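/- Let $D\subset\mathbb R^2$ be the bounded domain enclosed by a smooth Jordan curve $\partial D$ (smooth meaning that the curve has a $C^\infty$ regular parametrization), with $\mathbf 0\in D$, and let $\Phi\neq0$. Let $G$ be a real-valued function that is continuous on $\overline D\smallsetminus\{\mathbf 0\}$, harmonic in $D\smallsetminus\{\mathbf 0\}$, constant on $\partial D$, whose singularity at the origin is at most logarithmic, $G(\boldsymbol r)=O(\log|\boldsymbol r|)$ as $\boldsymbol r\to\mathbf 0$, and which has flux $-\lim_{\varepsilon\to0^+}\oint_{|\boldsymbol r|=\varepsilon}\boldsymbol n\cdot\nabla G\,\mathrm ds=\Phi$, where $\boldsymbol n$ is the outward unit normal. Let $\Sigma=\{\boldsymbol r\in\overline D\smallsetminus\{\mathbf 0\}: G(\boldsymbol r)=\varphi\}$ be any non-empty level set of $G$ (the boundary $\partial D$ is one of them; there $\nabla G$ is the gradient taken from inside $D$). Then $\Sigma$ is a smooth Jordan curve, $\nabla G\neq\mathbf 0$ on $\Sigma$, and $|\nabla G|$ is a smooth function along $\Sigma$. Let $\kappa$ be the signed curvature of $\Sigma$, traversed counterclockwise (so that a unit circle has $\kappa=+1$), and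 let $$L_\Sigma=\oint_\Sigma\mathrm ds,\qquad \langle f\rangle_\Sigma=\frac1{L_\Sigma}\oint_\Sigma f\,\mathrm ds,\qquad \operatorname{cov}_\Sigma(f_1,f_2)=\big\langle(f_1-\langle f_1\rangle_\Sigma)(f_2-\langle f_2\rangle_\Sigma)\big\rangle_\Sigma .$$ The following four inequalities hold: $$\operatorname{cov}_\Sigma\Big(\frac{\kappa}{|\nabla G|},|\nabla G|\Big)\le0,$$ $$\operatorname{cov}_\Sigma\Big(\frac{\kappa}{2\pi},\log\frac{|\nabla G|L_\Sigma}{|\Phi|}\Big)\le\operatorname{cov}_\Sigma\Big(\frac{|\nabla G|}{|\Phi|},\log\frac{|\nabla G|L_\Sigma}{|\Phi|}\Big),$$ $$\Big\langle\Big[\boldsymbol n\times\nabla\frac{\kappa}{|\nabla G|}\Big]\cdot\Big[\boldsymbol n\times\nabla\frac1{|\nabla G|}\Big]\Big\rangle_\Sigma\ge0,$$ $$\Big\langle\frac{\kappa}{|\nabla G|^2}\Big\rangle_\Sigma\ge\frac{2\pi}{|\Phi|}\Big\langle\frac1{|\nabla G|}\Big\rangle_\Sigma,$$ where $\boldsymbol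 n\times\nabla f$ is the tangential gradient of $f$ along $\Sigma$ up to a rotation by $90^\circ$, so that $[\boldsymbol n\times\nabla f_1]\cdot[\boldsymbol n\times\nabla f_2]=\frac{\partial f_1}{\partial s}\frac{\partial f_2}{\partial s}$ with $s$ the arc length. Each of the four inequalities is strict unless $\partial D$ is a circle centred at $\mathbf 0$, in which case each of them is an equality. -/

import Mathlib

open Set Filter Topology MeasureTheory
open scoped ContDiff

noncomputable section

namespace GreenLevel

/-! The plane is `ℂ`, with its Euclidean norm and real inner product. -/

/-- `c` is a smooth regular `1`-periodic parametrization of a simple closed curve with image `S`,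
traversed counterclockwise (the signed area `½ ∮ (x dy - y dx)` is positive). -/
structure IsPosParam (c : ℝ → ℂ) (S : Set ℂ) : Prop where
  smooth : ContDiff ℝ ∞ c
  periodic : Function.Periodic c 1
  regular : ∀ t, deriv c t ≠ 0
  injOn : InjOn c (Ico 0 1)
  range_eq : range c = S
  pos : 0 < (1 / 2 : ℝ) * ∫ t in (0 : ℝ)..1, ((c t).re * (deriv c t).im - (c t).im * (deriv c t).re)

/-- A smooth Jordan curve in the plane. -/
def IsSmoothJordanCurve (S : Set ℂ) : Prop := ∃ c : ℝ → ℂ, IsPosParam c S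

/-- `D` is a bounded domain containing the origin whose boundary is a smooth Jordan curve, that is,
the region enclosed by a smooth Jordan curve around the origin. -/
structure IsSmoothJordanInterior (D : Set ℂ) : Prop where
  isOpen : IsOpen D
  isConnected : IsConnected D
  isBounded : Bornology.IsBounded D
  zero_mem : (0 : ℂ) ∈ D
  frontier_jordan : IsSmoothJordanCurve (frontier D)

/-- `G` solves the interior Dirichlet problem on `D` with a logarithmic pole of flux `Φ` at the
origin. The value `G 0` is irrelevant. -/
structure IsGreen (D : Set ℂ) (Φ : ℝ) (G : ℂ → ℝ) : Prop where
  harmonic : InnerProductSpace.HarmonicOnNhd G (D \ {0})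
  continuousOn : ContinuousOn G (closure D \ {0})
  boundary : ∃ a : ℝ, ∀ z ∈ frontier D, G z = a
  /-- The singularity at the origin is at most logarithmic (no multipoles). -/
  log_sing : G =O[𝓝[≠] (0 : ℂ)] fun z => Real.log ‖z‖
  /-- `-∮_{|r| = ε} n · ∇G ds → Φ` as `ε → 0+`. -/
  flux : Tendsto
    (fun ε : ℝ => -∫ θ in (0 : ℝ)..(2 * Real.pi),
      inner ℝ (circleMap 0 1 θ) (gradient G (circleMap 0 ε θ)) * ε)
    (𝓝[>] 0) (𝓝 Φ)

/-- The level set `{G = φ}` in the closed region punctured at the origin. -/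
def levelSet (D : Set ℂ) (G : ℂ → ℝ) (φ : ℝ) : Set ℂ := {z | z ∈ closure D \ {0} ∧ G z = φ}

/-- `|∇G|`; in `D` this is the norm of the usual gradient, and on the boundary of `D` the gradient
is taken from inside. -/
def gradNorm (D : Set ℂ) (G : ℂ → ℝ) (z : ℂ) : ℝ := ‖gradientWithin G (closure D) z‖

/-! Functions on a curve are given as functions of the parameter `t`. -/

/-- Arc length of the closed curve `c`. -/
def arcLength (c : ℝ → ℂ) : ℝ := ∫ t in (0 : ℝ)..1, ‖deriv c t‖

/-- The average `⟨f⟩` with respect to arc length. -/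
def avg (c : ℝ → ℂ) (f : ℝ → ℝ) : ℝ := (∫ t in (0 : ℝ)..1, f t * ‖deriv c t‖) / arcLength c

/-- The covariance with respect to arc length. -/
def cov (c : ℝ → ℂ) (f g : ℝ → ℝ) : ℝ := avg c fun t => (f t - avg c f) * (g t - avg c g)

/-- Signed curvature `(x' y'' - y' x'') / |c'|³`; it is `+1` for the counterclockwise unit circle. -/
def curvature (c : ℝ → ℂ) (t : ℝ) : ℝ :=
  ((deriv c t).re * (deriv (deriv c) t).im - (deriv c t).im * (deriv (deriv c) t).re) /
    ‖deriv c t‖ ^ 3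

/-- The derivative `∂f/∂s` with respect to arc length. It is the only component of the vector
`n × ∇f`, which is perpendicular to the plane. -/
def tangentialDeriv (c : ℝ → ℂ) (f : ℝ → ℝ) (t : ℝ) : ℝ := deriv f t / ‖deriv c t‖

/-- `S` is a circle centred at the origin. -/
def IsCenteredCircle (S : Set ℂ) : Prop := ∃ R : ℝ, 0 < R ∧ S = Metric.sphere 0 R

end GreenLevel

end

/-! Everything is transported to the unit disc. Let `a` be the boundary value of `G`. Then `G = a -
Φ/(2π) log|f|` for a conformal map `f` of `D` onto the disc with `f 0 = 0`. With `ψ` the inverse of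
`f`, the non-empty level sets are the images under `ψ` of the circles `|w| = r`, `0 < r ≤ 1`. Put
`χ(w) = ψ(rw)`, `l = log χ'`, `M = |χ'| = exp(Re l)` and `H = Re(w l')` (`speed` and `excess`). In
terms of the angle on the circle, `ds = M dθ`, `|∇G| = |Φ|/(2πM)` and `κ = (1 + H)/M`.

After substitution, and because `∫ H = 0`, the difference of the two sides of each inequality is a
positive multiple of one of `∫ H M`, `∫ H Re l`, `∫ Im(w(wl')') Im(wl')`, `∫ H M²`. These are
positive multiples of the Dirichlet energy `∫ Re(conj(h) w h') dθ = 2π ∑ n|aₙ|² ≥ 0` for `h =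
exp(l/2)`, `l`, `w l'`, `exp l` respectively (`integral_angDeriv_mul_exp`,
`integral_angDeriv_mul_log`, `integral_im_angDeriv_mul`). The energy vanishes only for constant `h`.
In all four cases this means that `l` is constant, so `ψ` is linear and `∂D` is a centred circle.

The longer half of the proof constructs `f` from `G` and shows that it is smooth up to the boundary.
The function `z (G_x - i G_y)` has a removable singularity at the origin, with value `-Φ/(2π)` fixed
by the flux and by single-valuedness of `G`. Once the pole is removed, the complex gradient has a
primitive because `∂D` is connected: a holomorphic function is locally the Cauchy transform of a
density of mass zero in a collar of `∂D`, and kernels with poles along a connected set differ by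
exact ones. This gives `f = z exp P` (`IsGreen.exists_log_form`). Since `|f| → 1` at `∂D` and the
only zero is simple, an open-closed argument in the disc shows that `f` is bijective
(`IsDiscMap.ball_subset_simple`).

For boundary smoothness, the curve is straightened by its Taylor polynomial in a complexified
parameter, a chart holomorphic to order `N` along the boundary. Solving a `∂̄`-equation corrects
`log f` in this chart to a holomorphic function whose real part still vanishes on the real axis, and
Schwarz reflection extends it (`exists_contDiffOn_extension`). Every finite order of smoothness is
reached by choosing `N`. The Hopf lemma shows that the derivative does not vanish on `∂D`, so the
inverse is smooth as well (`IsDiscMap.exists_conformalParam`). -/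

noncomputable section

namespace GreenLevel

open Complex ComplexConjugate

/-! ### Cauchy–Pompeiu formula and the inhomogeneous Cauchy–Riemann equation. -/

/-- Twice the Wirtinger derivative `∂/∂z̄`. -/
def dbar (φ : ℂ → ℂ) (z : ℂ) : ℂ := fderiv ℝ φ z 1 + I * fderiv ℝ φ z I

lemma fderiv_real_apply (φ : ℂ → ℂ) (z v : ℂ) :
    fderiv ℝ φ z v = (v.re : ℂ) * fderiv ℝ φ z 1 + (v.im : ℂ) * fderiv ℝ φ z I := by
  conv_lhs => rw [show v = v.re • (1 : ℂ) + v.im • I by simp]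
  rw [map_add, map_smul, map_smul]
  simp

/-- Cauchy–Riemann operator in the rotated frame `v, I * v`. With `v` the radial unit vector, it
turns the Cauchy–Pompeiu integrand into a radial plus an angular derivative. -/
lemma dbar_mul_conj (φ : ℂ → ℂ) (z v : ℂ) :
    dbar φ z * (starRingEnd ℂ) v = fderiv ℝ φ z v + I * fderiv ℝ φ z (I * v) := by
  rw [fderiv_real_apply φ z v, fderiv_real_apply φ z (I * v), dbar]
  have : (starRingEnd ℂ) v = v.re - v.im * I := by
    apply Complex.ext <;> simp
  rw [this]
  simp only [mul_re, I_re, I_im, mul_im]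
  push_cast
  linear_combination (-(v.im : ℂ) * fderiv ℝ φ z I) * I_sq

lemma differentiableAt_of_dbar_eq_zero {φ : ℂ → ℂ} {z : ℂ} (h : DifferentiableAt ℝ φ z)
    (h0 : dbar φ z = 0) : DifferentiableAt ℂ φ z := by
  refine differentiableAt_complex_iff_differentiableAt_real.2 ⟨h, ?_⟩
  rw [dbar] at h0
  rw [smul_eq_mul]
  linear_combination (-I) * h0 + fderiv ℝ φ z I * I_sq

lemma dbar_eq_zero {φ : ℂ → ℂ} {z : ℂ} (h : DifferentiableAt ℂ φ z) : dbar φ z = 0 := by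
  have := (differentiableAt_complex_iff_differentiableAt_real.1 h).2
  rw [dbar, this, smul_eq_mul]
  linear_combination (fderiv ℝ φ z 1) * I_sq

/-- In polar coordinates the Jacobian `r` cancels the singularity `1 / r`. -/
lemma integrableOn_inv_ball (R : ℝ) : IntegrableOn (fun w : ℂ => w⁻¹) (Metric.ball 0 R) := by
  have h : Integrable (fun w : ℂ => (Iio R).indicator (fun r : ℝ => r⁻¹) ‖w‖) := by
    have := (integrable_fun_norm_addHaar (volume : Measure ℂ)
      (f := (Iio R).indicator (fun r : ℝ => r⁻¹)))
    rw [this]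
    have h1 : IntegrableOn (fun _ : ℝ => (1 : ℝ)) (Ioo 0 R) := by
      simp [integrableOn_const_iff]
    rw [← integrable_indicator_iff measurableSet_Ioo] at h1
    refine (h1.integrableOn (s := Ioi 0)).congr_fun ?_ measurableSet_Ioi
    intro y hy
    have hy' : (0 : ℝ) < y := hy
    by_cases hyR : y < R
    · simp [Set.indicator, hy', hyR, Complex.finrank_real_complex, hy'.ne']
    · simp [Set.indicator, hyR]
  refine Integrable.mono (h.integrableOn) (by fun_prop) ?_
  refine (ae_restrict_iff' measurableSet_ball).2 (Eventually.of_forall fun w hw => ?_)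
  have : ‖w‖ < R := by simpa using hw
  simp [Set.indicator, this]

lemma locallyIntegrable_inv : LocallyIntegrable (fun w : ℂ => w⁻¹) := by
  rw [locallyIntegrable_iff]
  intro k hk
  obtain ⟨R, hR⟩ := hk.isBounded.subset_ball 0
  exact (integrableOn_inv_ball R).mono_set hR

lemma hasCompactSupport_dbar {φ : ℂ → ℂ} (h : HasCompactSupport φ) :
    HasCompactSupport (dbar φ) := by
  refine (h.fderiv ℝ).mono' ?_
  intro z hz
  apply subset_closure
  contrapose! hz
  simp only [Function.mem_support, not_not] at hz
  simp [dbar, hz]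

lemma continuous_dbar {φ : ℂ → ℂ} (h : ContDiff ℝ 1 φ) : Continuous (dbar φ) := by
  have := h.continuous_fderiv one_ne_zero
  unfold dbar
  fun_prop

/-- The Cauchy–Pompeiu formula for compactly supported functions. -/
theorem integral_dbar_div {φ : ℂ → ℂ} (h : ContDiff ℝ 1 φ) (hc : HasCompactSupport φ) :
    ∫ w, w⁻¹ * dbar φ w = -(2 * Real.pi) * φ 0 := by
  obtain ⟨R, hR⟩ := hc.isCompact.isBounded.subset_ball (0 : ℂ)
  have hRpos : 0 < max R 1 := by positivity
  set R' := max R 1 with hR'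
  have hdφ := h.continuous_fderiv one_ne_zero
  have hsupp : ∀ z : ℂ, R' ≤ ‖z‖ → fderiv ℝ φ z = 0 := by
    intro z hz
    by_contra hne
    have : z ∈ tsupport φ := support_fderiv_subset ℝ hne
    have := hR this
    simp at this
    linarith [le_max_left R 1]
  have hsupp0 : ∀ z : ℂ, R' ≤ ‖z‖ → φ z = 0 := by
    intro z hz
    by_contra hne
    have : z ∈ tsupport φ := subset_closure hne
    have := hR this
    simp at this
    linarith [le_max_left R 1]
  rw [← Complex.integral_comp_polarCoord_symm]
  set u : ℝ → ℂ := fun θ => exp (θ * I) with hu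
  have hucont : Continuous u := by fun_prop
  have hunorm : ∀ θ, ‖u θ‖ = 1 := fun θ => by simp [hu, norm_exp_ofReal_mul_I]
  -- The Jacobian cancels the modulus of `w⁻¹`, leaving `conj u * dbar φ` with `u` the radial unit
  -- vector.
  have key : ∀ p ∈ polarCoord.target, p.1 • ((Complex.polarCoord.symm p)⁻¹ *
      dbar φ (Complex.polarCoord.symm p)) =
      fderiv ℝ φ (p.1 * u p.2) (u p.2) + I * fderiv ℝ φ (p.1 * u p.2) (I * u p.2) := by
    rintro ⟨r, θ⟩ hp
    have hr : 0 < r := by simpa [polarCoord] using hp.1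
    have e : Complex.polarCoord.symm (r, θ) = r * u θ := by
      simp [Complex.polarCoord_symm_apply, hu, exp_mul_I]
    rw [e, ← dbar_mul_conj]
    have hne : u θ ≠ 0 := by simp [hu]
    have hc : (starRingEnd ℂ) (u θ) = (u θ)⁻¹ := by
      rw [Complex.inv_def]
      simp [Complex.normSq_eq_norm_sq, hunorm]
    rw [hc]
    have : (r : ℂ) ≠ 0 := by exact_mod_cast hr.ne'
    simp only [real_smul]
    field_simp
  rw [setIntegral_congr_fun polarCoord.open_target.measurableSet key]
  have htarget : polarCoord.target = Ioi (0 : ℝ) ×ˢ Ioo (-Real.pi) Real.pi := rfl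
  have hInt : ∀ v : ℝ → ℂ, Continuous v → IntegrableOn
      (fun p : ℝ × ℝ => fderiv ℝ φ (p.1 * u p.2) (v p.2)) polarCoord.target := by
    intro v hv
    have hcont : Continuous (fun p : ℝ × ℝ => fderiv ℝ φ (p.1 * u p.2) (v p.2)) := by
      have : Continuous (fun p : ℝ × ℝ => fderiv ℝ φ (p.1 * u p.2)) := by fun_prop
      fun_prop
    have h1 : IntegrableOn (fun p : ℝ × ℝ => fderiv ℝ φ (p.1 * u p.2) (v p.2))
        (Icc 0 R' ×ˢ Icc (-Real.pi) Real.pi) :=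
      hcont.continuousOn.integrableOn_compact (isCompact_Icc.prod isCompact_Icc)
    -- Beyond radius `R'` the derivative vanishes, so integrability on the unbounded strip reduces
    -- to a compact rectangle.
    refine h1.of_forall_sdiff_eq_zero polarCoord.open_target.measurableSet ?_
    rintro ⟨r, θ⟩ ⟨hp, hp'⟩
    rw [htarget] at hp
    have hr : R' ≤ r := by
      by_contra hlt
      exact hp' ⟨⟨hp.1.le, (not_le.1 hlt).le⟩, ⟨hp.2.1.le, hp.2.2.le⟩⟩
    have : R' ≤ ‖(r : ℂ) * u θ‖ := by
      rw [norm_mul, hunorm, mul_one, norm_real]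
      exact hr.trans (le_abs_self r)
    simp [hsupp _ this]
  rw [integral_add (hInt u hucont) ((hInt (fun θ => I * u θ) (by fun_prop)).const_mul I),
    integral_const_mul]
  -- On each ray the radial derivative integrates to `-φ 0`, by compact support.
  have hrad : ∫ p in polarCoord.target, fderiv ℝ φ (p.1 * u p.2) (u p.2) =
      -(2 * Real.pi) * φ 0 := by
    have hi := hInt u hucont
    rw [htarget, IntegrableOn, Measure.volume_eq_prod, ← Measure.prod_restrict] at hi
    rw [htarget, Measure.volume_eq_prod, ← Measure.prod_restrict, integral_prod_symm _ hi]
    have : ∀ θ : ℝ, ∫ r in Ioi (0 : ℝ), fderiv ℝ φ (r * u θ) (u θ) = - φ 0 := by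
      intro θ
      have hd : ∀ r : ℝ, HasDerivAt (fun r : ℝ => φ (r * u θ)) (fderiv ℝ φ (r * u θ) (u θ)) r := by
        intro r
        have h1 : HasDerivAt (fun r : ℝ => (r : ℂ) * u θ) (u θ) r := by
          simpa using (hasDerivAt_id (r : ℂ)).comp_ofReal.mul_const (u θ)
        exact ((h.differentiable one_ne_zero).differentiableAt.hasFDerivAt).comp_hasDerivAt r h1
      have hcontr : Continuous (fun r : ℝ => fderiv ℝ φ (r * u θ) (u θ)) := by
        have : Continuous (fun r : ℝ => fderiv ℝ φ (r * u θ)) := by fun_prop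
        fun_prop
      have h0 : ∀ r : ℝ, R' ≤ r → R' ≤ ‖(r : ℂ) * u θ‖ := by
        intro r hr
        rw [norm_mul, hunorm, mul_one, norm_real]
        exact hr.trans (le_abs_self r)
      have hi : IntegrableOn (fun r : ℝ => fderiv ℝ φ (r * u θ) (u θ)) (Ioi 0) := by
        have h1 : IntegrableOn (fun r : ℝ => fderiv ℝ φ (r * u θ) (u θ)) (Icc 0 R') :=
          hcontr.continuousOn.integrableOn_compact isCompact_Icc
        refine h1.of_forall_sdiff_eq_zero measurableSet_Ioi ?_
        rintro r ⟨hr, hr'⟩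
        have : R' ≤ r := by
          by_contra hlt
          exact hr' ⟨le_of_lt hr, (not_le.1 hlt).le⟩
        simp [hsupp _ (h0 r this)]
      have ht : Tendsto (fun r : ℝ => φ (r * u θ)) atTop (𝓝 0) := by
        refine tendsto_const_nhds.congr' ?_
        filter_upwards [eventually_ge_atTop R'] with r hr
        exact (hsupp0 _ (h0 r hr)).symm
      have := integral_Ioi_of_hasDerivAt_of_tendsto
        ((hd 0).continuousAt.continuousWithinAt) (fun r _ => hd r) hi ht
      simpa using this
    simp only [this]
    simp only [setIntegral_const, smul_neg]
    rw [Real.volume_real_Ioo_of_le (by linarith [Real.pi_pos])]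
    simp only [real_smul]
    push_cast
    ring
  -- On each circle the angular derivative integrates to zero by periodicity.
  have hang : ∫ p in polarCoord.target, fderiv ℝ φ (p.1 * u p.2) (I * u p.2) = 0 := by
    have hi := hInt (fun θ => I * u θ) (by fun_prop)
    rw [htarget, IntegrableOn, Measure.volume_eq_prod, ← Measure.prod_restrict] at hi
    rw [htarget, Measure.volume_eq_prod, ← Measure.prod_restrict, integral_prod _ hi]
    refine (setIntegral_congr_fun measurableSet_Ioi (g := fun _ => (0 : ℂ)) ?_).trans (by simp)
    intro r hr
    have hr : (0 : ℝ) < r := hr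
    simp only
    have hd : ∀ θ : ℝ, HasDerivAt (fun θ : ℝ => φ (r * u θ))
        (r * fderiv ℝ φ (r * u θ) (I * u θ)) θ := by
      intro θ
      have h1 : HasDerivAt (fun θ : ℝ => (r : ℂ) * u θ) ((r : ℝ) • (I * u θ)) θ := by
        have h2 : HasDerivAt (fun θ : ℝ => (θ : ℂ) * I) I θ := by
          simpa using (hasDerivAt_id (θ : ℂ)).comp_ofReal.mul_const I
        refine ((h2.cexp).const_mul (r : ℂ)).congr_deriv ?_
        simp only [hu, real_smul]
        ring
      have := ((h.differentiable one_ne_zero).differentiableAt.hasFDerivAt).comp_hasDerivAt θ h1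
      rw [map_smul] at this
      exact this.congr_deriv (by simp)
    rw [← integral_Ioc_eq_integral_Ioo, ← intervalIntegral.integral_of_le (by linarith [Real.pi_pos])]
    have hcontr : Continuous (fun θ : ℝ => fderiv ℝ φ (r * u θ) (I * u θ)) := by
      have : Continuous (fun θ : ℝ => fderiv ℝ φ (r * u θ)) := by fun_prop
      fun_prop
    have := intervalIntegral.integral_eq_sub_of_hasDerivAt (a := -Real.pi) (b := Real.pi)
      (fun θ _ => hd θ) ((continuous_const.mul hcontr).intervalIntegrable _ _)
    rw [intervalIntegral.integral_const_mul] at this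
    have hu1 : u Real.pi = u (-Real.pi) := by
      simp [hu, exp_pi_mul_I, Complex.exp_neg]
    rw [hu1, sub_self] at this
    have hr' : (r : ℂ) ≠ 0 := by exact_mod_cast hr.ne'
    exact (mul_eq_zero.1 this).resolve_left hr'
  rw [hrad, hang]
  simp

/-- Solution of the inhomogeneous Cauchy–Riemann equation with compactly supported right side. -/
theorem exists_dbar_eq {n : ℕ} {h : ℂ → ℂ} (hn : ContDiff ℝ (n + 1) h) (hc : HasCompactSupport h) :
    ∃ u : ℂ → ℂ, ContDiff ℝ (n + 1) u ∧ ∀ z, dbar u z = h z := by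
  set L : ℂ →L[ℝ] ℂ →L[ℝ] ℂ := ContinuousLinearMap.mul ℝ ℂ
  have h1 : ContDiff ℝ 1 h := hn.of_le (by simp)
  set u : ℂ → ℂ := convolution (fun w : ℂ => w⁻¹) h L volume
  have hcu : ContDiff ℝ (n + 1) u :=
    hc.contDiff_convolution_right L locallyIntegrable_inv hn
  have hfd : ∀ z v, fderiv ℝ u z v = ∫ w, w⁻¹ * fderiv ℝ h (z - w) v := by
    intro z v
    rw [(hc.hasFDerivAt_convolution_right L locallyIntegrable_inv h1 z).fderiv]
    rw [convolution_precompR_apply L locallyIntegrable_inv (hc.fderiv ℝ)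
      (h1.continuous_fderiv one_ne_zero)]
    rfl
  have hInt : ∀ z v, Integrable (fun w => w⁻¹ * fderiv ℝ h (z - w) v) := by
    intro z v
    have := ((hc.fderiv_apply ℝ v).convolutionExists_right L locallyIntegrable_inv
      ((h1.continuous_fderiv one_ne_zero).clm_apply continuous_const)) z
    exact this
  -- The derivatives fall on `h`, and Cauchy–Pompeiu applies to `w ↦ h (z - w)`. The constant is
  -- `2π` rather than `π` because `dbar` is twice the Wirtinger derivative.
  have hdb : ∀ z, dbar u z = 2 * Real.pi * h z := by
    intro z
    rw [dbar, hfd, hfd, ← integral_const_mul, ← integral_add (hInt z 1) ((hInt z I).const_mul I)]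
    have hφ : ContDiff ℝ 1 (fun w => h (z - w)) := h1.comp (contDiff_const.sub contDiff_id)
    have hφc : HasCompactSupport (fun w => h (z - w)) :=
      hc.comp_homeomorph (Homeomorph.subLeft z)
    have hp := integral_dbar_div hφ hφc
    have hd : ∀ w, dbar (fun w => h (z - w)) w = - dbar h (z - w) := by
      intro w
      have : HasFDerivAt (fun w => h (z - w)) (-(fderiv ℝ h (z - w))) w := by
        have h2 : HasFDerivAt (fun w : ℂ => z - w) (-(ContinuousLinearMap.id ℝ ℂ)) w :=
          (hasFDerivAt_id w).const_sub z
        refine (((h1.differentiable one_ne_zero).differentiableAt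
          (x := z - w)).hasFDerivAt.comp w h2).congr_fderiv ?_
        ext
        simp
      rw [dbar, this.fderiv, dbar]
      simp only [neg_apply]
      ring
    simp only [hd, mul_neg, integral_neg, sub_zero] at hp
    rw [show (2 * Real.pi * h z : ℂ) = -(-(2 * Real.pi) * h z) by ring, ← hp, neg_neg]
    congr 1
    ext w
    simp only [dbar]
    ring
  refine ⟨fun z => (2 * Real.pi : ℂ)⁻¹ * u z, contDiff_const.mul hcu, fun z => ?_⟩
  have hdz : DifferentiableAt ℝ u z := (hcu.differentiable (by simp)) z
  have : dbar (fun z => (2 * Real.pi : ℂ)⁻¹ * u z) z = (2 * Real.pi : ℂ)⁻¹ * dbar u z := by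
    simp only [dbar, fderiv_const_mul hdz]
    simp only [smul_apply, smul_eq_mul]
    ring
  rw [this, hdb]
  have : (Real.pi : ℂ) ≠ 0 := by exact_mod_cast Real.pi_ne_zero
  field_simp

/-! ### Primitives on bounded domains with connected boundary. -/

lemma isExactOn_add {f g : ℂ → ℂ} {U : Set ℂ} (hf : IsExactOn f U) (hg : IsExactOn g U) :
    IsExactOn (fun z => f z + g z) U := by
  obtain ⟨F, hF⟩ := hf
  obtain ⟨H, hH⟩ := hg
  exact ⟨fun z => F z + H z, fun z hz => (hF z hz).add (hH z hz)⟩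

lemma isExactOn_const_mul {f : ℂ → ℂ} {U : Set ℂ} (c : ℂ) (hf : IsExactOn f U) :
    IsExactOn (fun z => c * f z) U := by
  obtain ⟨F, hF⟩ := hf
  exact ⟨fun z => c * F z, fun z hz => (hF z hz).const_mul c⟩

lemma isExactOn_congr {f g : ℂ → ℂ} {U : Set ℂ} (hf : IsExactOn f U) (h : ∀ z ∈ U, f z = g z) :
    IsExactOn g U := by
  obtain ⟨F, hF⟩ := hf
  exact ⟨F, fun z hz => h z hz ▸ hF z hz⟩

/-- The primitive is `-log((w - z)/(p - z))`. If `w` is closer to `p` than `z` is, this quotient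
stays in the unit disc around `1`, where the principal branch is holomorphic. -/
lemma hasDerivAt_log_quot {w p z : ℂ} (h : ‖w - p‖ < ‖z - p‖) :
    HasDerivAt (fun z => -log (1 + (w - p) / (p - z))) ((w - z)⁻¹ - (p - z)⁻¹) z := by
  have hpz : p - z ≠ 0 := by
    intro h0
    rw [norm_sub_rev z p, h0, norm_zero] at h
    exact absurd h (not_lt.2 (norm_nonneg _))
  have hlt : ‖(w - p) / (p - z)‖ < 1 := by
    rw [norm_div, norm_sub_rev p z]
    exact (div_lt_one ((norm_nonneg _).trans_lt h)).2 h
  have hslit : 1 + (w - p) / (p - z) ∈ slitPlane := mem_slitPlane_of_norm_lt_one hlt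
  have hwz : w - z ≠ 0 := by
    intro h0
    have : w = z := sub_eq_zero.1 h0
    rw [this] at h
    exact lt_irrefl _ h
  have h1 : HasDerivAt (fun z => 1 + (w - p) / (p - z)) ((w - p) / (p - z) ^ 2) z := by
    have h2 : HasDerivAt (fun z : ℂ => p - z) (-1) z := (hasDerivAt_id z).const_sub p
    refine ((h2.fun_inv hpz).const_mul (w - p) |>.const_add 1).congr_deriv ?_
    simp [div_eq_mul_inv]
  refine (h1.clog hslit).neg.congr_deriv ?_
  have h3 : (1 + (w - p) / (p - z)) = (w - z) / (p - z) := by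
    field_simp
    ring
  rw [h3]
  field_simp
  ring

lemma isExactOn_inv_sub_inv {w p : ℂ} {U : Set ℂ} (h : ∀ z ∈ U, ‖w - p‖ < ‖z - p‖) :
    IsExactOn (fun z => (w - z)⁻¹ - (p - z)⁻¹) U :=
  ⟨_, fun z hz => hasDerivAt_log_quot (h z hz)⟩

/-- Integration of the logarithmic primitives over `w`. The margin `2 * r` against `r` keeps both
`‖w - z‖` and `‖p - z‖` at least `r`, which dominates the derivative. -/
lemma isExactOn_setIntegral {k : ℂ → ℂ} (hk : Integrable k) {B U : Set ℂ} (hB : MeasurableSet B)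
    (hU : IsOpen U) {p : ℂ} {r : ℝ} (hr : 0 < r) (hBr : ∀ w ∈ B, ‖w - p‖ < r)
    (hUr : ∀ z ∈ U, 2 * r ≤ ‖z - p‖) :
    IsExactOn (fun z => ∫ w in B, k w * ((w - z)⁻¹ - (p - z)⁻¹)) U := by
  refine ⟨fun z => ∫ w in B, k w * (-log (1 + (w - p) / (p - z))), fun z hz => ?_⟩
  refine (hasDerivAt_integral_of_dominated_loc_of_deriv_le (s := U)
    (F := fun z w => k w * (-log (1 + (w - p) / (p - z))))
    (F' := fun z w => k w * ((w - z)⁻¹ - (p - z)⁻¹))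
    (bound := fun w => ‖k w‖ * (r⁻¹ + r⁻¹)) (hU.mem_nhds hz) ?_ ?_ ?_ ?_ ?_ ?_).2
  · refine Eventually.of_forall fun x => ?_
    refine hk.aestronglyMeasurable.restrict.mul ?_
    exact Measurable.aestronglyMeasurable (by fun_prop)
  · refine Integrable.mono' (g := fun w => ‖k w‖ * (3 / 2)) ?_ ?_ ?_
    · exact (hk.norm.mul_const _).integrableOn
    · refine hk.aestronglyMeasurable.restrict.mul ?_
      exact Measurable.aestronglyMeasurable (by fun_prop)
    · refine (ae_restrict_iff' hB).2 (Eventually.of_forall fun w hw => ?_)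
      rw [norm_mul, norm_neg]
      gcongr
      have h1 : ‖(w - p) / (p - z)‖ ≤ 1 / 2 := by
        rw [norm_div, norm_sub_rev p z, div_le_iff₀ (by linarith [hUr z hz])]
        linarith [hUr z hz, hBr w hw]
      refine (norm_log_one_add_half_le_self h1).trans ?_
      linarith
  · refine hk.aestronglyMeasurable.restrict.mul ?_
    exact Measurable.aestronglyMeasurable (by fun_prop)
  · refine (ae_restrict_iff' hB).2 (Eventually.of_forall fun w hw x hx => ?_)
    rw [norm_mul]
    gcongr
    refine (norm_sub_le _ _).trans ?_
    rw [norm_inv, norm_inv]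
    have h2 := hUr x hx
    have h3 := hBr w hw
    have h4 : r ≤ ‖p - x‖ := by rw [norm_sub_rev]; linarith
    have h5 : r ≤ ‖w - x‖ := by
      have : ‖x - p‖ ≤ ‖w - x‖ + ‖w - p‖ := by
        calc ‖x - p‖ = ‖(w - p) - (w - x)‖ := by congr 1; ring
          _ ≤ ‖w - p‖ + ‖w - x‖ := norm_sub_le _ _
          _ = _ := add_comm _ _
      linarith
    gcongr
  · exact (hk.norm.mul_const _).integrableOn
  · refine (ae_restrict_iff' hB).2 (Eventually.of_forall fun w hw x hx => ?_)
    exact (hasDerivAt_log_quot (by linarith [hUr x hx, hBr w hw])).const_mul _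

/-- A Cauchy transform of an integrable density of total mass zero, carried by a finite union of
balls centred on a connected set, has a primitive away from that set. -/
lemma isExactOn_cauchyTransform {k : ℂ → ℂ} (hk : Integrable k) {S U : Set ℂ} (hU : IsOpen U)
    (hS : IsPreconnected S) {r : ℝ} (hr : 0 < r) (hUr : ∀ z ∈ U, ∀ p ∈ S, 2 * r ≤ ‖z - p‖)
    {p₀ : ℂ} (hp₀ : p₀ ∈ S) (t : Finset ℂ) (ht : ∀ p ∈ t, p ∈ S) :
    ∀ B : Set ℂ, MeasurableSet B → (∀ w ∈ B, ∃ p ∈ t, ‖w - p‖ < r) →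
    IsExactOn (fun z => ∫ w in B, k w * ((w - z)⁻¹ - (p₀ - z)⁻¹)) U := by
  -- This is where connectedness enters: "the kernels with poles `a` and `b` differ by an exact
  -- function" is symmetric, transitive and true for nearby poles, hence true for any two points of
  -- `S`.
  have chain : ∀ p ∈ S, IsExactOn (fun z => (p - z)⁻¹ - (p₀ - z)⁻¹) U := by
    intro p hp
    refine hS.induction₂ (fun a b => IsExactOn (fun z => (a - z)⁻¹ - (b - z)⁻¹) U)
      ?_ ?_ ?_ hp hp₀
    · intro x hx
      filter_upwards [nhdsWithin_le_nhds (Metric.ball_mem_nhds x hr), self_mem_nhdsWithin]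
        with y hy hyS
      refine isExactOn_inv_sub_inv fun z hz => ?_
      have := hUr z hz y hyS
      rw [mem_ball_iff_norm, norm_sub_rev] at hy
      linarith
    · intro x y z _ _ _ h1 h2
      exact isExactOn_congr (isExactOn_add h1 h2) (fun z _ => by ring)
    · intro x y _ _ h
      exact isExactOn_congr (isExactOn_const_mul (-1) h) (fun z _ => by ring)
  induction t using Finset.induction_on with
  | empty =>
    intro B hB h
    have : B = ∅ := by
      ext w
      simp only [mem_empty_iff_false, iff_false]
      intro hw
      obtain ⟨p, hp, -⟩ := h w hw
      simp at hp
    exact ⟨fun _ => 0, fun z _ => by simpa [this] using hasDerivAt_const z (0 : ℂ)⟩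
  | insert p t hpt ih =>
    -- One ball is split off. There the kernel is recentred from `p` to `p₀`, which costs the mass
    -- in the ball times the exact function provided by `chain`.
    intro B hB h
    set B₁ := B ∩ Metric.ball p r
    set B₂ := B \ Metric.ball p r
    have hB₁ : MeasurableSet B₁ := hB.inter measurableSet_ball
    have hB₂ : MeasurableSet B₂ := hB.diff measurableSet_ball
    have hpS : p ∈ S := ht p (Finset.mem_insert_self p t)
    have hB₁r : ∀ w ∈ B₁, ‖w - p‖ < r := fun w hw => mem_ball_iff_norm.1 hw.2
    have e1 := isExactOn_setIntegral hk hB₁ hU hr hB₁r (fun z hz => hUr z hz p hpS)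
    have e2 := isExactOn_const_mul (∫ w in B₁, k w) (chain p hpS)
    have e3 := ih (fun q hq => ht q (Finset.mem_insert_of_mem hq)) B₂ hB₂ (by
      intro w hw
      obtain ⟨q, hq, hwq⟩ := h w hw.1
      rcases Finset.mem_insert.1 hq with rfl | hq
      · exact absurd (mem_ball_iff_norm.2 hwq) hw.2
      · exact ⟨q, hq, hwq⟩)
    refine isExactOn_congr (isExactOn_add (isExactOn_add e1 e2) e3) fun z hz => ?_
    have hInt : ∀ B' ⊆ B, MeasurableSet B' → ∀ q ∈ S,
        IntegrableOn (fun w => k w * ((w - z)⁻¹ - (q - z)⁻¹)) B' := by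
      intro B' hB' hmB' q hq
      refine Integrable.mono' (g := fun w => ‖k w‖ * (r⁻¹ + r⁻¹))
        (hk.norm.mul_const _).integrableOn ?_ ?_
      · refine hk.aestronglyMeasurable.restrict.mul ?_
        exact Measurable.aestronglyMeasurable (by fun_prop)
      · refine (ae_restrict_iff' hmB').2 (Eventually.of_forall fun w hw => ?_)
        rw [norm_mul]
        gcongr
        refine (norm_sub_le _ _).trans ?_
        rw [norm_inv, norm_inv]
        obtain ⟨q', hq', hwq'⟩ := h w (hB' hw)
        have h2 := hUr z hz q' (ht q' hq')
        have h4 : r ≤ ‖q - z‖ := by rw [norm_sub_rev]; linarith [hUr z hz q hq]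
        have h5 : r ≤ ‖w - z‖ := by
          have : ‖z - q'‖ ≤ ‖w - q'‖ + ‖w - z‖ := by
            calc ‖z - q'‖ = ‖(w - q') - (w - z)‖ := by congr 1; ring
              _ ≤ ‖w - q'‖ + ‖w - z‖ := norm_sub_le _ _
          linarith
        gcongr
    have hun : B = B₁ ∪ B₂ := (inter_union_sdiff B _).symm
    have hdis : Disjoint B₁ B₂ := disjoint_sdiff_inter.symm
    rw [hun, setIntegral_union hdis hB₂ (hInt B₁ inter_subset_left hB₁ p₀ hp₀)
      (hInt B₂ sdiff_subset hB₂ p₀ hp₀)]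
    congr 1
    rw [← integral_mul_const, ← integral_add (hInt B₁ inter_subset_left hB₁ p hpS)
      (hk.integrableOn.mul_const _)]
    congr 1
    ext w
    ring

/-- Cauchy–Pompeiu for `w * φ w`, which vanishes at the origin and whose factor `w` cancels the
kernel. -/
lemma integral_dbar_eq_zero {φ : ℂ → ℂ} (h : ContDiff ℝ 1 φ) (hc : HasCompactSupport φ) :
    ∫ w, dbar φ w = 0 := by
  have h1 : ContDiff ℝ 1 (fun w => w * φ w) := contDiff_id.mul h
  have hc1 : HasCompactSupport (fun w => w * φ w) := hc.mul_left
  have := integral_dbar_div h1 hc1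
  rw [zero_mul, mul_zero] at this
  rw [← this]
  refine integral_congr_ae ?_
  have hne : ∀ᵐ w : ℂ, w ≠ 0 := by simp [ae_iff]
  filter_upwards [hne] with w hw
  have hd : DifferentiableAt ℝ φ w := h.differentiable one_ne_zero w
  have : dbar (fun w => w * φ w) w = w * dbar φ w := by
    simp only [dbar, fderiv_fun_mul differentiableAt_fun_id hd]
    simp only [fderiv_fun_id, add_apply, smul_apply, ContinuousLinearMap.id_apply, smul_eq_mul]
    linear_combination φ w * I_sq
  rw [this]
  field_simp

lemma integral_dbar_div_sub {φ : ℂ → ℂ} (h : ContDiff ℝ 1 φ) (hc : HasCompactSupport φ) (z : ℂ) :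
    ∫ w, dbar φ w * (w - z)⁻¹ = -(2 * Real.pi) * φ z := by
  have h1 : ContDiff ℝ 1 (fun w => φ (w + z)) := h.comp (contDiff_id.add contDiff_const)
  have hc1 : HasCompactSupport (fun w => φ (w + z)) := hc.comp_homeomorph (Homeomorph.addRight z)
  have := integral_dbar_div h1 hc1
  rw [zero_add] at this
  rw [← this, ← integral_add_right_eq_self _ z]
  congr 1
  ext w
  have : dbar (fun w => φ (w + z)) w = dbar φ (w + z) := by
    simp only [dbar, fderiv_comp_add_right]
  rw [this, add_sub_cancel_right, mul_comm]

/-- A holomorphic function on a bounded open set with connected boundary has a primitive at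
positive distance from the boundary. -/
lemma isExactOn_of_lt_infDist {D : Set ℂ} (hD : IsOpen D) (hb : Bornology.IsBounded D)
    (hne : (frontier D).Nonempty) (hf : IsPreconnected (frontier D)) {g : ℂ → ℂ}
    (hg : DifferentiableOn ℂ g D) {ρ : ℝ} (hρ : 0 < ρ) :
    IsExactOn g {z ∈ D | ρ < Metric.infDist z (frontier D)} := by
  set δ : ℂ → ℝ := fun z => Metric.infDist z (frontier D) with hδ
  have hδc : Continuous δ := Metric.continuous_infDist_pt _
  have hcl : closure D = D ∪ frontier D := closure_eq_self_union_frontier D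
  have hδ0 : ∀ z ∈ frontier D, δ z = 0 := fun z hz => Metric.infDist_zero_of_mem hz
  have hDfr : ∀ z ∈ closure D, z ∉ frontier D → z ∈ D := fun z hz hz' => by
    rw [hcl] at hz
    exact hz.resolve_right hz'
  set t : Set ℂ := {z ∈ closure D | ρ / 4 ≤ δ z}
  set s : Set ℂ := Dᶜ
  have ht : IsClosed t := isClosed_closure.inter (isClosed_le continuous_const hδc)
  have hst : Disjoint s t := by
    rw [Set.disjoint_left]
    rintro z hzs ⟨hz1, hz2⟩
    refine hzs (hDfr z hz1 fun h => ?_)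
    rw [hδ0 z h] at hz2
    linarith
  -- The cutoff vanishes near the complement of `D` and is `1` near the points at distance at least
  -- `ρ / 4` from the boundary. Hence `dbar (χ g)` is carried by a collar of the boundary, while `χ
  -- g = g` on the set in question.
  obtain ⟨χ, hχ0, hχ1, -⟩ := exists_contMDiffMap_zero_one_nhds_of_isClosed
    (modelWithCornersSelf ℝ ℂ) (n := 1) hD.isClosed_compl ht hst
  have hχs : ContDiff ℝ 1 χ := χ.contMDiff.contDiff
  set φ : ℂ → ℂ := fun z => (χ z : ℂ) * g z
  have hφ0 : ∀ z ∉ D, φ =ᶠ[𝓝 z] 0 := by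
    intro z hz
    filter_upwards [(eventually_nhdsSet_iff_forall.1 hχ0) z hz] with y hy
    simp [φ, hy]
  have hφ : ContDiff ℝ 1 φ := by
    rw [contDiff_iff_contDiffAt]
    intro z
    by_cases hz : z ∈ D
    · have h1 : ContDiffAt ℝ 1 g z :=
        ((hg.analyticAt (hD.mem_nhds hz)).contDiffAt).restrict_scalars ℝ
      exact (ofRealCLM.contDiff.contDiffAt.comp z hχs.contDiffAt).mul h1
    · exact contDiffAt_const.congr_of_eventuallyEq (hφ0 z hz)
  have hφc : HasCompactSupport φ := by
    refine HasCompactSupport.of_support_subset_isCompact hb.isCompact_closure fun z hz => ?_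
    by_contra hzD
    exact hz ((hφ0 z fun h => hzD (subset_closure h)).eq_of_nhds)
  set k := dbar φ
  have hkc : HasCompactSupport k := hasCompactSupport_dbar hφc
  have hk : Integrable k := (continuous_dbar hφ).integrable_of_hasCompactSupport hkc
  have hksupp : ∀ w, k w ≠ 0 → δ w < ρ / 4 := by
    intro w hw
    by_contra hge
    rw [not_lt] at hge
    apply hw
    by_cases hwD : w ∈ D
    · have h1 : φ =ᶠ[𝓝 w] g := by
        filter_upwards [(eventually_nhdsSet_iff_forall.1 hχ1) w ⟨subset_closure hwD, hge⟩] with y hy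
        simp [φ, hy]
      have : k w = dbar g w := by simp only [k, dbar, h1.fderiv_eq]
      rw [this]
      exact dbar_eq_zero (hg.differentiableAt (hD.mem_nhds hwD))
    · have : k w = dbar 0 w := by simp only [k, dbar, (hφ0 w hwD).fderiv_eq]
      rw [this]
      simp [dbar]
  have hfc : IsCompact (frontier D) := hb.isCompact_closure.of_isClosed_subset isClosed_frontier
    frontier_subset_closure
  obtain ⟨T, hT⟩ := hfc.elim_nhds_subcover' (fun p _ => Metric.ball p (ρ / 8))
    (fun p _ => Metric.ball_mem_nhds p (by positivity))
  obtain ⟨p₀, hp₀⟩ := hne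
  set B : Set ℂ := {w | δ w < ρ / 4}
  have hB : MeasurableSet B := (isOpen_lt hδc continuous_const).measurableSet
  classical
  have hU : IsOpen {z ∈ D | ρ < δ z} := hD.inter (isOpen_lt continuous_const hδc)
  -- A collar point is within `ρ / 4` of the boundary, and the boundary is covered by balls of
  -- radius `ρ / 8`. Their sum is below the radius `ρ / 2`, twice which is the distance kept by `z`.
  have hex := isExactOn_cauchyTransform hk hU hf (r := ρ / 2) (by positivity)
    (by
      rintro z ⟨-, hz⟩ p hp
      have : δ z ≤ dist z p := Metric.infDist_le_dist_of_mem hp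
      rw [dist_eq_norm] at this
      linarith) hp₀ (T.image Subtype.val) (by
      intro p hp
      obtain ⟨q, -, rfl⟩ := Finset.mem_image.1 hp
      exact q.2) B hB (by
      intro w hw
      obtain ⟨q, hq, hwq⟩ := (Metric.infDist_lt_iff ⟨p₀, hp₀⟩).1 hw
      obtain ⟨p, hp⟩ := mem_iUnion.1 (hT hq)
      obtain ⟨hpT, hpq⟩ := mem_iUnion.1 hp
      refine ⟨p, Finset.mem_image_of_mem _ hpT, ?_⟩
      rw [← dist_eq_norm]
      have : dist q p < ρ / 8 := hpq
      linarith [dist_triangle w q p])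
  refine isExactOn_congr (isExactOn_const_mul (-(2 * Real.pi))⁻¹ hex) fun z hz => ?_
  have hBk : ∀ F : ℂ → ℂ, ∫ w in B, k w * F w = ∫ w, k w * F w := by
    intro F
    refine setIntegral_eq_integral_of_forall_compl_eq_zero fun w hw => ?_
    by_cases h : k w = 0
    · simp [h]
    · exact absurd (hksupp w h) hw
  have hzg : φ z = g z := by
    have := (eventually_nhdsSet_iff_forall.1 hχ1) z ⟨subset_closure hz.1, by linarith [hz.2]⟩
    simp [φ, this.self_of_nhds]
  have hi1 : Integrable (fun w => k w * (w - z)⁻¹) := by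
    have hloc : LocallyIntegrable (fun w : ℂ => (w - z)⁻¹) := by
      rw [locallyIntegrable_iff]
      intro K hK
      obtain ⟨R, hR⟩ := hK.isBounded.subset_ball z
      have h1 := integrableOn_inv_ball R
      have := (measurePreserving_sub_right (volume : Measure ℂ) z).integrableOn_comp_preimage
        (MeasurableEquiv.subRight z).measurableEmbedding (f := fun w : ℂ => w⁻¹) (s := Metric.ball 0 R)
      refine (this.2 h1).mono_set fun w hw => ?_
      simpa [dist_eq_norm] using hR hw
    have := hloc.integrable_smul_left_of_hasCompactSupport (continuous_dbar hφ) hkc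
    exact this
  -- The subtracted kernel contributes nothing because `k` has total mass zero; the rest is
  -- Cauchy–Pompeiu at `z`.
  have : ∫ w in B, k w * ((w - z)⁻¹ - (p₀ - z)⁻¹) = -(2 * Real.pi) * g z := by
    rw [hBk]
    simp only [mul_sub]
    rw [integral_sub hi1 (hk.mul_const _), integral_dbar_div_sub hφ hφc, integral_mul_const,
      integral_dbar_eq_zero hφ hφc, hzg]
    ring
  rw [this]
  have : (Real.pi : ℂ) ≠ 0 := by exact_mod_cast Real.pi_ne_zero
  field_simp

/-- Holomorphic functions on a bounded domain with connected boundary have primitives. -/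
theorem isExactOn_of_isPreconnected_frontier {D : Set ℂ} (hD : IsOpen D) (hc : IsConnected D)
    (hb : Bornology.IsBounded D) (hne : (frontier D).Nonempty) (hf : IsPreconnected (frontier D))
    {g : ℂ → ℂ} (hg : DifferentiableOn ℂ g D) : IsExactOn g D := by
  obtain ⟨z₀, hz₀⟩ := hc.nonempty
  set δ : ℂ → ℝ := fun z => Metric.infDist z (frontier D) with hδ
  have hδc : Continuous δ := Metric.continuous_infDist_pt _
  set U : ℕ → Set ℂ := fun n => {z ∈ D | 1 / ((n : ℝ) + 1) < δ z}
  have hU : ∀ n, IsOpen (U n) := fun n => hD.inter (isOpen_lt continuous_const hδc)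
  have hUm : Monotone U := by
    intro m n hmn z hz
    refine ⟨hz.1, lt_of_le_of_lt ?_ hz.2⟩
    have : (m : ℝ) ≤ n := by exact_mod_cast hmn
    gcongr
  choose F hF0 hF using fun n : ℕ =>
    (isExactOn_of_lt_infDist hD hb hne hf hg (ρ := 1 / ((n : ℝ) + 1))
      (by positivity)).with_val_at z₀ 0
  -- The sets `U n` need not be connected. On the component of `z₀` the primitives normalized at
  -- `z₀` agree with all later ones, and these components still exhaust `D`, since a path in `D`
  -- keeps a positive distance from the boundary.
  set V : ℕ → Set ℂ := fun n => connectedComponentIn (U n) z₀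
  have hV : ∀ n, IsOpen (V n) := fun n => (hU n).connectedComponentIn
  have hVU : ∀ n, V n ⊆ U n := fun n => connectedComponentIn_subset _ _
  have hex : ∀ z ∈ D, ∃ n, z ∈ V n := by
    intro z hz
    obtain ⟨γ, hγ⟩ := (hD.isConnected_iff_isPathConnected.1 hc).joinedIn z₀ hz₀ z hz
    have hK : IsCompact (range γ) := isCompact_range γ.continuous
    obtain ⟨y, ⟨s, rfl⟩, hy⟩ := hK.exists_isMinOn (range_nonempty γ) hδc.continuousOn
    have hpos : 0 < δ (γ s) := by
      refine (isClosed_frontier.notMem_iff_infDist_pos hne).1 fun h => ?_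
      have := hγ s
      rw [hD.frontier_eq] at h
      exact h.2 this
    obtain ⟨n, hn⟩ := exists_nat_one_div_lt hpos
    refine ⟨n, ?_⟩
    have hsub : range γ ⊆ U n := by
      rintro _ ⟨u, rfl⟩
      exact ⟨hγ u, hn.trans_le (hy (mem_range_self u))⟩
    have hpre : IsPreconnected (range γ) := isPreconnected_range γ.continuous
    exact hpre.subset_connectedComponentIn ⟨0, γ.source⟩ hsub ⟨1, γ.target⟩
  have hVm : Monotone V := fun m n hmn => connectedComponentIn_mono z₀ (hUm hmn)
  have hagree : ∀ m n, m ≤ n → ∀ z ∈ V m, F m z = F n z := by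
    intro m n hmn z hz
    have hz₀m : z₀ ∈ V m := by
      by_contra h
      have : V m = ∅ := connectedComponentIn_eq_empty fun h' => h (mem_connectedComponentIn h')
      rw [this] at hz
      exact hz
    refine (hV m).eqOn_of_deriv_eq (f := F m) (g := F n) isPreconnected_connectedComponentIn
      ?_ ?_ ?_ hz₀m ?_ hz
    · exact fun w hw => (hF m w (hVU m hw)).differentiableAt.differentiableWithinAt
    · exact fun w hw => (hF n w (hUm hmn (hVU m hw))).differentiableAt.differentiableWithinAt
    · intro w hw
      rw [(hF m w (hVU m hw)).deriv, (hF n w (hUm hmn (hVU m hw))).deriv]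
    · rw [hF0, hF0]
  classical
  refine ⟨fun z => if h : ∃ n, z ∈ V n then F (Nat.find h) z else 0, fun z hz => ?_⟩
  obtain ⟨n, hn⟩ := hex z hz
  refine (hF n z (hVU n hn)).congr_of_eventuallyEq ?_
  filter_upwards [(hV n).mem_nhds hn] with y hy
  have h : ∃ n, y ∈ V n := ⟨n, hy⟩
  simp only [h, dif_pos]
  exact hagree _ _ (Nat.find_min' h hy) y (Nat.find_spec h)

/-! ### Schwarz reflection on a half disc. -/

/-- The open upper half of the disc of radius `r` around the origin. -/
def halfDisc (r : ℝ) : Set ℂ := Metric.ball 0 r ∩ {z | 0 < z.im}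

lemma isOpen_halfDisc (r : ℝ) : IsOpen (halfDisc r) :=
  Metric.isOpen_ball.inter (isOpen_lt continuous_const continuous_im)

lemma convex_halfDisc (r : ℝ) : Convex ℝ (halfDisc r) :=
  (convex_ball 0 r).inter (convex_halfSpace_im_gt 0)

/-- A bounded derivative on a convex set makes the primitive Lipschitz, so it extends continuously.
Integrating once thus gives boundary values to a function that is merely bounded. -/
lemma exists_lipschitz_primitive {X : ℂ → ℂ} {s : Set ℂ} (hs : Convex ℝ s) (ho : IsOpen s)
    (hX : DifferentiableOn ℂ X s) {M : ℝ} (hM : ∀ z ∈ s, ‖X z‖ ≤ M) :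
    ∃ Y : ℂ → ℂ, Continuous Y ∧ ∀ z ∈ s, HasDerivAt Y (X z) z := by
  obtain ⟨Y, hY⟩ := hs.exists_forall_hasDerivWithinAt hX
  have hlip : LipschitzOnWith M.toNNReal Y s := by
    refine hs.lipschitzOnWith_of_nnnorm_hasDerivWithin_le hY fun z hz => ?_
    rw [← NNReal.coe_le_coe, coe_nnnorm]
    exact (hM z hz).trans (Real.le_coe_toNNReal M)
  obtain ⟨Ye, hYe, heq⟩ := hlip.extend_finite_dimension
  refine ⟨Ye, hYe.continuous, fun z hz => ?_⟩
  refine ((hY z hz).hasDerivAt (ho.mem_nhds hz)).congr_of_eventuallyEq ?_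
  filter_upwards [ho.mem_nhds hz] with w hw
  exact (heq hw).symm

/-- A continuous function on a disc that is holomorphic off the real axis is holomorphic. -/
lemma differentiableOn_of_off_real {W : ℂ → ℂ} {r : ℝ} (hc : ContinuousOn W (Metric.ball 0 r))
    (hd : ∀ z ∈ Metric.ball (0 : ℂ) r, z.im ≠ 0 → DifferentiableAt ℂ W z) :
    DifferentiableOn ℂ W (Metric.ball 0 r) := by
  refine (isConservativeOn_and_continuousOn_iff_isDifferentiableOn Metric.isOpen_ball).1 ⟨?_, hc⟩
  intro z w hzw
  rw [← add_eq_zero_iff_eq_neg, wedgeIntegral_add_wedgeIntegral_eq]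
  have hmem : ∀ x ∈ uIcc z.re w.re, ∀ v : ℝ, (v = z.im ∨ v = w.im) → ∀ y ∈ uIcc v 0,
      (x + y * I : ℂ) ∈ Metric.ball (0 : ℂ) r := by
    intro x hx v hv y hy
    have h1 : (x + v * I : ℂ) ∈ Metric.ball (0 : ℂ) r := by
      apply hzw
      refine ⟨by simpa using hx, ?_⟩
      rcases hv with rfl | rfl <;> simp
    rw [mem_ball_zero_iff] at h1 ⊢
    refine lt_of_le_of_lt ?_ h1
    rw [Complex.norm_add_mul_I, Complex.norm_add_mul_I]
    apply Real.sqrt_le_sqrt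
    have : y ^ 2 ≤ v ^ 2 := by
      rw [sq_le_sq]
      rcases mem_uIcc.1 hy with h | h
      · rw [abs_of_nonpos h.2, abs_of_nonpos (h.1.trans h.2)]; linarith
      · rw [abs_of_nonneg h.1, abs_of_nonneg (h.1.trans h.2)]; linarith
    linarith
  -- Cauchy's theorem for a rectangle with one side on the real axis, whose interior misses the
  -- axis. The difference of two such rectangles yields the general one, and Morera's theorem
  -- applies.
  have key : ∀ v : ℝ, (v = z.im ∨ v = w.im) →
      (∫ x : ℝ in z.re..w.re, W (x + v * I)) - (∫ x : ℝ in z.re..w.re, W (x + (0 : ℝ) * I)) +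
      I • (∫ y : ℝ in v..0, W (w.re + y * I)) - I • (∫ y : ℝ in v..0, W (z.re + y * I)) = 0 := by
    intro v hv
    have := integral_boundary_rect_eq_zero_of_continuousOn_of_differentiableOn W
      (z.re + v * I) (w.re + (0 : ℝ) * I) ?_ ?_
    · simpa using this
    · refine hc.mono fun u hu => ?_
      have h1 : u.re ∈ uIcc z.re w.re := by simpa using hu.1
      have h2 : u.im ∈ uIcc v 0 := by simpa using hu.2
      have := hmem _ h1 v hv _ h2
      rwa [re_add_im] at this
    · intro u hu
      have h1 : u.re ∈ uIcc z.re w.re := by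
        have := hu.1
        simp only [add_re, ofReal_re, mul_re, I_re, mul_zero, ofReal_im, I_im, mul_one, sub_self,
          add_zero, mem_preimage, mem_Ioo] at this
        exact ⟨this.1.le, this.2.le⟩
      have h2 : u.im ∈ Ioo (min v 0) (max v 0) := by simpa using hu.2
      have h3 : u.im ∈ uIcc v 0 := ⟨h2.1.le, h2.2.le⟩
      have h4 := hmem _ h1 v hv _ h3
      rw [re_add_im] at h4
      refine (hd u h4 fun h0 => ?_).differentiableWithinAt
      rw [h0] at h2
      rcases le_total v 0 with hv0 | hv0
      · rw [max_eq_right hv0] at h2; exact lt_irrefl _ h2.2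
      · rw [min_eq_right hv0] at h2; exact lt_irrefl _ h2.1
  have hInt : ∀ x ∈ uIcc z.re w.re, ∀ v : ℝ, (v = z.im ∨ v = w.im) →
      IntervalIntegrable (fun y : ℝ => W (x + y * I)) volume v 0 := by
    intro x hx v hv
    refine ContinuousOn.intervalIntegrable ?_
    refine hc.comp (by fun_prop) fun y hy => hmem x hx v hv y hy
  have k1 := key z.im (Or.inl rfl)
  have k2 := key w.im (Or.inr rfl)
  rw [← intervalIntegral.integral_add_adjacent_intervals
      (hInt w.re right_mem_uIcc z.im (Or.inl rfl)) (hInt w.re right_mem_uIcc w.im (Or.inr rfl)).symm,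
    ← intervalIntegral.integral_add_adjacent_intervals
      (hInt z.re left_mem_uIcc z.im (Or.inl rfl)) (hInt z.re left_mem_uIcc w.im (Or.inr rfl)).symm,
    intervalIntegral.integral_symm w.im 0, intervalIntegral.integral_symm w.im 0]
  simp only [smul_eq_mul] at k1 k2 ⊢
  linear_combination k1 - k2

/-- Schwarz reflection: a holomorphic function on a half disc whose real part vanishes on the
diameter, in the sense of limits, extends holomorphically across the origin. -/
theorem exists_extension_of_tendsto_re {ρ : ℝ} (hρ : 0 < ρ) {K : ℂ → ℂ}
    (hK : DifferentiableOn ℂ K (halfDisc ρ))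
    (hlim : ∀ x : ℝ, |x| < ρ →
      Tendsto (fun z => (K z).re) (𝓝[{z | 0 < z.im}] (x : ℂ)) (𝓝 0)) :
    ∃ r > 0, r ≤ ρ ∧ ∃ Ke : ℂ → ℂ, DifferentiableOn ℂ Ke (Metric.ball 0 r) ∧
      ∀ z ∈ halfDisc r, Ke z = K z := by
  obtain ⟨ρ₁, hρ₁, hρ₁ρ, hb⟩ : ∃ ρ₁ > 0, ρ₁ ≤ ρ ∧ ∀ z ∈ halfDisc ρ₁, |(K z).re| ≤ 1 := by
    have h0 := hlim 0 (by simpa using hρ)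
    have := (Metric.tendsto_nhds.1 h0 1 one_pos)
    rw [eventually_nhdsWithin_iff, Metric.eventually_nhds_iff_ball] at this
    obtain ⟨ε, hε, h⟩ := this
    refine ⟨min ε ρ, lt_min hε hρ, min_le_right _ _, fun z hz => ?_⟩
    have h1 := h z (by simpa using (Metric.ball_subset_ball (min_le_left ε ρ)) hz.1) hz.2
    rw [Real.dist_eq, sub_zero] at h1
    exact h1.le
  have hsub : halfDisc ρ₁ ⊆ halfDisc ρ :=
    inter_subset_inter_left _ (Metric.ball_subset_ball hρ₁ρ)
  have hK₁ := hK.mono hsub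
  have hKd : ∀ z ∈ halfDisc ρ₁, DifferentiableAt ℂ K z := fun z hz =>
    hK₁.differentiableAt ((isOpen_halfDisc ρ₁).mem_nhds hz)
  -- Nothing is known about the imaginary part of `K` near the axis. The bound on the real part
  -- makes `exp K` and `exp (-K)` bounded, and their primitives are continuous up to the axis.
  obtain ⟨Y, hYc, hY⟩ := exists_lipschitz_primitive (X := fun z => exp (K z)) (M := Real.exp 1)
    (convex_halfDisc ρ₁) (isOpen_halfDisc ρ₁) hK₁.cexp (fun z hz => by
      rw [norm_exp]
      exact Real.exp_le_exp.2 (le_of_abs_le (hb z hz)))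
  obtain ⟨Z, hZc, hZ⟩ := exists_lipschitz_primitive (X := fun z => exp (-K z)) (M := Real.exp 1)
    (convex_halfDisc ρ₁) (isOpen_halfDisc ρ₁) hK₁.neg.cexp (fun z hz => by
      rw [norm_exp]
      exact Real.exp_le_exp.2 (by rw [neg_re]; linarith [neg_le_of_abs_le (hb z hz)]))
  have hmem : ∀ x : ℝ, |x| < ρ₁ → ∀ᶠ y : ℝ in 𝓝[>] 0, ∀ s ∈ uIcc 0 x, (s + y * I : ℂ) ∈ halfDisc ρ₁ := by
    intro x hx
    have : Tendsto (fun y : ℝ => |x| + |y|) (𝓝[>] 0) (𝓝 (|x| + |(0 : ℝ)|)) :=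
      ((continuous_const.add continuous_abs).tendsto 0).mono_left nhdsWithin_le_nhds
    rw [abs_zero, add_zero] at this
    filter_upwards [this.eventually (gt_mem_nhds hx), self_mem_nhdsWithin] with y hy hy0 s hs
    refine ⟨?_, by simpa using hy0⟩
    rw [mem_ball_zero_iff]
    refine lt_of_le_of_lt ((norm_add_le _ _).trans ?_) hy
    have : |s| ≤ |x| := by
      rcases mem_uIcc.1 hs with h | h
      · rw [abs_of_nonneg h.1, abs_of_nonneg (h.1.trans h.2)]; exact h.2
      · rw [abs_of_nonpos h.2, abs_of_nonpos (h.1.trans h.2)]; linarith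
    simpa using this
  -- Where `Re K = 0` one has `exp K = conj (exp (-K))`. Integrating the difference along horizontal
  -- segments and letting their height tend to zero shows that `Y - conj Z` is constant on the axis.
  have hconst : ∀ x : ℝ, |x| < ρ₁ → Y x - conj (Z x) = Y 0 - conj (Z 0) := by
    intro x hx
    set A : ℂ → ℂ := fun z => Y z - conj (Z z)
    have hAc : Continuous A := by fun_prop
    set B : ℂ → ℂ := fun z => exp (K z) - conj (exp (-K z))
    have h1 : ∀ᶠ y : ℝ in 𝓝[>] 0, ∫ s in (0 : ℝ)..x, B (s + y * I) = A (x + y * I) - A (y * I) := by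
      filter_upwards [hmem x hx] with y hy
      have hd : ∀ s ∈ uIcc 0 x, HasDerivAt (fun s : ℝ => A (s + y * I)) (B (s + y * I)) s := by
        intro s hs
        have hl : HasDerivAt (fun s : ℂ => s + y * I) 1 (s : ℂ) := (hasDerivAt_id _).add_const _
        have e1 := ((hY _ (hy s hs)).comp (s : ℂ) hl).comp_ofReal
        have e2 := ((hZ _ (hy s hs)).comp (s : ℂ) hl).comp_ofReal
        simp only [mul_one] at e1 e2
        exact e1.sub (e2.star)
      have hi : ContinuousOn (fun s : ℝ => B (s + y * I)) (uIcc 0 x) := by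
        have : ContinuousOn B (halfDisc ρ₁) := by
          have hKc := hK₁.continuousOn
          exact hKc.cexp.sub (continuous_conj.comp_continuousOn hKc.neg.cexp)
        exact this.comp (by fun_prop) fun s hs => hy s hs
      have := intervalIntegral.integral_eq_sub_of_hasDerivAt hd hi.intervalIntegrable
      simpa using this
    have h2 : Tendsto (fun y : ℝ => A (x + y * I) - A (y * I)) (𝓝[>] 0) (𝓝 (A x - A 0)) := by
      have : Continuous (fun y : ℝ => A (x + y * I) - A (y * I)) := by fun_prop
      simpa using (this.tendsto 0).mono_left nhdsWithin_le_nhds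
    have h3 : Tendsto (fun y : ℝ => ∫ s in (0 : ℝ)..x, B (s + y * I)) (𝓝[>] 0)
        (𝓝 (∫ _ in (0 : ℝ)..x, (0 : ℂ))) := by
      refine intervalIntegral.tendsto_integral_filter_of_dominated_convergence
        (fun _ => Real.exp 1 + Real.exp 1) ?_ ?_ ?_ ?_
      · filter_upwards [hmem x hx] with y hy
        have : ContinuousOn B (halfDisc ρ₁) := by
          have hKc := hK₁.continuousOn
          exact hKc.cexp.sub (continuous_conj.comp_continuousOn hKc.neg.cexp)
        have : ContinuousOn (fun s : ℝ => B (s + y * I)) (uIcc 0 x) :=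
          this.comp (by fun_prop) fun s hs => hy s hs
        exact (this.mono uIoc_subset_uIcc).aestronglyMeasurable measurableSet_uIoc
      · filter_upwards [hmem x hx] with y hy
        refine Eventually.of_forall fun s hs => ?_
        have := hb _ (hy s (uIoc_subset_uIcc hs))
        refine (norm_sub_le _ _).trans ?_
        rw [RCLike.norm_conj, norm_exp, norm_exp]
        gcongr
        · exact le_of_abs_le this
        · rw [neg_re]; linarith [neg_le_of_abs_le this]
      · exact intervalIntegrable_const
      · refine Eventually.of_forall fun s hs => ?_
        have hs' : |s| < ρ₁ := by
          refine lt_of_le_of_lt ?_ hx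
          rcases mem_uIcc.1 (uIoc_subset_uIcc hs) with h | h
          · rw [abs_of_nonneg h.1, abs_of_nonneg (h.1.trans h.2)]; exact h.2
          · rw [abs_of_nonpos h.2, abs_of_nonpos (h.1.trans h.2)]; linarith
        have hKl : Tendsto (fun y : ℝ => (K (s + y * I)).re) (𝓝[>] 0) (𝓝 0) := by
          refine (hlim s (hs'.trans_le hρ₁ρ)).comp ?_
          refine tendsto_nhdsWithin_iff.2 ⟨?_, ?_⟩
          · have : Continuous (fun y : ℝ => (s + y * I : ℂ)) := by fun_prop
            simpa using (this.tendsto 0).mono_left nhdsWithin_le_nhds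
          · filter_upwards [self_mem_nhdsWithin] with y hy
            simpa using hy
        have hB : ∀ z, ‖B z‖ = |Real.exp (K z).re - Real.exp (-(K z).re)| := by
          intro z
          have e1 : conj (exp (-K z)) = exp (K z) * (Real.exp (-2 * (K z).re) : ℝ) := by
            rw [← exp_conj, ofReal_exp, ← exp_add]
            congr 1
            apply Complex.ext <;> simp
            ring
          have e2 : B z = exp (K z) * ((1 - Real.exp (-2 * (K z).re) : ℝ) : ℂ) := by
            simp only [B, e1]
            push_cast
            ring
          rw [e2, norm_mul, norm_exp, norm_real, Real.norm_eq_abs,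
            ← abs_of_pos (Real.exp_pos (K z).re), ← abs_mul, abs_of_pos (Real.exp_pos (K z).re),
            mul_sub, mul_one, ← Real.exp_add]
          congr 3
          ring
        rw [tendsto_zero_iff_norm_tendsto_zero]
        simp only [hB]
        have hcont : Continuous (fun u : ℝ => |Real.exp u - Real.exp (-u)|) := by fun_prop
        have := (hcont.tendsto 0).comp hKl
        simpa [Function.comp_def] using this
    simp only [intervalIntegral.integral_zero] at h3
    have h4 : A x - A 0 = 0 :=
      tendsto_nhds_unique (h2.congr' (h1.mono fun y hy => hy.symm)) h3
    simpa [A] using sub_eq_zero.1 h4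
  -- One formula, continuous on the whole plane, that glues `Y` above the axis to a constant plus
  -- the reflection of `Z` below it.
  set W : ℂ → ℂ := fun z => Y (z.re + (max z.im 0 : ℝ) * I) +
    conj (Z (z.re + (max (-z.im) 0 : ℝ) * I)) - conj (Z z.re)
  have hWc : Continuous W := by fun_prop
  have hWup : ∀ z : ℂ, 0 ≤ z.im → W z = Y z := by
    intro z hz
    have : (z.re + z.im * I : ℂ) = z := re_add_im z
    simp [W, max_eq_left hz, max_eq_right (neg_nonpos.2 hz), this]
  have hWdown : ∀ z ∈ Metric.ball (0 : ℂ) ρ₁, z.im ≤ 0 →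
      W z = (Y 0 - conj (Z 0)) + conj (Z (conj z)) := by
    intro z hz hz0
    have h1 : |z.re| < ρ₁ := (abs_re_le_norm z).trans_lt (mem_ball_zero_iff.1 hz)
    have h2 : (z.re + (-z.im : ℝ) * I : ℂ) = conj z := by
      apply Complex.ext <;> simp
    rw [← hconst _ h1]
    simp only [W, max_eq_right hz0, max_eq_left (neg_nonneg.2 hz0), h2]
    simp
    ring
  have hWd : DifferentiableOn ℂ W (Metric.ball 0 ρ₁) := by
    refine differentiableOn_of_off_real hWc.continuousOn fun z hz hz0 => ?_
    rcases lt_or_gt_of_ne hz0 with h | h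
    · have hcz : conj z ∈ halfDisc ρ₁ := ⟨by simpa using hz, by simpa using h⟩
      have h1 : DifferentiableAt ℂ (conj ∘ Z ∘ conj) (conj (conj z)) :=
        (hZ _ hcz).conj_conj.differentiableAt
      rw [conj_conj] at h1
      refine (h1.const_add (Y 0 - conj (Z 0))).congr_of_eventuallyEq ?_
      filter_upwards [Metric.isOpen_ball.mem_nhds hz,
        (isOpen_lt continuous_im continuous_const).mem_nhds h] with w hw hw0
      exact hWdown w hw (le_of_lt hw0)
    · refine (hY z ⟨hz, h⟩).differentiableAt.congr_of_eventuallyEq ?_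
      filter_upwards [(isOpen_lt continuous_const continuous_im).mem_nhds h] with w hw
      exact hWup w (le_of_lt hw)
  set X := deriv W
  have hXd : DifferentiableOn ℂ X (Metric.ball 0 ρ₁) := hWd.deriv Metric.isOpen_ball
  have hXK : ∀ z ∈ halfDisc ρ₁, X z = exp (K z) := by
    intro z hz
    refine HasDerivAt.deriv ((hY z hz).congr_of_eventuallyEq ?_)
    filter_upwards [(isOpen_lt continuous_const continuous_im).mem_nhds hz.2] with w hw
    exact hWup w (le_of_lt hw)
  -- Along the imaginary axis `‖X‖ = exp (Re K)` tends to `1`. So `X` extends `exp K` without a zero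
  -- near the origin, and a primitive of `X' / X` extends `K`.
  have hX0 : X 0 ≠ 0 := by
    have hc : ContinuousAt X 0 :=
      (hXd.differentiableAt (Metric.ball_mem_nhds 0 hρ₁)).continuousAt
    have hpath : Tendsto (fun y : ℝ => (y * I : ℂ)) (𝓝[>] 0) (𝓝[{z | 0 < z.im}] 0) := by
      refine tendsto_nhdsWithin_iff.2 ⟨?_, ?_⟩
      · have : Continuous (fun y : ℝ => (y * I : ℂ)) := by fun_prop
        simpa using (this.tendsto 0).mono_left nhdsWithin_le_nhds
      · filter_upwards [self_mem_nhdsWithin] with y hy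
        simpa using hy
    have h1 : Tendsto (fun y : ℝ => ‖X (y * I)‖) (𝓝[>] 0) (𝓝 ‖X 0‖) :=
      (hc.tendsto.comp (hpath.mono_right nhdsWithin_le_nhds)).norm
    have h2 : Tendsto (fun y : ℝ => ‖X (y * I)‖) (𝓝[>] 0) (𝓝 (Real.exp 0)) := by
      have h3 : Tendsto (fun y : ℝ => Real.exp (K (y * I)).re) (𝓝[>] 0) (𝓝 (Real.exp 0)) := by
        have := (hlim 0 (by simpa using hρ)).comp (by simpa using hpath)
        exact (Real.continuous_exp.tendsto 0).comp this
      refine h3.congr' ?_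
      filter_upwards [hmem 0 (by simpa using hρ₁)] with y hy
      have := hy 0 left_mem_uIcc
      rw [ofReal_zero, zero_add] at this
      rw [hXK _ this, norm_exp]
    have h3 := tendsto_nhds_unique h1 h2
    rw [Real.exp_zero] at h3
    exact norm_ne_zero_iff.1 (by rw [h3]; exact one_ne_zero)
  obtain ⟨r, hr, hrρ, hXr⟩ : ∃ r > 0, r ≤ ρ₁ ∧ ∀ z ∈ Metric.ball (0 : ℂ) r, X z ≠ 0 := by
    have hc : ContinuousAt X 0 :=
      (hXd.differentiableAt (Metric.ball_mem_nhds 0 hρ₁)).continuousAt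
    obtain ⟨ε, hε, h⟩ := Metric.eventually_nhds_iff_ball.1 (hc.eventually_ne hX0)
    exact ⟨min ε ρ₁, lt_min hε hρ₁, min_le_right _ _, fun z hz =>
      h z (Metric.ball_subset_ball (min_le_left _ _) hz)⟩
  have hXdr := hXd.mono (Metric.ball_subset_ball hrρ)
  have hLd : DifferentiableOn ℂ (fun z => deriv X z / X z) (Metric.ball 0 r) :=
    (hXdr.deriv Metric.isOpen_ball).div hXdr hXr
  obtain ⟨z₁, hz₁⟩ : (halfDisc r).Nonempty := by
    refine ⟨(r / 2 : ℝ) * I, ?_, by simpa using hr⟩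
    rw [mem_ball_zero_iff]
    simp [abs_of_pos hr]
    linarith
  obtain ⟨Ke, hKe1, hKe⟩ := hLd.isExactOn_ball.with_val_at z₁ (K z₁)
  have hsubr : halfDisc r ⊆ halfDisc ρ₁ := inter_subset_inter_left _ (Metric.ball_subset_ball hrρ)
  refine ⟨r, hr, hrρ.trans hρ₁ρ, Ke, fun z hz => (hKe z hz).differentiableAt.differentiableWithinAt, ?_⟩
  intro z hz
  refine (isOpen_halfDisc r).eqOn_of_deriv_eq (convex_halfDisc r).isPreconnected ?_ ?_ ?_ hz₁ hKe1 hz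
  · exact fun w hw => (hKe w hw.1).differentiableAt.differentiableWithinAt
  · exact hK₁.mono hsubr
  · intro w hw
    have h1 : deriv X w = exp (K w) * deriv K w := by
      have : X =ᶠ[𝓝 w] fun w => exp (K w) := by
        filter_upwards [(isOpen_halfDisc ρ₁).mem_nhds (hsubr hw)] with v hv
        exact hXK v hv
      rw [this.deriv_eq]
      exact ((hKd w (hsubr hw)).hasDerivAt.cexp).deriv
    rw [(hKe w hw.1).deriv, h1, hXK w (hsubr hw), mul_div_cancel_left₀ _ (exp_ne_zero _)]

/-! ### Smoothness up to the boundary in an almost holomorphic chart. -/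

/-- Only the real part is bounded, so the Cauchy estimate is applied to `exp F`, whose modulus lies
between `exp (-1)` and `exp 1`. -/
lemma norm_deriv_le_of_abs_re_le {F : ℂ → ℂ} {z : ℂ} {d : ℝ} (hd : 0 < d)
    (hF : DifferentiableOn ℂ F (Metric.ball z d)) (hb : ∀ w ∈ Metric.ball z d, |(F w).re| ≤ 1) :
    ‖deriv F z‖ ≤ 2 * Real.exp 2 / d := by
  have h1 : DiffContOnCl ℂ (fun w => exp (F w)) (Metric.ball z (d / 2)) := by
    refine DifferentiableOn.diffContOnCl ?_
    rw [closure_ball z (by positivity)]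
    exact hF.cexp.mono (Metric.closedBall_subset_ball (by linarith))
  have h2 : ‖deriv (fun w => exp (F w)) z‖ ≤ Real.exp 1 / (d / 2) := by
    refine norm_deriv_le_of_forall_mem_sphere_norm_le (by positivity) h1 fun w hw => ?_
    rw [norm_exp]
    refine Real.exp_le_exp.2 (le_of_abs_le (hb w ?_))
    exact Metric.closedBall_subset_ball (by linarith) (Metric.sphere_subset_closedBall hw)
  have hz : z ∈ Metric.ball z d := Metric.mem_ball_self hd
  have h3 : HasDerivAt F (deriv F z) z :=
    (hF.differentiableAt (Metric.isOpen_ball.mem_nhds hz)).hasDerivAt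
  rw [h3.cexp.deriv, norm_mul, norm_exp] at h2
  have h4 : Real.exp (-1) ≤ Real.exp (F z).re := Real.exp_le_exp.2 (neg_le_of_abs_le (hb z hz))
  have h5 : Real.exp (-1) * ‖deriv F z‖ ≤ Real.exp 1 / (d / 2) :=
    (mul_le_mul_of_nonneg_right h4 (norm_nonneg _)).trans h2
  have h6 : ‖deriv F z‖ = Real.exp 1 * (Real.exp (-1) * ‖deriv F z‖) := by
    rw [← mul_assoc, ← Real.exp_add]; simp
  rw [h6]
  calc Real.exp 1 * (Real.exp (-1) * ‖deriv F z‖) ≤ Real.exp 1 * (Real.exp 1 / (d / 2)) := by gcongr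
    _ = 2 * Real.exp 2 / d := by
      rw [show (2 : ℝ) = 1 + 1 by norm_num, Real.exp_add]
      field_simp

/-- Cauchy estimate for `deriv F` on the circle of radius `d / 4`, each point of which keeps a ball
of radius `d / 2` in the domain. What matters later is the blow-up rate `d ^ (-(j + 1))`. -/
lemma norm_iteratedDeriv_deriv_le {F : ℂ → ℂ} {z : ℂ} {d : ℝ} (hd : 0 < d)
    (hF : DifferentiableOn ℂ F (Metric.ball z d)) (hb : ∀ w ∈ Metric.ball z d, |(F w).re| ≤ 1)
    (j : ℕ) :
    ‖iteratedDeriv j (deriv F) z‖ ≤ j.factorial * (4 * Real.exp 2) * 4 ^ j / d ^ (j + 1) := by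
  have h1 : DiffContOnCl ℂ (deriv F) (Metric.ball z (d / 4)) := by
    refine DifferentiableOn.diffContOnCl ?_
    rw [closure_ball z (by positivity)]
    exact (hF.deriv Metric.isOpen_ball).mono (Metric.closedBall_subset_ball (by linarith))
  have h2 := norm_iteratedDeriv_le_of_forall_mem_sphere_norm_le (C := 4 * Real.exp 2 / d) j
    (by positivity) h1 ?_
  · refine h2.trans (le_of_eq ?_)
    rw [div_pow]
    field_simp
    ring
  · intro w hw
    have hsub : Metric.ball w (d / 2) ⊆ Metric.ball z d := by
      refine Metric.ball_subset_ball' ?_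
      rw [Metric.mem_sphere.1 hw]
      linarith
    refine (norm_deriv_le_of_abs_re_le (d := d / 2) (by positivity) (hF.mono hsub)
      (fun v hv => hb v (hsub hv))).trans (le_of_eq ?_)
    field_simp
    norm_num

/-- The functions `g ζ * (Im ζ) ^ m * A ζ`, extended by zero to the lower half plane. -/
def flatExt (g : ℂ → ℂ) (m : ℕ) (A : ℂ → ℂ) (ζ : ℂ) : ℂ :=
  if 0 < ζ.im then g ζ * (ζ.im ^ m * A ζ) else 0

lemma flatExt_of_nonpos (g : ℂ → ℂ) (m : ℕ) (A : ℂ → ℂ) {ζ : ℂ} (h : ζ.im ≤ 0) :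
    flatExt g m A ζ = 0 := if_neg (not_lt.2 h)

section Flat

variable {ρ : ℝ} {Gf : ℕ → ℂ → ℂ} {Θ : ℂ → ℂ} {Cb : ℕ → ℝ}

/-- The factor `(Im ζ) ^ m` with `m ≥ j + 3` beats the blow-up of `Gf j` by two powers, so the
extension by zero is quadratically small on the axis and its derivative there is zero. The
derivative is again built from such extensions, which permits induction. -/
lemma hasFDerivAt_flatExt (hG : ∀ j, ∀ ζ ∈ halfDisc ρ,
      HasFDerivAt (Gf j) ((Gf (j + 1) ζ) • fderiv ℝ Θ ζ) ζ)
    (hb : ∀ j, ∀ ζ ∈ halfDisc ρ, ‖Gf j ζ‖ * ζ.im ^ (j + 1) ≤ Cb j)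
    {j m : ℕ} {A : ℂ → ℂ} (hA : ContDiff ℝ ∞ A) (hm : j + 3 ≤ m) {ζ : ℂ}
    (hζ : ζ ∈ Metric.ball (0 : ℂ) ρ) :
    HasFDerivAt (flatExt (Gf j) m A)
      ((flatExt (Gf (j + 1)) m (fun ζ => A ζ * fderiv ℝ Θ ζ 1) ζ +
        flatExt (Gf j) m (fun ζ => fderiv ℝ A ζ 1) ζ) • (ofRealCLM ∘L reCLM) +
      (flatExt (Gf (j + 1)) m (fun ζ => A ζ * fderiv ℝ Θ ζ I) ζ +
        flatExt (Gf j) (m - 1) (fun ζ => m * A ζ) ζ +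
        flatExt (Gf j) m (fun ζ => fderiv ℝ A ζ I) ζ) • (ofRealCLM ∘L imCLM)) ζ := by
  rcases lt_trichotomy ζ.im 0 with h | h | h
  · have : flatExt (Gf j) m A =ᶠ[𝓝 ζ] fun _ => 0 := by
      filter_upwards [(isOpen_lt continuous_im continuous_const).mem_nhds h] with w hw
      exact flatExt_of_nonpos _ _ _ (le_of_lt hw)
    refine ((hasFDerivAt_const (0 : ℂ) ζ).congr_of_eventuallyEq this).congr_fderiv ?_
    ext v
    simp only [flatExt_of_nonpos _ _ _ h.le, add_apply, smul_apply, zero_apply, smul_eq_mul]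
    ring
  · suffices hO : flatExt (Gf j) m A =O[𝓝 ζ] fun w => ‖w - ζ‖ ^ 2 by
      refine (hO.hasFDerivAt (𝕜 := ℝ) one_lt_two).congr_fderiv ?_
      ext v
      simp only [flatExt_of_nonpos _ _ _ h.le, add_apply, smul_apply, zero_apply, smul_eq_mul]
      ring
    obtain ⟨M, hM⟩ : ∃ M, ∀ᶠ w in 𝓝 ζ, ‖A w‖ ≤ M :=
      ⟨‖A ζ‖ + 1, (hA.continuous.norm.continuousAt.eventually (gt_mem_nhds (lt_add_one _))).mono
        fun w hw => le_of_lt hw⟩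
    refine Asymptotics.IsBigO.of_bound (|Cb j| * |ρ| ^ (m - (j + 3)) * |M|) ?_
    filter_upwards [hM, Metric.isOpen_ball.mem_nhds hζ] with w hw hwρ
    by_cases hw0 : 0 < w.im
    · have hwH : w ∈ halfDisc ρ := ⟨hwρ, hw0⟩
      have h1 := hb j w hwH
      have himρ : w.im ≤ |ρ| :=
        (le_abs_self _).trans ((abs_im_le_norm w).trans
          ((mem_ball_zero_iff.1 hwρ).le.trans (le_abs_self ρ)))
      have hz : w.im ≤ ‖w - ζ‖ := by
        have : (w - ζ).im = w.im := by simp [h]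
        rw [← this]
        exact (le_abs_self _).trans (abs_im_le_norm _)
      have e : w.im ^ m = w.im ^ (j + 1) * w.im ^ (m - (j + 3)) * w.im ^ 2 := by
        rw [← pow_add, ← pow_add]
        congr 1
        omega
      rw [flatExt, if_pos hw0, norm_mul, norm_mul, norm_pow, norm_real, Real.norm_of_nonneg hw0.le,
        norm_pow, norm_norm, e]
      calc ‖Gf j w‖ * (w.im ^ (j + 1) * w.im ^ (m - (j + 3)) * w.im ^ 2 * ‖A w‖)
          = (‖Gf j w‖ * w.im ^ (j + 1)) * w.im ^ (m - (j + 3)) * ‖A w‖ * w.im ^ 2 := by ring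
        _ ≤ |Cb j| * |ρ| ^ (m - (j + 3)) * |M| * ‖w - ζ‖ ^ 2 := by
          gcongr
          · exact h1.trans (le_abs_self _)
          · exact hw.trans (le_abs_self _)
    · rw [flatExt_of_nonpos _ _ _ (not_lt.1 hw0), norm_zero]
      positivity
  · have hev : flatExt (Gf j) m A =ᶠ[𝓝 ζ] fun w => Gf j w * (w.im ^ m * A w) := by
      filter_upwards [(isOpen_lt continuous_const continuous_im).mem_nhds h] with w hw
      exact if_pos hw
    have h1 : HasFDerivAt (fun w : ℂ => (w.im : ℂ)) (ofRealCLM ∘L imCLM) ζ :=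
      (ofRealCLM ∘L imCLM).hasFDerivAt
    have h2 : HasFDerivAt A (fderiv ℝ A ζ) ζ :=
      (hA.differentiable (by simp)).differentiableAt.hasFDerivAt
    have h3 := (hG j ζ ⟨hζ, h⟩).mul ((h1.pow m).mul h2)
    refine (h3.congr_of_eventuallyEq hev).congr_fderiv ?_
    ext v
    simp only [flatExt, if_pos h]
    simp only [add_apply, smul_apply, smul_eq_mul, ContinuousLinearMap.comp_apply, reCLM_apply,
      imCLM_apply, ofRealCLM_apply]
    rw [fderiv_real_apply Θ ζ v, fderiv_real_apply A ζ v]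
    simp only [nsmul_eq_mul, Pi.mul_apply]
    ring

/-- Each derivative either raises `j` by one or lowers `m` by at most one, so `k` derivatives are
available when `m ≥ j + k + 3`. -/
lemma contDiffOn_flatExt (hΘ : ContDiff ℝ ∞ Θ) (hG : ∀ j, ∀ ζ ∈ halfDisc ρ,
      HasFDerivAt (Gf j) ((Gf (j + 1) ζ) • fderiv ℝ Θ ζ) ζ)
    (hb : ∀ j, ∀ ζ ∈ halfDisc ρ, ‖Gf j ζ‖ * ζ.im ^ (j + 1) ≤ Cb j) (k : ℕ) :
    ∀ (j m : ℕ) (A : ℂ → ℂ), ContDiff ℝ ∞ A → j + k + 3 ≤ m →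
      ContDiffOn ℝ k (flatExt (Gf j) m A) (Metric.ball 0 ρ) := by
  have hpart : ∀ {B : ℂ → ℂ}, ContDiff ℝ ∞ B → ∀ v, ContDiff ℝ ∞ (fun ζ => fderiv ℝ B ζ v) :=
    fun hB v => (hB.fderiv_right (m := ∞) (by simp)).clm_apply contDiff_const
  induction k with
  | zero =>
    intro j m A hA hm
    simp only [Nat.cast_zero, contDiffOn_zero]
    exact fun ζ hζ => (hasFDerivAt_flatExt hG hb hA (by omega) hζ).continuousAt.continuousWithinAt
  | succ k ih =>
    intro j m A hA hm
    push_cast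
    rw [contDiffOn_succ_iff_fderiv_of_isOpen Metric.isOpen_ball]
    refine ⟨fun ζ hζ => (hasFDerivAt_flatExt hG hb hA (by omega)
      hζ).differentiableAt.differentiableWithinAt, by simp, ?_⟩
    refine ContDiffOn.congr ?_ (fun ζ hζ => (hasFDerivAt_flatExt hG hb hA (by omega) hζ).fderiv)
    refine ContDiffOn.add ?_ ?_
    · refine ContDiffOn.smul ((ih _ _ _ (hA.mul (hpart hΘ 1)) (by omega)).add
        (ih _ _ _ (hpart hA 1) (by omega))) contDiffOn_const
    · refine ContDiffOn.smul (((ih _ _ _ (hA.mul (hpart hΘ I)) (by omega)).add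
        (ih _ _ _ (contDiff_const.mul hA) (by omega))).add
        (ih _ _ _ (hpart hA I) (by omega))) contDiffOn_const

end Flat

lemma dbar_conj_comp_conj {Q : ℂ → ℂ} {z : ℂ} (hQ : DifferentiableAt ℝ Q (conj z)) :
    DifferentiableAt ℝ (fun z => conj (Q (conj z))) z ∧
      dbar (fun z => conj (Q (conj z))) z = conj (dbar Q (conj z)) := by
  have h1 : HasFDerivAt (fun z : ℂ => conj z) (conjCLE : ℂ →L[ℝ] ℂ) z :=
    (conjCLE : ℂ →L[ℝ] ℂ).hasFDerivAt
  have h2 : HasFDerivAt (fun z : ℂ => conj z) (conjCLE : ℂ →L[ℝ] ℂ) (Q (conj z)) :=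
    (conjCLE : ℂ →L[ℝ] ℂ).hasFDerivAt
  have h3 := h2.comp z (hQ.hasFDerivAt.comp z h1)
  have h4 : HasFDerivAt (fun z => conj (Q (conj z))) _ z := h3
  refine ⟨h4.differentiableAt, ?_⟩
  rw [dbar, h4.fderiv, dbar]
  simp only [ContinuousLinearMap.comp_apply, ContinuousLinearEquiv.coe_coe, conjCLE_apply, map_add,
    map_one, conj_I, map_neg, map_mul]
  ring

lemma dbar_sub {P Q : ℂ → ℂ} {z : ℂ} (hP : DifferentiableAt ℝ P z) (hQ : DifferentiableAt ℝ Q z) :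
    dbar (fun z => P z - Q z) z = dbar P z - dbar Q z := by
  simp only [dbar, fderiv_fun_sub hP hQ, sub_apply]
  ring

lemma dbar_comp {F Θ : ℂ → ℂ} {z : ℂ} (hF : DifferentiableAt ℂ F (Θ z))
    (hΘ : DifferentiableAt ℝ Θ z) :
    HasFDerivAt (fun z => F (Θ z)) (deriv F (Θ z) • fderiv ℝ Θ z) z ∧
      dbar (fun z => F (Θ z)) z = deriv F (Θ z) * dbar Θ z := by
  have h1 : HasFDerivAt (fun z => F (Θ z)) (deriv F (Θ z) • fderiv ℝ Θ z) z := by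
    refine ((hF.hasDerivAt.hasFDerivAt.restrictScalars ℝ).comp z hΘ.hasFDerivAt).congr_fderiv ?_
    ext v
    simp [mul_comm]
  refine ⟨h1, ?_⟩
  rw [dbar, h1.fderiv, dbar]
  simp only [smul_apply, smul_eq_mul]
  ring

/-- Regularity up to the boundary in a chart that is holomorphic to high order along the boundary:
a holomorphic function of the chart whose real part vanishes on the boundary is smooth up to it. -/
theorem exists_contDiffOn_extension {Ω : Set ℂ} {F : ℂ → ℂ} (hΩ : IsOpen Ω)
    (hF : DifferentiableOn ℂ F Ω) (hFb : ∀ z ∈ Ω, |(F z).re| ≤ 1) {Θ A : ℂ → ℂ}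
    (hΘ : ContDiff ℝ ∞ Θ) (hA : ContDiff ℝ ∞ A) {n N : ℕ} (hN : n + 4 ≤ N)
    (hdb : ∀ ζ, dbar Θ ζ = ζ.im ^ N * A ζ) {ρ m : ℝ} (hρ : 0 < ρ) (hm : 0 < m)
    (hball : ∀ ζ ∈ halfDisc ρ, Metric.ball (Θ ζ) (m * ζ.im) ⊆ Ω)
    (hlim : ∀ x : ℝ, |x| < ρ →
      Tendsto (fun ζ => (F (Θ ζ)).re) (𝓝[{z | 0 < z.im}] (x : ℂ)) (𝓝 0)) :
    ∃ r > 0, r ≤ ρ ∧ ∃ U : ℂ → ℂ, ContDiffOn ℝ (n + 1) U (Metric.ball 0 r) ∧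
      ∀ ζ ∈ halfDisc r, U ζ = F (Θ ζ) := by
  have hΘd : ∀ ζ, DifferentiableAt ℝ Θ ζ := hΘ.differentiable (by simp)
  have hmem : ∀ ζ ∈ halfDisc ρ, Θ ζ ∈ Ω := fun ζ hζ =>
    hball ζ hζ (Metric.mem_ball_self (mul_pos hm hζ.2))
  have hFd : ∀ z ∈ Ω, DifferentiableAt ℂ F z := fun z hz => hF.differentiableAt (hΩ.mem_nhds hz)
  set Gf : ℕ → ℂ → ℂ := fun j ζ => iteratedDeriv j (deriv F) (Θ ζ)
  have hG : ∀ j, ∀ ζ ∈ halfDisc ρ, HasFDerivAt (Gf j) ((Gf (j + 1) ζ) • fderiv ℝ Θ ζ) ζ := by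
    intro j ζ hζ
    have han : AnalyticAt ℂ (deriv F) (Θ ζ) := (hF.analyticAt (hΩ.mem_nhds (hmem ζ hζ))).deriv
    have hd : DifferentiableAt ℂ (iteratedDeriv j (deriv F)) (Θ ζ) := by
      rw [iteratedDeriv_eq_iterate]
      exact (han.iterated_deriv j).differentiableAt
    have := (dbar_comp hd (hΘd ζ)).1
    rwa [← iteratedDeriv_succ] at this
  have hb : ∀ j, ∀ ζ ∈ halfDisc ρ, ‖Gf j ζ‖ * ζ.im ^ (j + 1) ≤
      j.factorial * (4 * Real.exp 2) * 4 ^ j / m ^ (j + 1) := by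
    intro j ζ hζ
    have hpos : 0 < m * ζ.im := mul_pos hm hζ.2
    have h1 := norm_iteratedDeriv_deriv_le hpos (hF.mono (hball ζ hζ))
      (fun w hw => hFb w (hball ζ hζ hw)) j
    have hy : 0 < ζ.im := hζ.2
    rw [mul_pow, ← div_div, le_div_iff₀ (by positivity)] at h1
    exact h1
  -- In the upper half disc this function is `dbar (F ∘ Θ) = F'(Θ) * dbar Θ`. It is `n + 1` times
  -- differentiable across the axis because `N ≥ n + 4`.
  have hh := contDiffOn_flatExt hΘ hG hb (n + 1) 0 N A hA (by omega)
  set h := flatExt (Gf 0) N A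
  set χ : ContDiffBump (0 : ℂ) := ⟨ρ / 3, 2 * ρ / 3, by positivity, by linarith⟩
  set h₁ : ℂ → ℂ := fun z => (χ z : ℂ) * h z
  have hχs : ContDiff ℝ ∞ χ := χ.contDiff
  have hh₁ : ContDiff ℝ (n + 1) h₁ := by
    rw [contDiff_iff_contDiffAt]
    intro z
    by_cases hz : z ∈ Metric.ball (0 : ℂ) ρ
    · have e1 : ContDiffAt ℝ (n + 1) (fun z => (χ z : ℂ)) z :=
        (ofRealCLM.contDiff.comp (hχs.of_le (by exact_mod_cast le_top))).contDiffAt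
      exact e1.mul (hh.contDiffAt (Metric.isOpen_ball.mem_nhds hz))
    · have : h₁ =ᶠ[𝓝 z] fun _ => 0 := by
        have hz' : z ∉ tsupport χ := by
          rw [χ.tsupport_eq]
          intro hc
          apply hz
          exact Metric.closedBall_subset_ball (show 2 * ρ / 3 < ρ by linarith) hc
        filter_upwards [(isClosed_tsupport χ).isOpen_compl.mem_nhds hz'] with w hw
        simp [h₁, image_eq_zero_of_notMem_tsupport hw]
      exact contDiffAt_const.congr_of_eventuallyEq this
  have hh₁c : HasCompactSupport h₁ :=
    (χ.hasCompactSupport.comp_left (g := fun x : ℝ => (x : ℂ)) ofReal_zero).mul_right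
  obtain ⟨Q, hQ, hQdb⟩ := exists_dbar_eq hh₁ hh₁c
  have hQd : ∀ z, DifferentiableAt ℝ Q z := hQ.differentiable (by simp)
  -- Subtracting the reflection of `Q` makes the real part of the correction vanish on the axis. It
  -- does not affect `dbar` in the upper half disc, because `h₁` vanishes in the lower one.
  set R : ℂ → ℂ := fun z => conj (Q (conj z))
  have hR : ContDiff ℝ (n + 1) R :=
    (conjCLE : ℂ →L[ℝ] ℂ).contDiff.comp (hQ.comp (conjCLE : ℂ →L[ℝ] ℂ).contDiff)
  set K : ℂ → ℂ := fun z => F (Θ z) - (Q z - R z)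
  have hsub : halfDisc (ρ / 3) ⊆ halfDisc ρ :=
    inter_subset_inter_left _ (Metric.ball_subset_ball (by linarith))
  have hK : DifferentiableOn ℂ K (halfDisc (ρ / 3)) := by
    intro z hz
    have hzρ := hsub hz
    have e1 := dbar_comp (hFd _ (hmem z hzρ)) (hΘd z)
    have e2 := dbar_conj_comp_conj (hQd (conj z))
    have e3 : DifferentiableAt ℝ (fun z => Q z - R z) z := (hQd z).sub e2.1
    refine (differentiableAt_of_dbar_eq_zero (e1.1.differentiableAt.sub e3) ?_).differentiableWithinAt
    have e4 : dbar K z = deriv F (Θ z) * dbar Θ z - (dbar Q z - conj (dbar Q (conj z))) := by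
      rw [← e2.2, ← e1.2, ← dbar_sub (hQd z) e2.1, ← dbar_sub e1.1.differentiableAt e3]
    have e5 : h₁ (conj z) = 0 := by
      have : h (conj z) = 0 := flatExt_of_nonpos _ _ _ (by simpa using le_of_lt hz.2)
      simp [h₁, this]
    have e6 : h₁ z = deriv F (Θ z) * dbar Θ z := by
      have : χ z = 1 := χ.one_of_mem_closedBall (Metric.ball_subset_closedBall hz.1)
      have hz0 : 0 < z.im := hz.2
      simp [h₁, this, h, flatExt, hz0, hdb, Gf]
    change dbar K z = 0
    rw [e4, hQdb, hQdb, e5, e6]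
    simp
  obtain ⟨r, hr, hrρ, Ke, hKe, hKeK⟩ := exists_extension_of_tendsto_re (ρ := ρ / 3) (by positivity)
    hK (by
      intro x hx
      have e1 := hlim x (by linarith)
      have hc : Continuous (fun z => (Q z - R z).re) :=
        continuous_re.comp (hQ.continuous.sub hR.continuous)
      have e2 : Tendsto (fun z => (Q z - R z).re) (𝓝[{z | 0 < z.im}] (x : ℂ)) (𝓝 0) := by
        have := (hc.tendsto (x : ℂ)).mono_left (nhdsWithin_le_nhds (s := {z | 0 < z.im}))
        simpa [R] using this
      simpa [K] using e1.sub e2)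
  refine ⟨r, hr, by linarith, fun z => Ke z + (Q z - R z), ?_, ?_⟩
  · refine ContDiffOn.add ?_ (hQ.sub hR).contDiffOn
    exact (hKe.contDiffOn Metric.isOpen_ball).restrict_scalars ℝ
  · intro ζ hζ
    simp only [hKeK ζ hζ, K]
    ring

/-! ### Charts from Taylor polynomials of a curve. -/

/-- The Taylor polynomial of a curve, in a complexified parameter. It is holomorphic to order `N`
along the real axis. -/
def taylorChart (c : ℝ → ℂ) (t : ℝ) (N : ℕ) (ζ : ℂ) : ℂ :=
  ∑ j ∈ Finset.range (N + 1), iteratedDeriv j c (t + ζ.re) * ((I * ζ.im) ^ j / j.factorial)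

section Chart

variable {c : ℝ → ℂ}

lemma contDiff_iteratedDeriv (hc : ContDiff ℝ ∞ c) (j : ℕ) : ContDiff ℝ ∞ (iteratedDeriv j c) := by
  induction j with
  | zero => simpa using hc
  | succ j ih =>
    rw [iteratedDeriv_succ]
    exact (contDiff_infty_iff_deriv.1 ih).2

lemma contDiff_iteratedDeriv_re (hc : ContDiff ℝ ∞ c) (t : ℝ) (j : ℕ) :
    ContDiff ℝ ∞ (fun ζ : ℂ => iteratedDeriv j c (t + ζ.re)) :=
  (contDiff_iteratedDeriv hc j).comp (contDiff_const.add reCLM.contDiff)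

lemma contDiff_taylorChart (hc : ContDiff ℝ ∞ c) (t : ℝ) (N : ℕ) :
    ContDiff ℝ ∞ (taylorChart c t N) := by
  refine ContDiff.sum fun j _ => (contDiff_iteratedDeriv_re hc t j).mul ?_
  exact ((contDiff_const.mul (ofRealCLM.contDiff.comp imCLM.contDiff)).pow j).div_const _

lemma taylorChart_ofReal (c : ℝ → ℂ) (t : ℝ) (N : ℕ) (x : ℝ) : taylorChart c t N x = c (t + x) := by
  rw [taylorChart, Finset.sum_eq_single 0]
  · simp
  · intro j _ hj
    simp [hj]
  · simp

lemma fderiv_taylorChart_term (hc : ContDiff ℝ ∞ c) (t : ℝ) (j : ℕ) (ζ : ℂ) :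
    HasFDerivAt (fun ζ : ℂ => iteratedDeriv j c (t + ζ.re) * ((I * ζ.im) ^ j / j.factorial))
      ((iteratedDeriv (j + 1) c (t + ζ.re) * ((I * ζ.im) ^ j / j.factorial)) •
          (ofRealCLM ∘L reCLM) +
        (iteratedDeriv j c (t + ζ.re) * (j * (I * ζ.im) ^ (j - 1) * I / j.factorial)) •
          (ofRealCLM ∘L imCLM)) ζ := by
  have h1 : HasFDerivAt (fun ζ : ℂ => t + ζ.re) reCLM ζ := reCLM.hasFDerivAt.const_add t
  have h2 : HasDerivAt (iteratedDeriv j c) (iteratedDeriv (j + 1) c (t + ζ.re)) (t + ζ.re) := by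
    rw [iteratedDeriv_succ]
    exact ((contDiff_iteratedDeriv hc j).differentiable (by simp)).differentiableAt.hasDerivAt
  have h3 := h2.hasFDerivAt.comp ζ h1
  have h4 : HasFDerivAt (fun w : ℂ => (w.im : ℂ)) (ofRealCLM ∘L imCLM) ζ :=
    (ofRealCLM ∘L imCLM).hasFDerivAt
  have h5 := ((h4.const_mul I).pow j).mul_const ((j.factorial : ℂ)⁻¹)
  have h6 := h3.mul h5
  refine (h6.congr_of_eventuallyEq (Eventually.of_forall fun w => ?_)).congr_fderiv ?_
  · simp [div_eq_mul_inv]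
  · ext v
    simp only [add_apply, smul_apply, smul_eq_mul, ContinuousLinearMap.comp_apply, reCLM_apply,
      imCLM_apply, ofRealCLM_apply, nsmul_eq_mul, Function.comp_apply, div_eq_mul_inv,
      ContinuousLinearMap.toSpanSingleton_apply, real_smul]
    ring

/-- The sum telescopes: the real derivative of the term of order `j` cancels against `I` times the
imaginary derivative of the next term, and only the last real derivative survives. -/
lemma dbar_taylorChart (hc : ContDiff ℝ ∞ c) (t : ℝ) (N : ℕ) (ζ : ℂ) :
    dbar (taylorChart c t N) ζ =
      iteratedDeriv (N + 1) c (t + ζ.re) * ((I * ζ.im) ^ N / N.factorial) := by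
  induction N with
  | zero =>
    have : taylorChart c t 0 = fun ζ : ℂ =>
        iteratedDeriv 0 c (t + ζ.re) * ((I * ζ.im) ^ 0 / Nat.factorial 0) := by
      ext ζ; simp [taylorChart]
    rw [this, dbar, (fderiv_taylorChart_term hc t 0 ζ).fderiv]
    simp
  | succ N ih =>
    have e : taylorChart c t (N + 1) = fun ζ : ℂ => taylorChart c t N ζ +
        iteratedDeriv (N + 1) c (t + ζ.re) * ((I * ζ.im) ^ (N + 1) / (N + 1).factorial) := by
      ext ζ
      rw [taylorChart, Finset.sum_range_succ, ← taylorChart]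
    have hd : DifferentiableAt ℝ (taylorChart c t N) ζ :=
      (contDiff_taylorChart hc t N).differentiable (by simp) ζ
    have ht := fderiv_taylorChart_term hc t (N + 1) ζ
    rw [e, dbar, fderiv_fun_add hd ht.differentiableAt, ht.fderiv]
    rw [dbar] at ih
    simp only [add_apply, smul_apply, smul_eq_mul, ContinuousLinearMap.comp_apply, reCLM_apply,
      imCLM_apply, ofRealCLM_apply, one_re, one_im, I_re, I_im, ofReal_one, ofReal_zero]
    have hfac : ((N + 1).factorial : ℂ) = (N + 1) * N.factorial := by
      rw [Nat.factorial_succ]; push_cast; ring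
    have hN1 : (N : ℂ) + 1 ≠ 0 := by exact_mod_cast Nat.succ_ne_zero N
    have hNf : (N.factorial : ℂ) ≠ 0 := by exact_mod_cast N.factorial_ne_zero
    have key : iteratedDeriv (N + 1) c (t + ζ.re) *
        (((N + 1 : ℕ) : ℂ) * (I * ζ.im) ^ (N + 1 - 1) * I / (N + 1).factorial) * I =
        - (iteratedDeriv (N + 1) c (t + ζ.re) * ((I * ζ.im) ^ N / N.factorial)) := by
      rw [hfac, Nat.add_sub_cancel]
      push_cast
      field_simp
      linear_combination (iteratedDeriv (N + 1) c (t + ζ.re) * (I * ζ.im) ^ N) * I_sq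
    linear_combination ih + key

/-- Along the axis the chart is the curve, which gives the real derivative. For `N ≥ 1` its `dbar`
vanishes at the origin, so the whole derivative is complex linear. -/
lemma hasFDerivAt_taylorChart_zero (hc : ContDiff ℝ ∞ c) (t : ℝ) {N : ℕ} (hN : 1 ≤ N) :
    HasFDerivAt (taylorChart c t N) (deriv c t • ContinuousLinearMap.id ℝ ℂ) 0 := by
  have hd : DifferentiableAt ℝ (taylorChart c t N) 0 :=
    (contDiff_taylorChart hc t N).differentiable (by simp) 0
  refine hd.hasFDerivAt.congr_fderiv ?_
  have h1 : fderiv ℝ (taylorChart c t N) 0 1 = deriv c t := by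
    have e1 : HasDerivAt (fun x : ℝ => taylorChart c t N x)
        (fderiv ℝ (taylorChart c t N) 0 1) 0 := by
      have := hd.hasFDerivAt
      rw [← ofReal_zero] at this
      exact this.comp_hasDerivAt (0 : ℝ) ofRealCLM.hasDerivAt
    have e2 : HasDerivAt (fun x : ℝ => taylorChart c t N x) (deriv c t) 0 := by
      simp only [taylorChart_ofReal]
      have : HasDerivAt c (deriv c (t + 0)) (t + 0) :=
        (hc.differentiable (by simp)).differentiableAt.hasDerivAt
      have := this.comp_const_add t 0
      simpa using this
    exact e1.unique e2
  have h2 := dbar_taylorChart hc t N 0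
  rw [dbar, h1] at h2
  have hN0 : N ≠ 0 := by omega
  simp only [zero_im, ofReal_zero, mul_zero, zero_pow hN0, zero_div] at h2
  ext v
  rw [fderiv_real_apply, h1]
  simp only [smul_apply, ContinuousLinearMap.id_apply, smul_eq_mul]
  conv_rhs => rw [← re_add_im v]
  linear_combination (-I * v.im) * h2 + (v.im * fderiv ℝ (taylorChart c t N) 0 I) * I_sq

end Chart

/-! ### Smooth closed curves: straightening charts and the side on which the domain lies. -/

/-- A smooth regular `1`-periodic parametrization of a simple closed curve, of any orientation. -/
structure IsParam (c : ℝ → ℂ) (S : Set ℂ) : Prop where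
  smooth : ContDiff ℝ ∞ c
  periodic : Function.Periodic c 1
  regular : ∀ t, deriv c t ≠ 0
  injOn : InjOn c (Ico 0 1)
  range_eq : range c = S

namespace IsParam

variable {c : ℝ → ℂ} {S : Set ℂ}

lemma hasDerivAt (h : IsParam c S) (t : ℝ) : HasDerivAt c (deriv c t) t :=
  (h.smooth.differentiable (by simp)).differentiableAt.hasDerivAt

lemma exists_int_of_eq (h : IsParam c S) {t t' : ℝ} (he : c t = c t') : ∃ k : ℤ, t = t' + k := by
  have hf : ∀ s, c (Int.fract s) = c s := fun s => by
    have := h.periodic.sub_int_mul_eq (x := s) ⌊s⌋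
    rwa [mul_one, Int.self_sub_floor] at this
  have h1 : Int.fract t = Int.fract t' := by
    refine h.injOn ⟨Int.fract_nonneg _, Int.fract_lt_one _⟩
      ⟨Int.fract_nonneg _, Int.fract_lt_one _⟩ ?_
    rw [hf, hf, he]
  obtain ⟨k, hk⟩ := Int.fract_eq_fract.1 h1
  exact ⟨k, by linarith⟩

lemma apply_add_int (h : IsParam c S) (t : ℝ) (k : ℤ) : c (t + k) = c t := by
  have := h.periodic.int_mul k t
  rwa [mul_one] at this

/-- The rest of a period is compact and, by injectivity, its image misses `c t₀`. A curve therefore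
cannot return close to `c t₀` at a parameter far from `t₀` modulo `1`. -/
lemma exists_near (h : IsParam c S) (t₀ : ℝ) {η : ℝ} (hη : 0 < η) :
    ∃ ε > 0, ∀ t, ‖c t - c t₀‖ < ε → ∃ k : ℤ, |t - t₀ - k| < η := by
  set K : Set ℝ := Icc (t₀ - 1 / 2) (t₀ + 1 / 2) ∩ {t | η ≤ |t - t₀|}
  have hK : IsCompact K := isCompact_Icc.inter_right (isClosed_le continuous_const (by fun_prop))
  have hcK : IsClosed (c '' K) := (hK.image h.smooth.continuous).isClosed
  have hnot : c t₀ ∉ c '' K := by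
    rintro ⟨t, ⟨ht1, ht2⟩, hct⟩
    obtain ⟨k, hk⟩ := h.exists_int_of_eq hct
    have hk0 : k = 0 := by
      have h1 : (k : ℝ) ≤ 1 / 2 := by linarith [ht1.2]
      have h2 : -(1 / 2) ≤ (k : ℝ) := by linarith [ht1.1]
      have h3 : k < 1 := by exact_mod_cast (by linarith : (k : ℝ) < 1)
      have h4 : -1 < k := by exact_mod_cast (by linarith : (-1 : ℝ) < k)
      omega
    have : t - t₀ = 0 := by rw [hk, hk0]; simp
    rw [mem_ofPred_eq, this, abs_zero] at ht2
    linarith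
  obtain ⟨ε, hε, hb⟩ := Metric.isOpen_iff.1 hcK.isOpen_compl (c t₀) hnot
  refine ⟨ε, hε, fun t ht => ⟨round (t - t₀), ?_⟩⟩
  by_contra hge
  rw [not_lt] at hge
  have h1 := abs_sub_round (t - t₀)
  refine hb (mem_ball_iff_norm.2 ht) ⟨t - round (t - t₀), ⟨?_, ?_⟩, ?_⟩
  · have := abs_le.1 h1
    constructor <;> linarith [this.1, this.2]
  · have : t - round (t - t₀) - t₀ = t - t₀ - round (t - t₀) := by ring
    rw [mem_ofPred_eq, this]
    exact hge
  · have := h.apply_add_int t (-(round (t - t₀)))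
    rw [← this]
    push_cast
    rfl

lemma isPreconnected (h : IsParam c S) : IsPreconnected S := by
  rw [← h.range_eq]
  exact isPreconnected_range h.smooth.continuous

lemma nonempty (h : IsParam c S) : S.Nonempty := by
  rw [← h.range_eq]
  exact range_nonempty c

/-- The reversed parametrization. -/
lemma reverse (h : IsParam c S) : IsParam (fun t => c (-t)) S where
  smooth := h.smooth.comp contDiff_neg
  periodic := fun t => by
    have := h.periodic (-t - 1)
    rw [sub_add_cancel] at this
    simp only [this, neg_add]
    rfl
  regular := fun t => by
    have : deriv (fun t => c (-t)) t = - deriv c (-t) := deriv_comp_neg c t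
    rw [this]
    exact neg_ne_zero.2 (h.regular _)
  injOn := by
    intro s hs t ht hst
    obtain ⟨k, hk⟩ := h.exists_int_of_eq hst
    have h1 : (k : ℝ) = t - s := by linarith
    have h2 : k < 1 := by exact_mod_cast (by rw [h1]; linarith [ht.2, hs.1] : (k : ℝ) < 1)
    have h3 : -1 < k := by exact_mod_cast (by rw [h1]; linarith [hs.2, ht.1] : (-1 : ℝ) < k)
    have h4 : k = 0 := by omega
    rw [h4] at hk
    simp at hk
    exact hk
  range_eq := by
    rw [← h.range_eq]
    exact (Equiv.neg ℝ).surjective.range_comp c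

end IsParam

lemma IsPosParam.isParam {c : ℝ → ℂ} {S : Set ℂ} (h : IsPosParam c S) : IsParam c S :=
  ⟨h.smooth, h.periodic, h.regular, h.injOn, h.range_eq⟩

/-- A chart around a point of a smooth closed curve, straightening the curve. -/
lemma exists_chart {c : ℝ → ℂ} {S : Set ℂ} (h : IsParam c S) (t : ℝ) {N : ℕ} (hN : 1 ≤ N) :
    ∃ e : OpenPartialHomeomorph ℂ ℂ, (e : ℂ → ℂ) = taylorChart c t N ∧
      ContDiffAt ℝ ∞ e.symm (c t) ∧ e.symm (c t) = 0 ∧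
      HasFDerivAt e.symm ((deriv c t)⁻¹ • ContinuousLinearMap.id ℝ ℂ) (c t) ∧
      ∃ ρ > 0, Metric.ball 0 ρ ⊆ e.source ∧
        ∀ ζ ∈ Metric.ball (0 : ℂ) ρ, taylorChart c t N ζ ∈ S ↔ ζ.im = 0 := by
  have hne := h.regular t
  set L : ℂ ≃L[ℝ] ℂ := (ContinuousLinearEquiv.unitsEquivAut ℂ (Units.mk0 _ hne)).restrictScalars ℝ
  have hL : (L : ℂ →L[ℝ] ℂ) = deriv c t • ContinuousLinearMap.id ℝ ℂ := by
    ext v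
    simp [L, mul_comm]
  have hcd : ContDiffAt ℝ ∞ (taylorChart c t N) 0 :=
    (contDiff_taylorChart h.smooth t N).contDiffAt
  have hfd : HasFDerivAt (taylorChart c t N) (L : ℂ →L[ℝ] ℂ) 0 := by
    rw [hL]
    exact hasFDerivAt_taylorChart_zero h.smooth t hN
  set e := hcd.toOpenPartialHomeomorph _ hfd (by simp)
  have he : (e : ℂ → ℂ) = taylorChart c t N := hcd.toOpenPartialHomeomorph_coe hfd (by simp)
  have h0 : (0 : ℂ) ∈ e.source := hcd.mem_toOpenPartialHomeomorph_source hfd (by simp)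
  have hΘ0 : taylorChart c t N 0 = c t := by
    have := taylorChart_ofReal c t N 0
    simpa using this
  have hs0 : e.symm (c t) = 0 := by
    rw [← hΘ0, ← he]
    exact e.left_inv h0
  have hts : c t ∈ e.target := by
    rw [← hΘ0, ← he]
    exact e.map_source h0
  have hsd : HasFDerivAt e.symm (L.symm : ℂ →L[ℝ] ℂ) (c t) := by
    refine e.hasFDerivAt_symm hts ?_
    rw [hs0, he]
    exact hfd
  refine ⟨e, he, ?_, hs0, ?_, ?_⟩
  · have := e.contDiffAt_symm hts (f₀' := L) (by rw [hs0, he]; exact hfd) (by rw [hs0, he]; exact hcd)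
    exact this
  · refine hsd.congr_fderiv ?_
    ext v
    simp only [ContinuousLinearEquiv.coe_coe, smul_apply, ContinuousLinearMap.id_apply, smul_eq_mul]
    rw [ContinuousLinearEquiv.symm_apply_eq]
    have : L ((deriv c t)⁻¹ * v) = (L : ℂ →L[ℝ] ℂ) ((deriv c t)⁻¹ * v) := rfl
    rw [this, hL]
    simp only [smul_apply, ContinuousLinearMap.id_apply, smul_eq_mul]
    rw [mul_inv_cancel_left₀ hne]
  · obtain ⟨ρ₁, hρ₁, hb₁⟩ := Metric.isOpen_iff.1 e.open_source 0 h0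
    -- Curve points near `c t` come from parameters near `t` modulo `1`, hence are chart values at
    -- small real `x`. Injectivity of the chart excludes any other preimage, so the curve is exactly
    -- the real axis.
    obtain ⟨ε, hε, hnear⟩ := h.exists_near t hρ₁
    have hcont : Continuous (taylorChart c t N) := (contDiff_taylorChart h.smooth t N).continuous
    have hpre : taylorChart c t N ⁻¹' Metric.ball (c t) ε ∈ 𝓝 (0 : ℂ) :=
      hcont.continuousAt.preimage_mem_nhds (by rw [hΘ0]; exact Metric.ball_mem_nhds _ hε)
    obtain ⟨ρ₂, hρ₂, hb₂⟩ := Metric.mem_nhds_iff.1 hpre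
    refine ⟨min ρ₁ ρ₂, lt_min hρ₁ hρ₂, (Metric.ball_subset_ball (min_le_left _ _)).trans hb₁, ?_⟩
    intro ζ hζ
    have hζ₁ : ζ ∈ Metric.ball (0 : ℂ) ρ₁ := Metric.ball_subset_ball (min_le_left _ _) hζ
    have hζ₂ : ζ ∈ Metric.ball (0 : ℂ) ρ₂ := Metric.ball_subset_ball (min_le_right _ _) hζ
    constructor
    · intro hmem
      rw [← h.range_eq] at hmem
      obtain ⟨s, hs⟩ := hmem
      have hlt : ‖c s - c t‖ < ε := by
        rw [hs]
        exact mem_ball_iff_norm.1 (hb₂ hζ₂)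
      obtain ⟨k, hk⟩ := hnear s hlt
      set x : ℝ := s - t - k
      have hx : (x : ℂ) ∈ Metric.ball (0 : ℂ) ρ₁ := by
        rw [mem_ball_zero_iff, norm_real]
        exact hk
      have e1 : taylorChart c t N x = taylorChart c t N ζ := by
        rw [taylorChart_ofReal, ← hs, ← h.apply_add_int (t + x) k]
        congr 1
        simp only [x]
        ring
      have e2 : (x : ℂ) = ζ := by
        rw [← he] at e1
        exact e.injOn (hb₁ hx) (hb₁ hζ₁) e1
      rw [← e2, ofReal_im]
    · intro him
      have : ζ = (ζ.re : ℂ) := by apply Complex.ext <;> simp [him]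
      rw [this, taylorChart_ofReal, ← h.range_eq]
      exact mem_range_self _

/-- `D` lies on the left (`σ = 1`) or on the right (`σ = -1`) of the curve `c` at `t`. -/
def Side (c : ℝ → ℂ) (D : Set ℂ) (σ t : ℝ) : Prop :=
  ∀ᶠ ε : ℝ in 𝓝[>] 0, c t + (ε * σ : ℝ) * (I * deriv c t) ∈ D

lemma isPreconnected_half (σ ρ : ℝ) : IsPreconnected (Metric.ball (0 : ℂ) ρ ∩ {ζ | 0 < σ * ζ.im}) := by
  refine Convex.isPreconnected ((convex_ball 0 ρ).inter ?_)
  have : {ζ : ℂ | 0 < σ * ζ.im} = (fun ζ : ℂ => σ * ζ.im) ⁻¹' Ioi 0 := rfl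
  rw [this]
  exact (convex_Ioi (0 : ℝ)).is_linear_preimage
    (f := fun ζ : ℂ => σ * ζ.im) ⟨fun x y => by simp [mul_add], fun a x => by simp; ring⟩

lemma subset_or_disjoint_of_isPreconnected {D T : Set ℂ} (hT : IsPreconnected T)
    (h : ∀ z ∈ T, z ∉ frontier D) : T ⊆ D ∨ ∀ z ∈ T, z ∉ D := by
  have hsub : T ⊆ interior D ∪ (closure D)ᶜ := fun z hz => by
    by_cases hzc : z ∈ closure D
    · exact Or.inl (by_contra fun hi => h z hz ⟨hzc, hi⟩)
    · exact Or.inr hzc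
  rcases hT.subset_or_subset isOpen_interior isClosed_closure.isOpen_compl
    (disjoint_compl_right.mono_left (interior_subset.trans subset_closure)) hsub with h1 | h1
  · exact Or.inl (h1.trans interior_subset)
  · exact Or.inr fun z hz hzD => h1 hz (subset_closure hzD)

section Sides

variable {c : ℝ → ℂ} {D : Set ℂ}

/-- The chart image of a half ball is connected and misses the boundary, so it lies in `D` or is
disjoint from it. Short normal segments start in that image, since the inverse chart has derivative
`σ * I` along them; this makes `Side` detect which case holds. -/
lemma side_dichotomy (h : IsParam c (frontier D)) {t : ℝ} {N : ℕ} {ρ : ℝ}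
    {e : OpenPartialHomeomorph ℂ ℂ} (he : (e : ℂ → ℂ) = taylorChart c t N)
    (hsd : HasFDerivAt e.symm ((deriv c t)⁻¹ • ContinuousLinearMap.id ℝ ℂ) (c t))
    (hs0 : e.symm (c t) = 0) (hρ : 0 < ρ) (hb : Metric.ball 0 ρ ⊆ e.source)
    (hS : ∀ ζ ∈ Metric.ball (0 : ℂ) ρ, taylorChart c t N ζ ∈ frontier D ↔ ζ.im = 0)
    {σ : ℝ} (hσ : σ ≠ 0) :
    (Side c D σ t ∧ ∀ ζ ∈ Metric.ball (0 : ℂ) ρ, 0 < σ * ζ.im → taylorChart c t N ζ ∈ D) ∨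
    (¬ Side c D σ t ∧ ∀ ζ ∈ Metric.ball (0 : ℂ) ρ, 0 < σ * ζ.im → taylorChart c t N ζ ∉ D) := by
  have hcont : ContinuousOn (taylorChart c t N) (Metric.ball 0 ρ) := by
    rw [← he]
    exact e.continuousOn.mono hb
  have hpre := (isPreconnected_half σ ρ).image (taylorChart c t N)
    (hcont.mono inter_subset_left)
  have hdich := subset_or_disjoint_of_isPreconnected (D := D) hpre (by
    rintro _ ⟨ζ, ⟨hζ, hζσ⟩, rfl⟩ hmem
    have := (hS ζ hζ).1 hmem
    rw [mem_ofPred_eq, this, mul_zero] at hζσ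
    exact lt_irrefl _ hζσ)
  have hne : deriv c t ≠ 0 := h.regular t
  have hts : c t ∈ e.target := by
    have h0 : (0 : ℂ) ∈ e.source := hb (Metric.mem_ball_self hρ)
    have : e 0 = c t := by
      rw [he]
      simpa using taylorChart_ofReal c t N 0
    rw [← this]
    exact e.map_source h0
  have hev : ∀ᶠ ε : ℝ in 𝓝[>] 0, ∃ ζ ∈ Metric.ball (0 : ℂ) ρ, 0 < σ * ζ.im ∧
      taylorChart c t N ζ = c t + (ε * σ : ℝ) * (I * deriv c t) := by
    set p : ℝ → ℂ := fun ε => c t + (ε * σ : ℝ) * (I * deriv c t)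
    have hp0 : p 0 = c t := by simp [p]
    have hpd : HasDerivAt p (σ * (I * deriv c t)) 0 := by
      have h1 : HasDerivAt (fun ε : ℝ => ((ε * σ : ℝ) : ℂ)) (σ : ℂ) 0 := by
        have := ((hasDerivAt_id (0 : ℝ)).mul_const σ).ofReal_comp
        simpa using this
      exact (h1.mul_const _).const_add _
    have hq : HasDerivAt (fun ε => e.symm (p ε)) (σ * I) 0 := by
      rw [← hp0] at hsd
      refine (hsd.comp_hasDerivAt (0 : ℝ) hpd).congr_deriv ?_
      simp only [smul_apply, ContinuousLinearMap.id_apply, smul_eq_mul]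
      field_simp
    have hpc : Tendsto p (𝓝[>] 0) (𝓝 (c t)) := by
      rw [← hp0]
      exact hpd.continuousAt.tendsto.mono_left nhdsWithin_le_nhds
    have hqim : HasDerivAt (fun ε => σ * (e.symm (p ε)).im) (σ * σ) 0 := by
      have := imCLM.hasFDerivAt.comp_hasDerivAt (0 : ℝ) hq
      have := this.const_mul σ
      simpa using this
    have hslope := hasDerivAt_iff_tendsto_slope.1 hqim
    have hpos : ∀ᶠ ε : ℝ in 𝓝[>] 0, 0 < slope (fun ε => σ * (e.symm (p ε)).im) 0 ε :=
      (hslope.mono_left (nhdsWithin_mono _ (fun x hx => ne_of_gt hx))).eventually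
        (lt_mem_nhds (mul_self_pos.2 hσ))
    have hball : ∀ᶠ ε : ℝ in 𝓝[>] 0, e.symm (p ε) ∈ Metric.ball (0 : ℂ) ρ := by
      have : Tendsto (fun ε => e.symm (p ε)) (𝓝[>] 0) (𝓝 (e.symm (p 0))) :=
        hq.continuousAt.tendsto.mono_left nhdsWithin_le_nhds
      rw [hp0, hs0] at this
      exact this.eventually (Metric.ball_mem_nhds _ hρ)
    filter_upwards [hpos, hball, hpc.eventually (e.open_target.mem_nhds hts), self_mem_nhdsWithin]
      with ε h1 h2 h3 h4
    refine ⟨e.symm (p ε), h2, ?_, ?_⟩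
    · rw [slope_def_field, hp0, hs0] at h1
      simp only [zero_im, mul_zero, sub_zero] at h1
      have h4' : (0 : ℝ) < ε := h4
      rcases div_pos_iff.1 h1 with h | h
      · exact h.1
      · linarith [h.2]
    · rw [← he]
      exact e.right_inv h3
  rcases hdich with hd | hd
  · left
    refine ⟨?_, fun ζ hζ hζσ => hd ⟨ζ, ⟨hζ, hζσ⟩, rfl⟩⟩
    filter_upwards [hev] with ε hε
    obtain ⟨ζ, h1, h2, h3⟩ := hε
    rw [← h3]
    exact hd ⟨ζ, ⟨h1, h2⟩, rfl⟩
  · right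
    refine ⟨fun hside => ?_, fun ζ hζ hζσ => hd _ ⟨ζ, ⟨hζ, hζσ⟩, rfl⟩⟩
    obtain ⟨ε, ⟨ζ, h1, h2, h3⟩, h4⟩ := (hev.and hside).exists
    rw [← h3] at h4
    exact hd _ ⟨ζ, ⟨h1, h2⟩, rfl⟩ h4

lemma side_eventually (h : IsParam c (frontier D)) {σ : ℝ} (hσ : σ ≠ 0) (t₀ : ℝ) :
    ∀ᶠ t in 𝓝 t₀, Side c D σ t = Side c D σ t₀ := by
  obtain ⟨e, he, -, hs0, hsd, ρ, hρ, hb, hS⟩ := exists_chart h t₀ (le_refl 1)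
  have hdich := side_dichotomy h he hsd hs0 hρ hb hS hσ
  have hev : ∀ᶠ t in 𝓝 t₀, ∀ᶠ ε : ℝ in 𝓝[>] 0, ∃ ζ ∈ Metric.ball (0 : ℂ) ρ, 0 < σ * ζ.im ∧
      taylorChart c t₀ 1 ζ = c t + (ε * σ : ℝ) * (I * deriv c t) := by
    filter_upwards [Metric.ball_mem_nhds t₀ hρ] with t ht
    have hlt : |t - t₀| < ρ := by simpa [Real.dist_eq] using ht
    have htend : Tendsto (fun ε : ℝ => |t - t₀| + |ε * σ|) (𝓝[>] 0) (𝓝 (|t - t₀| + |0 * σ|)) := by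
      have : Continuous (fun ε : ℝ => |t - t₀| + |ε * σ|) := by fun_prop
      exact (this.tendsto 0).mono_left nhdsWithin_le_nhds
    rw [zero_mul, abs_zero, add_zero] at htend
    filter_upwards [htend.eventually (gt_mem_nhds hlt), self_mem_nhdsWithin] with ε hε hε0
    have hε0' : (0 : ℝ) < ε := hε0
    -- The chart of order one is `c (t₀ + x) + I y c'(t₀ + x)`, so normal segments at nearby points
    -- are vertical lines in a single chart.
    refine ⟨((t - t₀ : ℝ) : ℂ) + ((ε * σ : ℝ) : ℂ) * I, ?_, ?_, ?_⟩
    · rw [mem_ball_zero_iff]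
      refine lt_of_le_of_lt ((norm_add_le _ _).trans ?_) hε
      rw [norm_mul, norm_real, norm_real, norm_I, mul_one]
      rfl
    · simp only [add_im, ofReal_im, mul_im, ofReal_re, I_im, mul_one, I_re, mul_zero, add_zero,
        zero_add]
      have : 0 < σ * σ := mul_self_pos.2 hσ
      nlinarith
    · simp [taylorChart, Finset.sum_range_succ]
      ring
  filter_upwards [hev] with t ht
  rw [eq_iff_iff]
  rcases hdich with ⟨h1, h2⟩ | ⟨h1, h2⟩
  · refine ⟨fun _ => h1, fun _ => ?_⟩
    filter_upwards [ht] with ε hε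
    obtain ⟨ζ, e1, e2, e3⟩ := hε
    rw [← e3]
    exact h2 ζ e1 e2
  · refine ⟨fun hs => ?_, fun hs => absurd hs h1⟩
    obtain ⟨ε, ⟨ζ, e1, e2, e3⟩, e4⟩ := (ht.and hs).exists
    rw [← e3] at e4
    exact absurd e4 (h2 ζ e1 e2)

lemma side_const (h : IsParam c (frontier D)) {σ : ℝ} (hσ : σ ≠ 0) (t s : ℝ) :
    Side c D σ t = Side c D σ s := by
  have hl : IsLocallyConstant (fun t => Side c D σ t) :=
    (IsLocallyConstant.iff_eventually_eq _).2 (side_eventually h hσ)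
  exact hl.apply_eq_of_isPreconnected isPreconnected_univ (mem_univ t) (mem_univ s)

/-- The domain is on at least one side since boundary points are limits of `D`. It is not on both,
since otherwise the closure of `D` would be open as well as closed, hence the whole plane, against
boundedness. -/
lemma exists_one_side (hD : IsOpen D) (hbd : Bornology.IsBounded D)
    (h : IsParam c (frontier D)) :
    ∃ σ : ℝ, (σ = 1 ∨ σ = -1) ∧ (∀ t, Side c D σ t) ∧ ∀ t, ¬ Side c D (-σ) t := by
  have hcl : closure D = D ∪ frontier D := closure_eq_self_union_frontier D
  have hex : Side c D 1 0 ∨ Side c D (-1) 0 := by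
    obtain ⟨e, he, -, hs0, hsd, ρ, hρ, hb, hS⟩ := exists_chart h 0 (le_refl 1)
    by_contra hcon
    rw [not_or] at hcon
    have d1 := side_dichotomy h he hsd hs0 hρ hb hS one_ne_zero
    have d2 := side_dichotomy h he hsd hs0 hρ hb hS (neg_ne_zero.2 one_ne_zero)
    rcases d1 with d1 | d1
    · exact hcon.1 d1.1
    rcases d2 with d2 | d2
    · exact hcon.2 d2.1
    have hop : IsOpen (e '' Metric.ball 0 ρ) := e.isOpen_image_of_subset_source Metric.isOpen_ball hb
    have hmem : c 0 ∈ e '' Metric.ball 0 ρ :=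
      ⟨0, Metric.mem_ball_self hρ, by rw [he]; simpa using taylorChart_ofReal c 0 1 0⟩
    have hc0 : c 0 ∈ closure D := by
      rw [hcl, ← h.range_eq]
      exact Or.inr (mem_range_self 0)
    obtain ⟨z, ⟨ζ, hζ, rfl⟩, hzD⟩ := mem_closure_iff.1 hc0 _ hop hmem
    rw [he] at hzD
    rcases lt_trichotomy ζ.im 0 with h0 | h0 | h0
    · exact d2.2 ζ hζ (by linarith) hzD
    · have := (hS ζ hζ).2 h0
      rw [hD.frontier_eq] at this
      exact this.2 hzD
    · exact d1.2 ζ hζ (by linarith) hzD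
  have hnb : ¬ (Side c D 1 0 ∧ Side c D (-1) 0) := by
    rintro ⟨h1, h2⟩
    have hopen : IsOpen (closure D) := by
      rw [isOpen_iff_mem_nhds]
      intro z hz
      rw [hcl] at hz
      rcases hz with hz | hz
      · exact mem_of_superset (hD.mem_nhds hz) subset_closure
      · rw [← h.range_eq] at hz
        obtain ⟨t, rfl⟩ := hz
        obtain ⟨e, he, -, hs0, hsd, ρ, hρ, hb, hS⟩ := exists_chart h t (le_refl 1)
        rw [side_const h one_ne_zero 0 t] at h1
        rw [side_const h (neg_ne_zero.2 one_ne_zero) 0 t] at h2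
        have d1 := (side_dichotomy h he hsd hs0 hρ hb hS one_ne_zero).resolve_right
          (fun hh => hh.1 h1)
        have d2 := (side_dichotomy h he hsd hs0 hρ hb hS (neg_ne_zero.2 one_ne_zero)).resolve_right
          (fun hh => hh.1 h2)
        have hop : IsOpen (e '' Metric.ball 0 ρ) :=
          e.isOpen_image_of_subset_source Metric.isOpen_ball hb
        have hmem : c t ∈ e '' Metric.ball 0 ρ :=
          ⟨0, Metric.mem_ball_self hρ, by rw [he]; simpa using taylorChart_ofReal c t 1 0⟩
        refine mem_of_superset (hop.mem_nhds hmem) ?_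
        rintro _ ⟨ζ, hζ, rfl⟩
        rw [he, hcl]
        rcases lt_trichotomy ζ.im 0 with h0 | h0 | h0
        · exact Or.inl (d2.2 ζ hζ (by linarith))
        · exact Or.inr ((hS ζ hζ).2 h0)
        · exact Or.inl (d1.2 ζ hζ (by linarith))
    have huniv : closure D = univ := by
      refine IsClopen.eq_univ ⟨isClosed_closure, hopen⟩ ⟨c 0, ?_⟩
      rw [hcl, ← h.range_eq]
      exact Or.inr (mem_range_self 0)
    have := hbd.closure
    rw [huniv] at this
    exact NormedSpace.unbounded_univ ℝ ℂ this
  rcases hex with h1 | h1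
  · refine ⟨1, Or.inl rfl, fun t => ?_, fun t ht => hnb ⟨h1, ?_⟩⟩
    · rw [side_const h one_ne_zero t 0]; exact h1
    · rw [side_const h (neg_ne_zero.2 one_ne_zero) 0 t]; exact ht
  · refine ⟨-1, Or.inr rfl, fun t => ?_, fun t ht => hnb ⟨?_, h1⟩⟩
    · rw [side_const h (neg_ne_zero.2 one_ne_zero) t 0]; exact h1
    · rw [neg_neg, side_const h one_ne_zero t 0] at ht; exact ht

/-- `c` parametrizes the boundary of `D`, with `D` on its left side only. -/
structure IsLeftParam (c : ℝ → ℂ) (D : Set ℂ) : Prop extends IsParam c (frontier D) where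
  isOpen : IsOpen D
  left : ∀ t, Side c D 1 t
  not_right : ∀ t, ¬ Side c D (-1) t

/-- The orientation is fixed by the side of `D`, reversing the curve if necessary. The sign of the
enclosed area plays no role, so the Jordan curve theorem is not involved. -/
lemma exists_isLeftParam (hD : IsSmoothJordanInterior D) : ∃ c, IsLeftParam c D := by
  obtain ⟨c, hc⟩ := hD.frontier_jordan
  have h := hc.isParam
  obtain ⟨σ, hσ, h1, h2⟩ := exists_one_side hD.isOpen hD.isBounded h
  rcases hσ with rfl | rfl
  · exact ⟨c, h, hD.isOpen, h1, h2⟩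
  · have key : ∀ σ t, Side (fun t => c (-t)) D σ t = Side c D (-σ) (-t) := by
      intro σ t
      have : deriv (fun t => c (-t)) t = - deriv c (-t) := deriv_comp_neg c t
      simp only [Side, this]
      congr! 3 with ε
      push_cast
      ring
    refine ⟨fun t => c (-t), h.reverse, hD.isOpen, fun t => ?_, fun t => ?_⟩
    · rw [key]; exact h1 _
    · rw [key]; exact h2 _

/-- Boundary charts: the upper half disc corresponds to `D`, the lower one to the exterior. -/
lemma IsLeftParam.exists_chart (h : IsLeftParam c D) (t : ℝ) {N : ℕ} (hN : 1 ≤ N) :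
    ∃ e : OpenPartialHomeomorph ℂ ℂ, (e : ℂ → ℂ) = taylorChart c t N ∧
      ContDiffAt ℝ ∞ e.symm (c t) ∧ e.symm (c t) = 0 ∧
      HasFDerivAt e.symm ((deriv c t)⁻¹ • ContinuousLinearMap.id ℝ ℂ) (c t) ∧
      ∃ ρ > 0, Metric.ball 0 ρ ⊆ e.source ∧
        ∀ ζ ∈ Metric.ball (0 : ℂ) ρ, (taylorChart c t N ζ ∈ D ↔ 0 < ζ.im) ∧
          (taylorChart c t N ζ ∈ frontier D ↔ ζ.im = 0) := by
  obtain ⟨e, he, hcd, hs0, hsd, ρ, hρ, hb, hS⟩ := GreenLevel.exists_chart h.toIsParam t hN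
  refine ⟨e, he, hcd, hs0, hsd, ρ, hρ, hb, fun ζ hζ => ⟨?_, hS ζ hζ⟩⟩
  have d1 := (side_dichotomy h.toIsParam he hsd hs0 hρ hb hS one_ne_zero).resolve_right
    (fun hh => hh.1 (h.left t))
  have d2 := (side_dichotomy h.toIsParam he hsd hs0 hρ hb hS
    (neg_ne_zero.2 one_ne_zero)).resolve_left (fun hh => h.not_right t hh.1)
  constructor
  · intro hmem
    by_contra hle
    rcases lt_or_eq_of_le (not_lt.1 hle) with h0 | h0
    · exact d2.2 ζ hζ (by linarith) hmem
    · have := (hS ζ hζ).2 h0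
      rw [h.isOpen.frontier_eq] at this
      exact this.2 hmem
  · intro h0
    exact d1.2 ζ hζ (by linarith)

end Sides

/-! ### Boundary regularity and interior balls. -/

section BoundaryRegularity

variable {c : ℝ → ℂ} {D : Set ℂ}

lemma taylorChart_zero (c : ℝ → ℂ) (t : ℝ) (N : ℕ) : taylorChart c t N 0 = c t := by
  simpa using taylorChart_ofReal c t N 0

/-- A holomorphic function on a smooth domain whose real part vanishes on the boundary is smooth up
to the boundary. -/
theorem IsLeftParam.exists_contDiffAt_extension (h : IsLeftParam c D) (t : ℝ) {r₀ : ℝ}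
    (hr₀ : 0 < r₀) {F : ℂ → ℂ} (hF : DifferentiableOn ℂ F (D ∩ Metric.ball (c t) r₀))
    (hlim : ∀ q ∈ frontier D ∩ Metric.ball (c t) r₀,
      Tendsto (fun z => (F z).re) (𝓝[D] q) (𝓝 0)) (n : ℕ) :
    ∃ Fe : ℂ → ℂ, ContDiffAt ℝ n Fe (c t) ∧ ∀ᶠ z in 𝓝[D] (c t), Fe z = F z := by
  have hpf : c t ∈ frontier D := by rw [← h.range_eq]; exact mem_range_self t
  have hbd : ∀ᶠ z in 𝓝[D] (c t), |(F z).re| ≤ 1 := by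
    filter_upwards [(hlim _ ⟨hpf, Metric.mem_ball_self hr₀⟩).eventually
      (Metric.closedBall_mem_nhds (0 : ℝ) one_pos)] with z hz
    simpa [Real.dist_eq] using hz
  obtain ⟨r₁, hr₁, hb₁⟩ := Metric.mem_nhdsWithin_iff.1 hbd
  obtain ⟨e, he, hcd, hs0, -, ρ, hρ, hb, hch⟩ := h.exists_chart t (N := n + 4) (by omega)
  set Θ := taylorChart c t (n + 4) with hΘ
  have hΘs : ContDiff ℝ ∞ Θ := contDiff_taylorChart h.smooth t _
  have hΘ0 : Θ 0 = c t := taylorChart_zero c t _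
  have h0s : (0 : ℂ) ∈ e.source := hb (Metric.mem_ball_self hρ)
  have hpt : c t ∈ e.target := by
    rw [← hΘ0, ← he]; exact e.map_source h0s
  obtain ⟨K, s, hs, hlip⟩ := (hcd.of_le (by simp) : ContDiffAt ℝ 1 e.symm (c t)).exists_lipschitzOnWith
  obtain ⟨r₂, hr₂, hb₂⟩ := Metric.mem_nhds_iff.1 (inter_mem hs (e.open_target.mem_nhds hpt))
  set r₃ := min r₀ (min r₁ r₂)
  have hr₃ : 0 < r₃ := lt_min hr₀ (lt_min hr₁ hr₂)
  have h30 : r₃ ≤ r₀ := min_le_left _ _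
  have h31 : r₃ ≤ r₁ := (min_le_right _ _).trans (min_le_left _ _)
  have h32 : r₃ ≤ r₂ := (min_le_right _ _).trans (min_le_right _ _)
  have hpre : Θ ⁻¹' Metric.ball (c t) (r₃ / 2) ∈ 𝓝 (0 : ℂ) :=
    hΘs.continuous.continuousAt.preimage_mem_nhds
      (by rw [hΘ0]; exact Metric.ball_mem_nhds _ (half_pos hr₃))
  obtain ⟨ρ₁, hρ₁, hbρ₁⟩ := Metric.mem_nhds_iff.1 hpre
  set ρ₂ := min (ρ / 2) (min ρ₁ (r₃ / 2))
  have hρ₂ : 0 < ρ₂ := lt_min (half_pos hρ) (lt_min hρ₁ (half_pos hr₃))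
  have h2ρ : ρ₂ ≤ ρ / 2 := min_le_left _ _
  have h2ρ₁ : ρ₂ ≤ ρ₁ := (min_le_right _ _).trans (min_le_left _ _)
  have h2r : ρ₂ ≤ r₃ / 2 := (min_le_right _ _).trans (min_le_right _ _)
  -- With `K` a Lipschitz constant of the inverse chart, the ball of radius `m * Im ζ` about `Θ ζ`
  -- pulls back to within less than `Im ζ` of `ζ`, hence stays in the upper half plane and so in
  -- `D`.
  set m : ℝ := 1 / (K + 1)
  have hK0 : (0 : ℝ) ≤ K := K.coe_nonneg
  have hm : 0 < m := by positivity
  have hm1 : m ≤ 1 := by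
    rw [div_le_one (by positivity)]; linarith
  have hKm : K * m < 1 := by
    rw [mul_one_div, div_lt_one (by positivity)]; linarith
  set Ω := D ∩ Metric.ball (c t) r₃
  have hΩ : IsOpen Ω := h.isOpen.inter Metric.isOpen_ball
  set A : ℂ → ℂ := fun ζ => iteratedDeriv (n + 4 + 1) c (t + ζ.re) *
    (I ^ (n + 4) / (n + 4).factorial)
  have hA : ContDiff ℝ ∞ A := (contDiff_iteratedDeriv_re h.smooth t _).mul contDiff_const
  have hdb : ∀ ζ, dbar Θ ζ = ζ.im ^ (n + 4) * A ζ := fun ζ => by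
    rw [dbar_taylorChart h.smooth, mul_pow]
    simp only [A]
    ring
  have hball : ∀ ζ ∈ halfDisc ρ₂, Metric.ball (Θ ζ) (m * ζ.im) ⊆ Ω := by
    rintro ζ ⟨hζ, hζi⟩ z hz
    have hζi : 0 < ζ.im := hζi
    have hζn : ‖ζ‖ < ρ₂ := mem_ball_zero_iff.1 hζ
    have him : ζ.im ≤ ‖ζ‖ := (le_abs_self _).trans (abs_im_le_norm ζ)
    have hΘζ : dist (Θ ζ) (c t) < r₃ / 2 :=
      hbρ₁ (Metric.ball_subset_ball h2ρ₁ hζ)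
    have hzd : dist z (Θ ζ) < m * ζ.im := hz
    have hmi : m * ζ.im ≤ ζ.im := mul_le_of_le_one_left hζi.le hm1
    have hz3 : dist z (c t) < r₃ := by linarith [dist_triangle z (Θ ζ) (c t)]
    have hζb : ζ ∈ Metric.ball (0 : ℂ) ρ := mem_ball_zero_iff.2 (by linarith)
    have hsz := hb₂ (show z ∈ Metric.ball (c t) r₂ from lt_of_lt_of_le hz3 h32)
    have hsΘ := hb₂ (show Θ ζ ∈ Metric.ball (c t) r₂ from by
      rw [Metric.mem_ball]; linarith)
    have hl := hlip.dist_le_mul z hsz.1 (Θ ζ) hsΘ.1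
    have hinv : e.symm (Θ ζ) = ζ := by
      rw [← he]; exact e.left_inv (hb hζb)
    rw [hinv] at hl
    have hl2 : dist (e.symm z) ζ < ζ.im := by
      calc _ ≤ K * dist z (Θ ζ) := hl
        _ ≤ K * (m * ζ.im) := by gcongr
        _ = (K * m) * ζ.im := by ring
        _ < 1 * ζ.im := by gcongr
        _ = ζ.im := one_mul _
    rw [dist_eq_norm] at hl2
    have him2 : 0 < (e.symm z).im := by
      have := (abs_le.1 (abs_im_le_norm (e.symm z - ζ))).1
      rw [sub_im] at this
      linarith
    have hn2 : ‖e.symm z‖ < ρ := by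
      have := norm_add_le (e.symm z - ζ) ζ
      rw [sub_add_cancel] at this
      linarith
    have := ((hch _ (mem_ball_zero_iff.2 hn2)).1).2 him2
    rw [← he, e.right_inv hsz.2] at this
    exact ⟨this, hz3⟩
  have hlim' : ∀ x : ℝ, |x| < ρ₂ →
      Tendsto (fun ζ => (F (Θ ζ)).re) (𝓝[{z | 0 < z.im}] (x : ℂ)) (𝓝 0) := by
    intro x hx
    have hxb : (x : ℂ) ∈ Metric.ball (0 : ℂ) ρ₂ := by
      rw [mem_ball_zero_iff, norm_real]; exact hx
    have hsub : Metric.ball (0 : ℂ) ρ₂ ⊆ Metric.ball 0 ρ := Metric.ball_subset_ball (by linarith)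
    have hxf : Θ x ∈ frontier D := ((hch _ (hsub hxb)).2).2 (ofReal_im x)
    have hxr : Θ x ∈ Metric.ball (c t) r₀ := by
      have : dist (Θ x) (c t) < r₃ / 2 := hbρ₁ (Metric.ball_subset_ball h2ρ₁ hxb)
      rw [Metric.mem_ball]; linarith
    refine (hlim _ ⟨hxf, hxr⟩).comp (tendsto_nhdsWithin_iff.2 ⟨?_, ?_⟩)
    · exact hΘs.continuous.continuousAt.tendsto.mono_left nhdsWithin_le_nhds
    · filter_upwards [self_mem_nhdsWithin,
        mem_nhdsWithin_of_mem_nhds (Metric.isOpen_ball.mem_nhds hxb)] with ζ h1 h2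
      exact ((hch _ (hsub h2)).1).2 h1
  obtain ⟨r, hr, hrρ, U, hU, hUF⟩ := exists_contDiffOn_extension hΩ
    (hF.mono (inter_subset_inter_right _ (Metric.ball_subset_ball h30)))
    (fun z hz => hb₁ ⟨Metric.ball_subset_ball h31 hz.2, hz.1⟩) hΘs hA (le_refl (n + 4)) hdb hρ₂ hm
    hball hlim'
  refine ⟨U ∘ e.symm, ?_, ?_⟩
  · have h1 : ContDiffAt ℝ n U (e.symm (c t)) := by
      rw [hs0]
      exact (hU.contDiffAt (Metric.ball_mem_nhds _ hr)).of_le (by norm_cast; omega)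
    exact h1.comp _ (hcd.of_le (by exact_mod_cast le_top))
  · have hc : Tendsto e.symm (𝓝[D] (c t)) (𝓝 0) := by
      have := hcd.continuousAt.tendsto
      rw [hs0] at this
      exact this.mono_left nhdsWithin_le_nhds
    filter_upwards [hc.eventually (Metric.ball_mem_nhds _ hr), self_mem_nhdsWithin,
      mem_nhdsWithin_of_mem_nhds (e.open_target.mem_nhds hpt)] with z h1 h2 h3
    have hez : Θ (e.symm z) = z := by rw [← he]; exact e.right_inv h3
    have hpos : 0 < (e.symm z).im := by
      refine ((hch _ (Metric.ball_subset_ball (by linarith) h1)).1).1 ?_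
      rw [hez]; exact h2
    rw [Function.comp_apply, hUF _ ⟨h1, hpos⟩, hez]

/-- The interior ball condition. -/
lemma IsLeftParam.exists_interior_ball (h : IsLeftParam c D) (t : ℝ) :
    ∃ q : ℂ, ∃ ρ > 0, ‖c t - q‖ = ρ ∧ Metric.ball q ρ ⊆ D := by
  obtain ⟨e, he, hcd, hs0, hsd, ρ, hρ, hb, hch⟩ := h.exists_chart t (N := 1) le_rfl
  have hne := h.regular t
  have h0s : (0 : ℂ) ∈ e.source := hb (Metric.mem_ball_self hρ)
  have hpt : c t ∈ e.target := by
    rw [← taylorChart_zero c t 1, ← he]; exact e.map_source h0s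
  have hcd1 : ContDiffAt ℝ 1 (fderiv ℝ e.symm) (c t) :=
    (hcd.fderiv_right (m := ∞) (by simp)).of_le (by simp)
  obtain ⟨K, s, hs, hlip⟩ := hcd1.exists_lipschitzOnWith
  have hdiff : ∀ᶠ z in 𝓝 (c t), DifferentiableAt ℝ e.symm z := by
    filter_upwards [(hcd.of_le (by simp) : ContDiffAt ℝ 1 e.symm (c t)).eventually (by simp)]
      with z hz using hz.differentiableAt (by simp)
  have hball : ∀ᶠ z in 𝓝 (c t), e.symm z ∈ Metric.ball (0 : ℂ) ρ := by
    have := hcd.continuousAt.tendsto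
    rw [hs0] at this
    exact this.eventually (Metric.ball_mem_nhds _ hρ)
  obtain ⟨r, hr, hbr⟩ := Metric.mem_nhds_iff.1
    (inter_mem (inter_mem hs hdiff) (inter_mem hball (e.open_target.mem_nhds hpt)))
  have hst : c t ∈ s := mem_of_mem_nhds hs
  set w := deriv c t
  -- Second-order Taylor bound for the inverse chart, from the mean value inequality and the
  -- Lipschitz constant `K` of its derivative.
  have htaylor : ∀ z ∈ Metric.ball (c t) r, ‖e.symm z - w⁻¹ * (z - c t)‖ ≤ K * ‖z - c t‖ ^ 2 := by
    intro z hz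
    have hconv : Convex ℝ (Metric.closedBall (c t) ‖z - c t‖) := convex_closedBall _ _
    have hsub : Metric.closedBall (c t) ‖z - c t‖ ⊆ Metric.ball (c t) r :=
      Metric.closedBall_subset_ball (mem_ball_iff_norm.1 hz)
    have hmv := hconv.norm_image_sub_le_of_norm_fderiv_le' (𝕜 := ℝ) (f := e.symm)
      (φ := fderiv ℝ e.symm (c t)) (C := K * ‖z - c t‖) (x := c t) (y := z)
      (fun x hx => (hbr (hsub hx)).1.2) (fun x hx => by
        rw [← dist_eq_norm]
        refine (hlip.dist_le_mul x (hbr (hsub hx)).1.1 _ hst).trans ?_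
        have : dist x (c t) ≤ ‖z - c t‖ := hx
        gcongr) (Metric.mem_closedBall_self (norm_nonneg _)) (by simp [dist_eq_norm])
    rw [hs0, hsd.fderiv] at hmv
    simp only [sub_zero, smul_apply, ContinuousLinearMap.id_apply, smul_eq_mul] at hmv
    rw [pow_two, ← mul_assoc]
    exact hmv
  have hw : 0 < ‖w‖ := norm_pos_iff.2 hne
  -- With `a` the displacement in the frame of the inward normal, the ball means `‖a‖ ^ 2 < 2 * ρ' *
  -- a.re`. This choice lets the linear term `a.re / ‖w‖` of the height dominate the quadratic error
  -- `K * ‖a‖ ^ 2`.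
  set ρ' := min (r / 2) (1 / (2 * (K + 1) * ‖w‖))
  have hK0 : (0 : ℝ) ≤ K := K.coe_nonneg
  have hρ' : 0 < ρ' := lt_min (half_pos hr) (by positivity)
  set ν : ℂ := I * w / ‖w‖
  have hwc : (‖w‖ : ℂ) ≠ 0 := by exact_mod_cast hw.ne'
  have hν : ‖ν‖ = 1 := by
    rw [norm_div, norm_mul, norm_I, one_mul, norm_real, norm_norm, div_self hw.ne']
  refine ⟨c t + ρ' * ν, ρ', hρ', ?_, ?_⟩
  · rw [sub_add_cancel_left, norm_neg, norm_mul, hν, norm_real, mul_one, Real.norm_of_nonneg hρ'.le]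
  · intro z hz
    have hzn : ‖z - c t - ρ' * ν‖ < ρ' := by
      rw [sub_sub]; exact mem_ball_iff_norm.1 hz
    set v := z - c t with hv
    set a := v * conj ν
    have hva : v = a * ν := by
      simp only [a]
      rw [mul_assoc, mul_comm (conj ν), mul_conj, normSq_eq_norm_sq, hν]; simp
    have hvn : ‖v‖ = ‖a‖ := by rw [hva, norm_mul, hν, mul_one]
    have hna : ‖a - ρ'‖ < ρ' := by
      have : v - ρ' * ν = (a - ρ') * ν := by rw [sub_mul, ← hva]
      rw [this, norm_mul, hν, mul_one] at hzn
      exact hzn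
    have hsq : ‖a‖ ^ 2 < 2 * ρ' * a.re := by
      have h1 : ‖a - ρ'‖ ^ 2 < ρ' ^ 2 := by
        have := norm_nonneg (a - ρ'); nlinarith
      rw [← normSq_eq_norm_sq, normSq_apply] at h1 ⊢
      simp only [sub_re, sub_im, ofReal_re, ofReal_im, sub_zero] at h1
      nlinarith
    have har : 0 < a.re := by
      have := sq_nonneg ‖a‖
      by_contra hcon
      nlinarith [not_lt.1 hcon]
    have hzr : z ∈ Metric.ball (c t) r := by
      rw [mem_ball_iff_norm, ← hv, hvn]
      have h1 := norm_add_le (a - ρ') (ρ' : ℂ)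
      rw [sub_add_cancel, norm_real, Real.norm_of_nonneg hρ'.le] at h1
      have : ρ' ≤ r / 2 := min_le_left _ _
      linarith
    have ht := htaylor z hzr
    have him : (w⁻¹ * v).im = a.re / ‖w‖ := by
      have : w⁻¹ * v = I * (a / ‖w‖) := by
        rw [hva]; simp only [ν]; field_simp
      rw [this, I_mul_im, div_ofReal_re]
    have him2 := (abs_le.1 ((abs_im_le_norm _).trans ht)).1
    rw [sub_im, ← hv, him, hvn] at him2
    have hρK : (K + 1) * (2 * ρ') ≤ 1 / ‖w‖ := by
      have : ρ' ≤ 1 / (2 * (K + 1) * ‖w‖) := min_le_right _ _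
      calc ((K : ℝ) + 1) * (2 * ρ') ≤ (K + 1) * (2 * (1 / (2 * (K + 1) * ‖w‖))) := by gcongr
        _ = 1 / ‖w‖ := by field_simp
    have hpos : 0 < (e.symm z).im := by
      have h1 : (K : ℝ) * ‖a‖ ^ 2 < a.re / ‖w‖ := by
        calc (K : ℝ) * ‖a‖ ^ 2 ≤ (K + 1) * ‖a‖ ^ 2 := by gcongr; linarith
          _ < (K + 1) * (2 * ρ' * a.re) := by gcongr
          _ = (K + 1) * (2 * ρ') * a.re := by ring
          _ ≤ 1 / ‖w‖ * a.re := by gcongr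
          _ = a.re / ‖w‖ := by ring
      linarith
    have := ((hch _ (hbr hzr).2.1).1).2 hpos
    rw [← he, e.right_inv (hbr hzr).2.2] at this
    exact this

end BoundaryRegularity

/-! ### The Hopf lemma for maps into the disc. -/

/-- A boundary estimate of Schwarz–Pick type. -/
lemma one_sub_norm_ge {f : ℂ → ℂ} {q : ℂ} {ρ : ℝ} (hρ : 0 < ρ)
    (hf : DifferentiableOn ℂ f (Metric.ball q ρ)) (hm : ∀ z ∈ Metric.ball q ρ, ‖f z‖ < 1) {z : ℂ}
    (hz : z ∈ Metric.ball q ρ) :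
    (1 - ‖f q‖) / 2 * (1 - ‖z - q‖ / ρ) ≤ 1 - ‖f z‖ := by
  set a := f q
  have ha : ‖a‖ < 1 := hm q (Metric.mem_ball_self hρ)
  have hden : ∀ z ∈ Metric.ball q ρ, 1 - conj a * f z ≠ 0 := by
    intro z hz h0
    have : ‖conj a * f z‖ = 1 := by rw [← sub_eq_zero.1 h0, norm_one]
    rw [norm_mul, norm_conj] at this
    nlinarith [hm z hz, norm_nonneg a, norm_nonneg (f z)]
  -- Composition with the disc automorphism sending `f q` to `0`; the Schwarz lemma bounds `b`, and
  -- inverting gives `‖f z‖ ≤ (‖a‖ + x) / (1 + ‖a‖ x)` with `x = ‖z - q‖ / ρ`.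
  set b : ℂ → ℂ := fun z => (f z - a) / (1 - conj a * f z)
  have hbd : DifferentiableOn ℂ b (Metric.ball q ρ) :=
    (hf.sub_const a).div ((hf.const_mul _).const_sub 1) hden
  have hbq : b q = 0 := by simp [b, a]
  have hsq : ∀ z ∈ Metric.ball q ρ, ‖f z - a‖ ^ 2 ≤ ‖1 - conj a * f z‖ ^ 2 := by
    intro z hz
    have h1 := hm z hz
    have h2 : (1 - normSq a) * (1 - normSq (f z)) =
        normSq (1 - conj a * f z) - normSq (f z - a) := by
      simp only [normSq_apply, sub_re, sub_im, mul_re, mul_im, conj_re, conj_im, one_re, one_im]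
      ring
    rw [normSq_eq_norm_sq, normSq_eq_norm_sq, normSq_eq_norm_sq, normSq_eq_norm_sq] at h2
    have h3 : 0 ≤ 1 - ‖a‖ ^ 2 := by nlinarith [norm_nonneg a]
    have h4 : 0 ≤ 1 - ‖f z‖ ^ 2 := by nlinarith [norm_nonneg (f z)]
    nlinarith [mul_nonneg h3 h4]
  have hle : ‖b z‖ ≤ ‖z - q‖ / ρ := by
    have := dist_le_div_mul_dist_of_mapsTo_ball (f := b) (c := q) (R₁ := ρ) (R₂ := 1) hbd
      (fun z hz => by
        rw [hbq, mem_closedBall_zero_iff, norm_div, div_le_one (norm_pos_iff.2 (hden z hz))]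
        exact (sq_le_sq₀ (norm_nonneg _) (norm_nonneg _)).1 (hsq z hz)) hz
    rw [hbq, dist_zero_right, dist_eq_norm] at this
    rw [div_eq_mul_inv, mul_comm]
    simpa using this
  set x := ‖z - q‖ / ρ
  have hx1 : x < 1 := (div_lt_one hρ).2 (mem_ball_iff_norm.1 hz)
  have hx0 : 0 ≤ x := by positivity
  have hfz : f z = (a + b z) / (1 + conj a * b z) := by
    have h1 := hden z hz
    have h2 : 1 + conj a * b z ≠ 0 := by
      intro h0
      have : ‖conj a * b z‖ = 1 := by
        rw [eq_neg_of_add_eq_zero_right h0, norm_neg, norm_one]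
      rw [norm_mul, norm_conj] at this
      nlinarith [norm_nonneg a, norm_nonneg (b z)]
    rw [eq_div_iff h2]
    have h3 : b z * (1 - conj a * f z) = f z - a := div_mul_cancel₀ _ h1
    linear_combination -h3
  have hA0 := norm_nonneg a
  have hB0 := norm_nonneg (b z)
  have key : ‖f z‖ * (1 + ‖a‖ * x) ≤ ‖a‖ + x := by
    have hb1 : ‖b z‖ < 1 := hle.trans_lt hx1
    have h1 : ‖f z‖ ^ 2 * ‖1 + conj a * b z‖ ^ 2 = ‖a + b z‖ ^ 2 := by
      rw [← mul_pow, ← norm_mul, hfz, div_mul_cancel₀]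
      intro h0
      have : ‖conj a * b z‖ = 1 := by
        rw [eq_neg_of_add_eq_zero_right h0, norm_neg, norm_one]
      rw [norm_mul, norm_conj] at this
      nlinarith
    have h2 : (1 - ‖a‖ ^ 2) * (1 - ‖b z‖ ^ 2) = ‖1 + conj a * b z‖ ^ 2 - ‖a + b z‖ ^ 2 := by
      simp only [← normSq_eq_norm_sq, normSq_apply, add_re, add_im, mul_re, mul_im, conj_re,
        conj_im, one_re, one_im]
      ring
    have h3 : ‖1 + conj a * b z‖ ≤ 1 + ‖a‖ * x := by
      refine (norm_add_le _ _).trans ?_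
      rw [norm_one, norm_mul, norm_conj]
      gcongr
    have hfz1 := hm z hz
    have hf0 := norm_nonneg (f z)
    have hb2 : ‖b z‖ ^ 2 ≤ x ^ 2 := by gcongr
    have h4 : (1 - ‖a‖ ^ 2) * (1 - x ^ 2) ≤ (1 - ‖f z‖ ^ 2) * (1 + ‖a‖ * x) ^ 2 := by
      have e1 : (1 - ‖a‖ ^ 2) * (1 - x ^ 2) ≤ (1 - ‖a‖ ^ 2) * (1 - ‖b z‖ ^ 2) := by
        have : 0 ≤ 1 - ‖a‖ ^ 2 := by nlinarith
        gcongr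
      have e2 : (1 - ‖a‖ ^ 2) * (1 - ‖b z‖ ^ 2) = (1 - ‖f z‖ ^ 2) * ‖1 + conj a * b z‖ ^ 2 := by
        rw [h2]; linear_combination h1
      have e3 : 0 ≤ 1 - ‖f z‖ ^ 2 := by nlinarith
      calc _ ≤ _ := e1
        _ = _ := e2
        _ ≤ _ := by gcongr
    have h5 : (‖f z‖ * (1 + ‖a‖ * x)) ^ 2 ≤ (‖a‖ + x) ^ 2 := by nlinarith
    exact (sq_le_sq₀ (by positivity) (by positivity)).1 h5
  have h6 : (1 - ‖a‖) * (1 - x) ≤ (1 - ‖f z‖) * (1 + ‖a‖ * x) := by nlinarith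
  have h7 : 1 + ‖a‖ * x ≤ 2 := by nlinarith
  have h8 : 0 ≤ 1 - ‖f z‖ := by linarith [hm z hz]
  nlinarith [mul_le_mul_of_nonneg_left h7 h8]

/-- The Hopf lemma for maps into the disc. -/
lemma fderiv_ne_zero_of_interior_ball {D : Set ℂ} {f fe : ℂ → ℂ} {p q : ℂ} {ρ : ℝ} (hρ : 0 < ρ)
    (hpq : ‖p - q‖ = ρ) (hb : Metric.ball q ρ ⊆ D) (hf : DifferentiableOn ℂ f D)
    (hm : ∀ z ∈ D, ‖f z‖ < 1) {L : ℂ →L[ℝ] ℂ} (hfe : HasFDerivAt fe L p)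
    (heq : ∀ᶠ z in 𝓝[D] p, fe z = f z) (hp : ‖fe p‖ = 1) : L ≠ 0 := by
  rintro rfl
  set k : ℝ := (1 - ‖f q‖) / 2
  have hk : 0 < k := by
    have := hm q (hb (Metric.mem_ball_self hρ))
    simp only [k]; linarith
  have ho := hfe.isLittleO
  -- With zero derivative, `1 - ‖f‖` at the point `p + s (q - p)` is at most `k s / 2` for small
  -- `s`, while the Schwarz–Pick estimate gives at least `k s`.
  have hev : ∀ᶠ z in 𝓝 p, ‖fe z - fe p‖ ≤ k / (2 * ρ) * ‖z - p‖ := by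
    have := ho.def (c := k / (2 * ρ)) (by positivity)
    simpa using this
  have htend : Tendsto (fun s : ℝ => p + s * (q - p)) (𝓝[>] 0) (𝓝[D] p) := by
    refine tendsto_nhdsWithin_iff.2 ⟨?_, ?_⟩
    · have : Continuous (fun s : ℝ => p + s * (q - p)) := by fun_prop
      have h2 := this.tendsto 0
      simp only [ofReal_zero, zero_mul, add_zero] at h2
      exact h2.mono_left nhdsWithin_le_nhds
    · filter_upwards [Ioo_mem_nhdsGT (zero_lt_one (α := ℝ))] with s hs
      refine hb ?_
      rw [mem_ball_iff_norm, show p + s * (q - p) - q = ((1 - s : ℝ) : ℂ) * (p - q) by push_cast; ring,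
        norm_mul, norm_real, hpq, Real.norm_of_nonneg (by linarith [hs.2])]
      nlinarith [hs.1]
  obtain ⟨s, ⟨h1, h2⟩, hs⟩ := ((htend.eventually (heq.and (hev.filter_mono nhdsWithin_le_nhds))).and
    (Ioo_mem_nhdsGT (zero_lt_one (α := ℝ)))).exists
  set z := p + s * (q - p)
  have hzq : ‖z - q‖ = (1 - s) * ρ := by
    rw [show z - q = ((1 - s : ℝ) : ℂ) * (p - q) by simp only [z]; push_cast; ring,
      norm_mul, norm_real, hpq, Real.norm_of_nonneg (by linarith [hs.2])]
  have hzp : ‖z - p‖ = s * ρ := by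
    rw [show z - p = (s : ℂ) * (q - p) by simp only [z]; ring, norm_mul, norm_real, norm_sub_rev,
      hpq, Real.norm_of_nonneg hs.1.le]
  have hzb : z ∈ Metric.ball q ρ := by
    rw [mem_ball_iff_norm, hzq]; nlinarith [hs.1]
  have h3 := one_sub_norm_ge hρ (hf.mono hb) (fun z hz => hm z (hb hz)) hzb
  rw [hzq, mul_div_assoc, div_self hρ.ne', mul_one] at h3
  rw [h1, hzp] at h2
  have h4 := norm_sub_norm_le (fe p) (f z)
  rw [norm_sub_rev, hp] at h4
  have h5 : k / (2 * ρ) * (s * ρ) = k * s / 2 := by field_simp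
  have h6 : 0 < k * s := mul_pos hk hs.1
  change k * (1 - (1 - s)) ≤ _ at h3
  nlinarith

/-! ### The logarithmic pole of the Green function. -/

/-- The complex gradient `G_x - i G_y`. -/
def cgrad (G : ℂ → ℝ) (z : ℂ) : ℂ := fderiv ℝ G z 1 - I * fderiv ℝ G z I

lemma fderiv_eq_re_cgrad (G : ℂ → ℝ) (z v : ℂ) : fderiv ℝ G z v = (cgrad G z * v).re := by
  conv_lhs => rw [show v = v.re • (1 : ℂ) + v.im • I by simp]
  rw [map_add, map_smul, map_smul]
  simp [cgrad, mul_comm]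

lemma hasFDerivAt_re {F : ℂ → ℂ} {F' z : ℂ} (h : HasDerivAt F F' z) :
    HasFDerivAt (fun w => (F w).re) (reCLM ∘L (F' • (1 : ℂ →L[ℝ] ℂ))) z :=
  reCLM.hasFDerivAt.comp z h.complexToReal_fderiv

lemma cgrad_eq_of_eventually_re {G : ℂ → ℝ} {F : ℂ → ℂ} {z F' : ℂ} (h : HasDerivAt F F' z)
    (he : ∀ᶠ w in 𝓝 z, (F w).re = G w) : cgrad G z = F' := by
  have h1 : HasFDerivAt G (reCLM ∘L (F' • (1 : ℂ →L[ℝ] ℂ))) z :=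
    (hasFDerivAt_re h).congr_of_eventuallyEq (he.mono fun w hw => hw.symm)
  rw [cgrad, h1.fderiv]
  apply Complex.ext <;> simp

lemma hasFDerivAt_log_norm {z : ℂ} (hz : z ≠ 0) : HasFDerivAt (fun z : ℂ => Real.log ‖z‖)
    (reCLM ∘L (z⁻¹ • (1 : ℂ →L[ℝ] ℂ))) z := by
  have h1 : HasDerivAt (fun w : ℂ => log (w / z)) z⁻¹ z := by
    have := ((hasDerivAt_id z).div_const z).clog (by simp [div_self hz])
    refine this.congr_deriv ?_
    simp [div_self hz]
  have h2 := (hasFDerivAt_re h1).add_const (Real.log ‖z‖)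
  refine h2.congr_of_eventuallyEq ?_
  filter_upwards [isOpen_compl_singleton.mem_nhds hz] with w hw
  rw [log_re, norm_div, Real.log_div (norm_ne_zero_iff.2 hw) (norm_ne_zero_iff.2 hz)]
  ring

section Green

variable {D : Set ℂ} {Φ : ℝ} {G : ℂ → ℝ}

lemma IsGreen.differentiableOn_cgrad (hG : IsGreen D Φ G) :
    DifferentiableOn ℂ (cgrad G) (D \ {0}) := fun z hz =>
  (HarmonicAt.differentiableAt_complex_partial (hG.harmonic z hz)).differentiableWithinAt

lemma IsGreen.differentiableAt (hG : IsGreen D Φ G) {z : ℂ} (hz : z ∈ D \ {0}) :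
    DifferentiableAt ℝ G z := (HarmonicAt.analyticAt (hG.harmonic z hz)).differentiableAt

/-- On the ball of radius `‖z‖ / 2` about `z`, `G` is the real part of a holomorphic function and is
bounded by a multiple of `log (2 / ‖z‖)`. The interior derivative estimate costs a factor `1 / ‖z‖`.
-/
lemma IsGreen.exists_norm_cgrad_le (hG : IsGreen D Φ G) (hD : IsOpen D) (h0 : (0 : ℂ) ∈ D) :
    ∃ C > 0, ∀ᶠ z in 𝓝[≠] (0 : ℂ), ‖cgrad G z‖ ≤ C * Real.log (2 / ‖z‖) / ‖z‖ := by
  obtain ⟨C, hC, hb⟩ := hG.log_sing.exists_pos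
  rw [Asymptotics.isBigOWith_iff] at hb
  obtain ⟨δ, hδ, hbδ⟩ := Metric.mem_nhdsWithin_iff.1
    (inter_mem hb (mem_nhdsWithin_of_mem_nhds (hD.mem_nhds h0)))
  refine ⟨4 * Real.exp 2 * C, by positivity, ?_⟩
  have hδ' : 0 < min (δ / 2) (1 / 2) := by positivity
  filter_upwards [self_mem_nhdsWithin,
    mem_nhdsWithin_of_mem_nhds (Metric.ball_mem_nhds (0 : ℂ) hδ')] with z hz0 hzb
  have hz0' : z ≠ 0 := hz0
  have hzn : ‖z‖ < min (δ / 2) (1 / 2) := mem_ball_zero_iff.1 hzb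
  have hz1 : ‖z‖ < δ / 2 := hzn.trans_le (min_le_left _ _)
  have hz2 : ‖z‖ < 1 / 2 := hzn.trans_le (min_le_right _ _)
  have hzp : 0 < ‖z‖ := norm_pos_iff.2 hz0'
  have hy : ∀ y ∈ Metric.ball z (‖z‖ / 2), y ∈ D \ {0} ∧ |G y| ≤ C * Real.log (2 / ‖z‖) := by
    intro y hy
    have hyz : ‖y - z‖ < ‖z‖ / 2 := mem_ball_iff_norm.1 hy
    have hy1 : ‖z‖ / 2 < ‖y‖ := by
      have := norm_sub_norm_le z y
      rw [norm_sub_rev] at this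
      linarith
    have hy2 : ‖y‖ < 2 * ‖z‖ := by
      have := norm_sub_norm_le y z
      linarith
    have hy0 : y ≠ 0 := norm_pos_iff.1 (by linarith)
    have hyb := hbδ ⟨mem_ball_zero_iff.2 (by linarith : ‖y‖ < δ), hy0⟩
    refine ⟨⟨hyb.2, hy0⟩, ?_⟩
    have h1 : ‖G y‖ ≤ C * ‖Real.log ‖y‖‖ := hyb.1
    rw [Real.norm_eq_abs, Real.norm_eq_abs] at h1
    refine h1.trans ?_
    gcongr
    have hl : Real.log ‖y‖ ≤ 0 := Real.log_nonpos (norm_nonneg _) (by linarith)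
    rw [abs_of_nonpos hl, ← Real.log_inv]
    refine Real.log_le_log (inv_pos.2 (by linarith)) ?_
    rw [inv_le_comm₀ (by linarith) (by positivity), inv_div]
    exact hy1.le
  obtain ⟨F, hF, hFG⟩ := InnerProductSpace.HarmonicOnNhd.exists_analyticOnNhd_ball_re_eq
    (f := G) (z := z) (R := ‖z‖ / 2) (fun y hy' => hG.harmonic y (hy y hy').1)
  have hM : 0 < C * Real.log (2 / ‖z‖) :=
    mul_pos hC (Real.log_pos (by rw [lt_div_iff₀ hzp]; linarith))
  set M := C * Real.log (2 / ‖z‖)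
  have hFd : DifferentiableAt ℂ F z :=
    (hF z (Metric.mem_ball_self (by positivity))).differentiableAt
  have hg : cgrad G z = deriv F z := cgrad_eq_of_eventually_re hFd.hasDerivAt
    (eventually_of_mem (Metric.ball_mem_nhds _ (by positivity)) hFG)
  have hle := norm_deriv_le_of_abs_re_le (F := fun w => F w / M) (z := z) (d := ‖z‖ / 2)
    (by positivity) (hF.differentiableOn.div_const _) (fun w hw => by
      rw [div_ofReal_re, abs_div, abs_of_pos hM, div_le_one hM]
      have : (F w).re = G w := hFG hw
      rw [this]
      exact (hy w hw).2)
  rw [deriv_div_const, norm_div, norm_real, Real.norm_of_nonneg hM.le, ← hg, div_le_iff₀ hM] at hle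
  refine hle.trans (le_of_eq ?_)
  simp only [M]
  field_simp
  ring

/-- The growth of `z * cgrad G z` is only logarithmic, hence `o(1 / ‖z‖)`, and the singularity is
removable. -/
lemma IsGreen.exists_regular_part (hG : IsGreen D Φ G) (hD : IsOpen D) (h0 : (0 : ℂ) ∈ D) :
    ∃ q : ℂ → ℂ, DifferentiableOn ℂ q D ∧ ∀ z, z ≠ 0 → q z = z * cgrad G z := by
  set f : ℂ → ℂ := fun z => z * cgrad G z
  refine ⟨Function.update f 0 (limUnder (𝓝[≠] 0) f),
    differentiableOn_update_limUnder_of_isLittleO (hD.mem_nhds h0)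
      (differentiableOn_id.mul hG.differentiableOn_cgrad) ?_,
    fun z hz => Function.update_of_ne hz _ _⟩
  obtain ⟨C, hC, hb⟩ := hG.exists_norm_cgrad_le hD h0
  have hf0 : f 0 = 0 := by simp [f]
  simp only [hf0, sub_zero]
  rw [Asymptotics.isLittleO_iff_tendsto' (by
    filter_upwards [self_mem_nhdsWithin] with z hz h
    exact absurd (inv_eq_zero.1 h) hz)]
  have hlim : Tendsto (fun z : ℂ => C * (‖z‖ * Real.log 2 - ‖z‖ * Real.log ‖z‖)) (𝓝[≠] 0) (𝓝 0) := by
    have hc : Continuous (fun z : ℂ => C * (‖z‖ * Real.log 2 - ‖z‖ * Real.log ‖z‖)) :=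
      continuous_const.mul ((continuous_norm.mul continuous_const).sub
        (Real.continuous_mul_log.comp continuous_norm))
    have := hc.tendsto 0
    simp only [norm_zero, zero_mul, sub_zero, mul_zero] at this
    exact this.mono_left nhdsWithin_le_nhds
  refine squeeze_zero_norm' ?_ hlim
  filter_upwards [hb, self_mem_nhdsWithin] with z hz hz0
  have hzp : 0 < ‖z‖ := norm_pos_iff.2 hz0
  rw [div_inv_eq_mul, norm_mul, norm_mul]
  calc ‖z‖ * ‖cgrad G z‖ * ‖z‖ ≤ ‖z‖ * (C * Real.log (2 / ‖z‖) / ‖z‖) * ‖z‖ := by gcongr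
    _ = C * (‖z‖ * Real.log 2 - ‖z‖ * Real.log ‖z‖) := by
      rw [Real.log_div two_ne_zero hzp.ne']
      field_simp

/-- By the mean value property, the circle integral of the real part is minus the flux, and that of
the imaginary part is minus the increment of `G` around the circle, which is zero. -/
lemma IsGreen.regular_part_zero (hG : IsGreen D Φ G) (hD : IsOpen D) (h0 : (0 : ℂ) ∈ D)
    {q : ℂ → ℂ} (hq : DifferentiableOn ℂ q D) (hqz : ∀ z, z ≠ 0 → q z = z * cgrad G z) :
    q 0 = ((-Φ / (2 * Real.pi) : ℝ) : ℂ) := by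
  obtain ⟨δ, hδ, hb⟩ := Metric.isOpen_iff.1 hD 0 h0
  have hmem : ∀ ε ∈ Ioo 0 δ, ∀ θ, circleMap 0 ε θ ∈ D \ {0} := by
    intro ε hε θ
    refine ⟨hb ?_, ?_⟩
    · rw [mem_ball_zero_iff, norm_circleMap_zero, abs_of_pos hε.1]; exact hε.2
    · exact circleMap_ne_center hε.1.ne'
  have hmean : ∀ ε ∈ Ioo 0 δ, ∫ θ in (0 : ℝ)..(2 * Real.pi), q (circleMap 0 ε θ) =
      (2 * Real.pi : ℝ) * q 0 := by
    intro ε hε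
    have hcl : DiffContOnCl ℂ q (Metric.ball 0 |ε|) := by
      refine DifferentiableOn.diffContOnCl (hq.mono ?_)
      rw [abs_of_pos hε.1, closure_ball _ hε.1.ne']
      exact (Metric.closedBall_subset_ball hε.2).trans hb
    have := hcl.circleAverage
    rw [Real.circleAverage_def] at this
    rw [← this, real_smul, ← mul_assoc, ← ofReal_mul, mul_inv_cancel₀ (by positivity)]
    simp
  have hcont : ∀ ε ∈ Ioo 0 δ, Continuous fun θ => q (circleMap 0 ε θ) := fun ε hε =>
    hq.continuousOn.comp_continuous (continuous_circleMap 0 ε) (fun θ => (hmem ε hε θ).1)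
  have hre : 2 * Real.pi * (q 0).re = -Φ := by
    have hconst : ∀ ε ∈ Ioo 0 δ, -∫ θ in (0 : ℝ)..(2 * Real.pi),
        inner ℝ (circleMap 0 1 θ) (gradient G (circleMap 0 ε θ)) * ε =
        -(2 * Real.pi * (q 0).re) := by
      intro ε hε
      have h1 : ∀ θ, inner ℝ (circleMap 0 1 θ) (gradient G (circleMap 0 ε θ)) * ε =
          reCLM (q (circleMap 0 ε θ)) := by
        intro θ
        rw [real_inner_comm, inner_gradient_left, fderiv_eq_re_cgrad, hqz _ (hmem ε hε θ).2]
        have : circleMap 0 ε θ = (ε : ℂ) * circleMap 0 1 θ := by simp [circleMap]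
        rw [reCLM_apply]
        conv_rhs => rw [this, mul_assoc, re_ofReal_mul]
        rw [← this, mul_comm (circleMap 0 1 θ), mul_comm ε]
      simp_rw [h1]
      rw [ContinuousLinearMap.intervalIntegral_comp_comm _ ((hcont ε hε).intervalIntegrable _ _),
        hmean ε hε, reCLM_apply, re_ofReal_mul]
    have hev : (fun ε : ℝ => -∫ θ in (0 : ℝ)..(2 * Real.pi),
        inner ℝ (circleMap 0 1 θ) (gradient G (circleMap 0 ε θ)) * ε) =ᶠ[𝓝[>] 0]
        fun _ => -(2 * Real.pi * (q 0).re) :=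
      eventually_of_mem (Ioo_mem_nhdsGT hδ) hconst
    have := tendsto_nhds_unique (hG.flux.congr' hev) tendsto_const_nhds
    linarith
  have him : (q 0).im = 0 := by
    have hε : δ / 2 ∈ Ioo 0 δ := ⟨by positivity, by linarith⟩
    have hderiv : ∀ θ ∈ uIcc 0 (2 * Real.pi),
        HasDerivAt (fun θ => G (circleMap 0 (δ / 2) θ)) (-imCLM (q (circleMap 0 (δ / 2) θ))) θ := by
      intro θ _
      have h1 := (hG.differentiableAt (hmem _ hε θ)).hasFDerivAt.comp_hasDerivAt θ
        (hasDerivAt_circleMap 0 (δ / 2) θ)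
      refine h1.congr_deriv ?_
      rw [fderiv_eq_re_cgrad, hqz _ (hmem _ hε θ).2, imCLM_apply, ← mul_assoc, mul_I_re, mul_comm]
    have hInt := intervalIntegral.integral_eq_sub_of_hasDerivAt hderiv
      ((imCLM.continuous.comp (hcont _ hε)).neg.intervalIntegrable _ _)
    rw [intervalIntegral.integral_neg,
      ContinuousLinearMap.intervalIntegral_comp_comm _ ((hcont _ hε).intervalIntegrable _ _),
      hmean _ hε, imCLM_apply, im_ofReal_mul] at hInt
    have hper : circleMap 0 (δ / 2) (2 * Real.pi) = circleMap 0 (δ / 2) 0 := by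
      simp [circleMap]
    rw [hper, sub_self, neg_eq_zero] at hInt
    exact (mul_eq_zero.1 hInt).resolve_left (by positivity)
  apply Complex.ext
  · rw [ofReal_re, eq_div_iff (by positivity)]; linarith
  · rw [him, ofReal_im]

lemma isPreconnected_punctured_ball (δ : ℝ) : IsPreconnected (Metric.ball (0 : ℂ) δ \ {0}) := by
  have : Metric.ball (0 : ℂ) δ \ {0} =
      (fun x : ℝ × ℝ => circleMap 0 x.1 x.2) '' (Ioo 0 δ ×ˢ univ) := by
    ext z
    constructor
    · rintro ⟨h1, h2⟩
      refine ⟨(‖z‖, z.arg), ⟨⟨norm_pos_iff.2 h2, mem_ball_zero_iff.1 h1⟩, mem_univ _⟩, ?_⟩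
      simp [circleMap]
    · rintro ⟨⟨r, θ⟩, ⟨hr, -⟩, rfl⟩
      refine ⟨?_, circleMap_ne_center (ne_of_gt hr.1)⟩
      rw [mem_ball_zero_iff, norm_circleMap_zero, abs_of_pos hr.1]
      exact hr.2
  rw [this]
  refine (isPreconnected_Ioo.prod isPreconnected_univ).image _ (Continuous.continuousOn ?_)
  simp only [circleMap]
  fun_prop

/-- A function with vanishing derivative on a punctured domain is constant. -/
lemma exists_eq_const_of_fderiv_eq_zero {H : ℂ → ℝ} (hD : IsOpen D) (hc : IsPreconnected D)
    (h0 : (0 : ℂ) ∈ D) (hd : DifferentiableOn ℝ H (D \ {0})) (hz : EqOn (fderiv ℝ H) 0 (D \ {0})) :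
    ∃ k, ∀ z ∈ D \ {0}, H z = k := by
  have hDo : IsOpen (D \ {0}) := hD.sdiff isClosed_singleton
  have hop := hDo.isOpen_inter_preimage_of_fderiv_eq_zero hd hz
  obtain ⟨δ, hδ, hb⟩ := Metric.isOpen_iff.1 hD 0 h0
  have hBo : IsOpen (Metric.ball (0 : ℂ) δ \ {0}) := Metric.isOpen_ball.sdiff isClosed_singleton
  have hBD : Metric.ball (0 : ℂ) δ \ {0} ⊆ D \ {0} := sdiff_subset_sdiff_left hb
  set p : ℂ := ((δ / 2 : ℝ) : ℂ)
  have hp : p ∈ Metric.ball (0 : ℂ) δ \ {0} := by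
    constructor
    · rw [mem_ball_zero_iff, norm_real, Real.norm_of_nonneg (by positivity)]; linarith
    · simp only [p, mem_singleton_iff, ofReal_eq_zero]; positivity
  refine ⟨H p, ?_⟩
  have hball : ∀ z ∈ Metric.ball (0 : ℂ) δ \ {0}, H z = H p := fun z hz' =>
    hBo.is_const_of_fderiv_eq_zero (isPreconnected_punctured_ball δ) (hd.mono hBD)
      (fun x hx => hz (hBD hx)) hz' hp
  -- The puncture is filled with a ball on whose punctured part `H` is constant, so that
  -- connectedness of `D` itself applies to the splitting by the value of `H`.
  set u := Metric.ball (0 : ℂ) δ ∪ (D \ {0}) ∩ H ⁻¹' {H p}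
  set v := (D \ {0}) ∩ H ⁻¹' {H p}ᶜ
  have hsub := IsPreconnected.subset_left_of_subset_union (s := D) (u := u) (v := v)
    (Metric.isOpen_ball.union (hop _)) (hop _) (by
      rw [Set.disjoint_left]
      rintro z (hzu | hzu) hzv
      · exact hzv.2 (hball z ⟨hzu, hzv.1.2⟩)
      · exact hzv.2 hzu.2) (fun z hzD => by
      by_cases hz0 : z = 0
      · exact Or.inl (Or.inl (hz0 ▸ Metric.mem_ball_self hδ))
      · by_cases hH : H z = H p
        · exact Or.inl (Or.inr ⟨⟨hzD, hz0⟩, hH⟩)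
        · exact Or.inr ⟨⟨hzD, hz0⟩, hH⟩) ⟨0, h0, Or.inl (Metric.mem_ball_self hδ)⟩ hc
  intro z hz'
  rcases hsub hz'.1 with h | h
  · exact hball z ⟨h, hz'.2⟩
  · exact h.2

/-- The Green function is the logarithm of the modulus of a holomorphic function. -/
theorem IsGreen.exists_log_form (hD : IsSmoothJordanInterior D) (hΦ : Φ ≠ 0) (hG : IsGreen D Φ G) :
    ∃ a : ℝ, ∃ P : ℂ → ℂ, DifferentiableOn ℂ P D ∧ (∀ z ∈ frontier D, G z = a) ∧
      ∀ z ∈ D \ {0}, G z = a - Φ / (2 * Real.pi) * (Real.log ‖z‖ + (P z).re) := by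
  obtain ⟨a, ha⟩ := hG.boundary
  obtain ⟨q, hq, hqz⟩ := hG.exists_regular_part hD.isOpen hD.zero_mem
  have hq0 := hG.regular_part_zero hD.isOpen hD.zero_mem hq hqz
  have hnhds := hD.isOpen.mem_nhds hD.zero_mem
  -- Away from the origin this slope is `cgrad G z + Φ / (2 * π * z)`, the complex gradient without
  -- its pole. Its primitive `F` is global because the boundary is connected, and `H` below compares
  -- `G` with it.
  have hg₀ : DifferentiableOn ℂ (dslope q 0) D := (differentiableOn_dslope hnhds).2 hq
  obtain ⟨c, hc⟩ := hD.frontier_jordan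
  obtain ⟨F, hF⟩ := isExactOn_of_isPreconnected_frontier hD.isOpen hD.isConnected hD.isBounded
    hc.isParam.nonempty hc.isParam.isPreconnected hg₀
  set H : ℂ → ℝ := fun z => G z + Φ / (2 * Real.pi) * Real.log ‖z‖ - (F z).re
  have hH : ∀ z ∈ D \ {0}, HasFDerivAt H (0 : ℂ →L[ℝ] ℝ) z := by
    intro z hz
    have hz0 : z ≠ 0 := hz.2
    have h1 := (((hG.differentiableAt hz).hasFDerivAt).add
      ((hasFDerivAt_log_norm hz0).const_mul (Φ / (2 * Real.pi)))).sub (hasFDerivAt_re (hF z hz.1))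
    refine h1.congr_fderiv ?_
    ext v
    simp only [add_apply, sub_apply, smul_apply, ContinuousLinearMap.comp_apply, reCLM_apply,
      one_apply_eq_self, smul_eq_mul, zero_apply]
    rw [fderiv_eq_re_cgrad, dslope_of_ne _ hz0, slope_def_field, sub_zero, hq0, hqz z hz0,
      ← re_ofReal_mul, ← add_re, ← sub_re]
    have : cgrad G z * v + ↑(Φ / (2 * Real.pi)) * (z⁻¹ * v) -
        (z * cgrad G z - ↑(-Φ / (2 * Real.pi))) / z * v = 0 := by
      push_cast
      field_simp
      ring
    rw [this, zero_re]
  obtain ⟨k, hk⟩ := exists_eq_const_of_fderiv_eq_zero hD.isOpen hD.isConnected.isPreconnected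
    hD.zero_mem (fun z hz => (hH z hz).differentiableAt.differentiableWithinAt)
    (fun z hz => by rw [(hH z hz).fderiv]; rfl)
  refine ⟨a, fun z => ((-(2 * Real.pi / Φ) : ℝ) : ℂ) * (F z + (k - a : ℝ)),
    fun z hz => ((((hF z hz).differentiableAt).add_const _).const_mul _).differentiableWithinAt,
    ha, fun z hz => ?_⟩
  have := hk z hz
  simp only [H] at this
  rw [re_ofReal_mul, add_re, ofReal_re]
  field_simp
  field_simp at this
  linarith

end Green

/-! ### Proper holomorphic maps onto the disc with one simple zero. -/

/-- Near a critical point a nonconstant holomorphic function takes nearby values at least twice. -/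
lemma eventually_two_preimages {f : ℂ → ℂ} {z₀ : ℂ} (hf : AnalyticAt ℂ f z₀)
    (hd : deriv f z₀ = 0) (hnc : ¬ ∀ᶠ z in 𝓝 z₀, f z = f z₀) {V : Set ℂ} (hV : V ∈ 𝓝 z₀) :
    ∀ᶠ w in 𝓝[≠] (f z₀), ∃ z₁ ∈ V, ∃ z₂ ∈ V, z₁ ≠ z₂ ∧ f z₁ = w ∧ f z₂ = w := by
  have hfa : AnalyticAt ℂ (fun z => f z - f z₀) z₀ := hf.sub analyticAt_const
  obtain ⟨n, g, hg, hg0, hfg⟩ := (hfa.exists_eventuallyEq_pow_smul_nonzero_iff).2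
    (fun h => hnc (h.mono fun z hz => sub_eq_zero.1 hz))
  simp only [smul_eq_mul] at hfg
  have hn0 : n ≠ 0 := by
    rintro rfl
    have := hfg.self_of_nhds
    simp only [sub_self, pow_zero, one_mul] at this
    exact hg0 this.symm
  have hn1 : n ≠ 1 := by
    rintro rfl
    have h1 : HasDerivAt (fun z => (z - z₀) ^ 1 * g z) (g z₀) z₀ := by
      have := (((hasDerivAt_id z₀).sub_const z₀).pow 1).mul hg.differentiableAt.hasDerivAt
      refine this.congr_deriv ?_
      simp
    have h2 : HasDerivAt (fun z => f z - f z₀) (g z₀) z₀ := h1.congr_of_eventuallyEq hfg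
    have h3 : HasDerivAt (fun z => f z - f z₀) (deriv f z₀) z₀ :=
      hf.differentiableAt.hasDerivAt.sub_const _
    exact hg0 (by rw [h2.unique h3, hd])
  obtain ⟨α, hα⟩ := IsAlgClosed.exists_pow_nat_eq (g z₀) (Nat.pos_of_ne_zero hn0)
  have hα0 : α ≠ 0 := by
    rintro rfl
    rw [zero_pow hn0] at hα
    exact hg0 hα.symm
  -- A local `n`-th root of `f - f z₀` with nonzero derivative, `n ≥ 2`. Two preimages of a nearby
  -- value arise from `ξ` and `η * ξ`, with `η` a primitive root of unity.
  set k : ℂ → ℂ := fun z => (z - z₀) * (α * exp (log (g z / g z₀) / n))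
  have hg1 : g z₀ / g z₀ = 1 := div_self hg0
  have hla : AnalyticAt ℂ (fun z => α * exp (log (g z / g z₀) / n)) z₀ := by
    refine analyticAt_const.mul (AnalyticAt.cexp (AnalyticAt.div (AnalyticAt.clog
      (hg.div analyticAt_const hg0) ?_) analyticAt_const (by exact_mod_cast hn0)))
    simp only [hg1, one_mem_slitPlane]
  have hka : AnalyticAt ℂ k z₀ := (analyticAt_id.sub analyticAt_const).mul hla
  have hkd : HasDerivAt k α z₀ := by
    have := ((hasDerivAt_id z₀).sub_const z₀).mul hla.differentiableAt.hasDerivAt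
    refine this.congr_deriv ?_
    simp [hg1]
  have hks : HasStrictDerivAt k α z₀ := by
    have := hka.hasStrictDerivAt
    rwa [hkd.deriv] at this
  have hk0 : k z₀ = 0 := by simp [k]
  have hkn : ∀ᶠ z in 𝓝 z₀, k z ^ n = f z - f z₀ := by
    filter_upwards [hfg, hg.continuousAt.eventually_ne hg0] with z h1 h2
    simp only [k]
    rw [h1, mul_pow, mul_pow, hα, ← exp_nat_mul, mul_div_cancel₀ _ (by exact_mod_cast hn0),
      exp_log (div_ne_zero h2 hg0), mul_div_cancel₀ _ hg0]
  have himg : k '' (V ∩ {z | k z ^ n = f z - f z₀}) ∈ 𝓝 (0 : ℂ) := by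
    rw [← hk0, ← hks.map_nhds_eq hα0]
    exact image_mem_map (inter_mem hV hkn)
  obtain ⟨δ, hδ, hb⟩ := Metric.mem_nhds_iff.1 himg
  filter_upwards [self_mem_nhdsWithin,
    mem_nhdsWithin_of_mem_nhds (Metric.ball_mem_nhds (f z₀) (pow_pos hδ n))] with w hw1 hw2
  obtain ⟨ξ, hξ⟩ := IsAlgClosed.exists_pow_nat_eq (w - f z₀) (Nat.pos_of_ne_zero hn0)
  have hξδ : ‖ξ‖ < δ := by
    refine lt_of_pow_lt_pow_left₀ n hδ.le ?_
    rw [← norm_pow, hξ]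
    exact mem_ball_iff_norm.1 hw2
  have hξ0 : ξ ≠ 0 := by
    rintro rfl
    rw [zero_pow hn0] at hξ
    exact hw1 (sub_eq_zero.1 hξ.symm)
  have hprim := isPrimitiveRoot_exp n hn0
  set η : ℂ := exp (2 * Real.pi * I / n)
  have hη1 : η ≠ 1 := hprim.ne_one (by omega)
  have hηn : ‖η‖ = 1 := hprim.norm'_eq_one hn0
  obtain ⟨z₁, ⟨h1V, h1k⟩, h1⟩ := hb (mem_ball_zero_iff.2 hξδ)
  obtain ⟨z₂, ⟨h2V, h2k⟩, h2⟩ := hb (mem_ball_zero_iff.2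
    (show ‖η * ξ‖ < δ by rw [norm_mul, hηn, one_mul]; exact hξδ))
  rw [mem_ofPred_eq, h1, hξ] at h1k
  rw [mem_ofPred_eq, h2, mul_pow, hprim.pow_eq_one, one_mul, hξ] at h2k
  refine ⟨z₁, h1V, z₂, h2V, ?_, (sub_left_injective h1k).symm, (sub_left_injective h2k).symm⟩
  rintro rfl
  rw [h1] at h2
  exact hη1 (mul_right_cancel₀ hξ0 (by rw [one_mul]; exact h2.symm))

/-- A proper holomorphic map from `D` to the unit disc with a single simple zero, at the origin. -/
structure IsDiscMap (f : ℂ → ℂ) (D : Set ℂ) : Prop where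
  isOpen : IsOpen D
  isConnected : IsConnected D
  isBounded : Bornology.IsBounded D
  zero_mem : (0 : ℂ) ∈ D
  diff : DifferentiableOn ℂ f D
  map_zero : f 0 = 0
  eq_zero : ∀ z ∈ D, f z = 0 → z = 0
  deriv_zero : deriv f 0 ≠ 0
  tendsto : ∀ p ∈ frontier D, Tendsto (fun z => ‖f z‖) (𝓝[D] p) (𝓝 1)

namespace IsDiscMap

variable {f : ℂ → ℂ} {D : Set ℂ}

lemma analyticAt (h : IsDiscMap f D) {z : ℂ} (hz : z ∈ D) : AnalyticAt ℂ f z :=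
  h.diff.analyticAt (h.isOpen.mem_nhds hz)

lemma not_eventually_const (h : IsDiscMap f D) {z₀ : ℂ} (hz₀ : z₀ ∈ D) :
    ¬ ∀ᶠ z in 𝓝 z₀, f z = f z₀ := by
  intro hev
  have := AnalyticOnNhd.eqOn_of_preconnected_of_eventuallyEq (f := f) (g := fun _ => f z₀)
    (fun z hz => h.analyticAt hz) (fun z _ => analyticAt_const) h.isConnected.isPreconnected hz₀ hev
  have h2 : f =ᶠ[𝓝 0] fun _ => f z₀ := eventually_of_mem (h.isOpen.mem_nhds h.zero_mem) this
  exact h.deriv_zero (by rw [h2.deriv_eq, deriv_const])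

lemma image_mem_nhds (h : IsDiscMap f D) {z₀ : ℂ} (hz₀ : z₀ ∈ D) {V : Set ℂ} (hV : V ∈ 𝓝 z₀) :
    f '' V ∈ 𝓝 (f z₀) :=
  ((h.analyticAt hz₀).eventually_constant_or_nhds_le_map_nhds.resolve_left
    (h.not_eventually_const hz₀)) (image_mem_map hV)

open Classical in
lemma continuousOn_norm_ext (h : IsDiscMap f D) :
    ContinuousOn (fun z => if z ∈ D then ‖f z‖ else 1) (closure D) := by
  intro z hz
  rw [closure_eq_self_union_frontier] at hz
  rcases hz with hz | hz
  · refine ContinuousAt.continuousWithinAt ?_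
    have : ContinuousAt (fun z => ‖f z‖) z := (h.analyticAt hz).continuousAt.norm
    refine this.congr ?_
    filter_upwards [h.isOpen.mem_nhds hz] with w hw
    rw [if_pos hw]
  · rw [closure_eq_self_union_frontier]
    have hzD : z ∉ D := by
      rw [h.isOpen.frontier_eq] at hz; exact hz.2
    refine ContinuousWithinAt.union ?_ ?_
    · rw [ContinuousWithinAt, if_neg hzD]
      refine (h.tendsto z hz).congr' ?_
      filter_upwards [self_mem_nhdsWithin] with w hw
      rw [if_pos hw]
    · refine ContinuousWithinAt.congr (f := fun _ => (1 : ℝ)) continuousWithinAt_const (fun y hy => ?_) (if_neg hzD)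
      rw [h.isOpen.frontier_eq] at hy
      exact if_neg hy.2

lemma isCompact_closure (h : IsDiscMap f D) : IsCompact (closure D) := h.isBounded.isCompact_closure

/-- Maximum principle for `‖f‖` extended by `1` to the boundary. An interior maximum would make
`‖f‖` constant, hence zero as `f 0 = 0`, against the simple zero. -/
lemma norm_lt_one (h : IsDiscMap f D) {z : ℂ} (hz : z ∈ D) : ‖f z‖ < 1 := by
  classical
  obtain ⟨z₁, hz₁, hmax⟩ := h.isCompact_closure.exists_isMaxOn ⟨0, subset_closure h.zero_mem⟩
    h.continuousOn_norm_ext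
  have key : ∀ y ∈ D, ¬ IsMaxOn (norm ∘ f) D y := by
    intro y hy hym
    have hc := norm_eqOn_of_isPreconnected_of_isMaxOn h.isConnected.isPreconnected h.isOpen h.diff
      hy hym
    have h0 := hc h.zero_mem
    simp only [Function.comp_apply, h.map_zero, norm_zero, Function.const_apply] at h0
    refine h.not_eventually_const h.zero_mem ?_
    filter_upwards [h.isOpen.mem_nhds h.zero_mem] with w hw
    have := hc hw
    simp only [Function.comp_apply, Function.const_apply, ← h0, norm_eq_zero] at this
    rw [this, h.map_zero]
  have hz₁D : z₁ ∉ D := by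
    intro hzD
    refine key z₁ hzD fun y hy => ?_
    have := hmax (subset_closure hy)
    simp only [mem_ofPred_eq, if_pos hy, if_pos hzD] at this
    exact this
  have hle : ∀ y ∈ D, ‖f y‖ ≤ 1 := by
    intro y hy
    have := hmax (subset_closure hy)
    simpa only [mem_ofPred_eq, if_pos hy, if_neg hz₁D] using this
  refine lt_of_le_of_ne (hle z hz) fun heq => key z hz fun y hy => ?_
  simp only [mem_ofPred_eq, Function.comp_apply, heq]
  exact hle y hy

/-- Properness: boundary values `1` keep the sublevel sets away from the boundary. -/
lemma isCompact_sublevel (h : IsDiscMap f D) {s : ℝ} (hs : s < 1) :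
    IsCompact {z | z ∈ D ∧ ‖f z‖ ≤ s} := by
  classical
  have : {z | z ∈ D ∧ ‖f z‖ ≤ s} =
      closure D ∩ (fun z => if z ∈ D then ‖f z‖ else 1) ⁻¹' Iic s := by
    ext z
    simp only [mem_inter_iff, mem_preimage, mem_Iic, mem_ofPred_eq]
    constructor
    · rintro ⟨h1, h2⟩
      exact ⟨subset_closure h1, by rwa [if_pos h1]⟩
    · rintro ⟨h1, h2⟩
      by_cases hz : z ∈ D
      · rw [if_pos hz] at h2; exact ⟨hz, h2⟩
      · rw [if_neg hz] at h2; linarith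
  rw [this]
  exact h.isCompact_closure.of_isClosed_subset
    (h.continuousOn_norm_ext.preimage_isClosed_of_isClosed isClosed_closure isClosed_Iic)
    inter_subset_left

/-- An elementary degree argument. The values taken exactly once, at a noncritical point, form a set
that contains `0` and is open and relatively closed in the disc, hence all of it. -/
lemma ball_subset_simple (h : IsDiscMap f D) :
    Metric.ball (0 : ℂ) 1 ⊆ {w | ∃ z ∈ D, f z = w ∧ deriv f z ≠ 0 ∧ ∀ z' ∈ D, f z' = w → z' = z} := by
  set S : Set ℂ := {w | w ∈ Metric.ball (0 : ℂ) 1 ∧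
    ∃ z ∈ D, f z = w ∧ deriv f z ≠ 0 ∧ ∀ z' ∈ D, f z' = w → z' = z}
  suffices hS : Metric.ball (0 : ℂ) 1 ⊆ S from fun w hw => (hS hw).2
  have hex : ∀ w ∈ Metric.ball (0 : ℂ) 1, ∃ s, ‖w‖ < s ∧ s < 1 := fun w hw =>
    exists_between (mem_ball_zero_iff.1 hw)
  have hcs : ∀ s < 1, IsClosed (f '' {z | z ∈ D ∧ ‖f z‖ ≤ s}) := fun s hs =>
    ((h.isCompact_sublevel hs).image_of_continuousOn
      (h.diff.continuousOn.mono fun z hz => hz.1)).isClosed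
  refine (convex_ball (0 : ℂ) 1).isPreconnected.subset_of_closure_inter_subset ?_ ?_ ?_
  -- Openness: `f` is injective near the one preimage, and the part of a compact sublevel set
  -- outside that neighbourhood has closed image missing `w`.
  · rw [isOpen_iff_mem_nhds]
    rintro w ⟨hw, z, hz, hzw, hzd, hu⟩
    obtain ⟨s, hs1, hs2⟩ := hex w hw
    have hstr : HasStrictDerivAt f (deriv f z) z := (h.analyticAt hz).hasStrictDerivAt
    have hinj := (hstr.hasStrictFDerivAt_equiv hzd).eventually_left_inverse
    have hdn : ∀ᶠ y in 𝓝 z, deriv f y ≠ 0 :=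
      (h.analyticAt hz).deriv.continuousAt.eventually_ne hzd
    obtain ⟨V, hV, hVo, hzV⟩ := mem_nhds_iff.1 (inter_mem (inter_mem hinj hdn) (h.isOpen.mem_nhds hz))
    have hK : IsCompact ({z | z ∈ D ∧ ‖f z‖ ≤ s} \ V) := (h.isCompact_sublevel hs2).diff hVo
    have hKc : IsClosed (f '' ({z | z ∈ D ∧ ‖f z‖ ≤ s} \ V)) :=
      (hK.image_of_continuousOn (h.diff.continuousOn.mono fun z hz => hz.1.1)).isClosed
    have hwK : w ∉ f '' ({z | z ∈ D ∧ ‖f z‖ ≤ s} \ V) := by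
      rintro ⟨y, ⟨⟨hyD, -⟩, hyV⟩, hyw⟩
      exact hyV (hu y hyD hyw ▸ hzV)
    have himg : f '' V ∈ 𝓝 w := by
      rw [← hzw]; exact h.image_mem_nhds hz (hVo.mem_nhds hzV)
    filter_upwards [himg, hKc.isOpen_compl.mem_nhds hwK, Metric.isOpen_ball.mem_nhds hw,
      (isOpen_lt continuous_norm continuous_const).mem_nhds hs1] with w' h1 h2 h3 h4
    obtain ⟨y, hyV, rfl⟩ := h1
    refine ⟨h3, y, (hV hyV).2, rfl, (hV hyV).1.2, fun y' hy' hyy => ?_⟩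
    have hy'V : y' ∈ V := by
      by_contra hcon
      have h4' : ‖f y‖ < s := h4
      exact h2 ⟨y', ⟨⟨hy', by rw [hyy]; exact h4'.le⟩, hcon⟩, hyy⟩
    have e1 := (hV hyV).1.1
    have e2 := (hV hy'V).1.1
    simp only [mem_ofPred_eq] at e1 e2
    rw [← e1, ← e2, hyy]
  · refine ⟨0, Metric.mem_ball_self one_pos, Metric.mem_ball_self one_pos, 0, h.zero_mem, h.map_zero,
      h.deriv_zero, h.eq_zero⟩
  -- Closedness: properness supplies a preimage of the limit value. If it were critical, or not the
  -- only one, nearby values would be taken twice.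
  · rintro w ⟨hwS, hw⟩
    by_contra hcon
    obtain ⟨s, hs1, hs2⟩ := hex w hw
    have hfreq : ∃ᶠ w' in 𝓝[≠] w, w' ∈ S :=
      frequently_nhdsWithin_iff.2 ((mem_closure_iff_frequently.1 hwS).mono fun y hy =>
        ⟨hy, fun he => hcon (he ▸ hy)⟩)
    have hfreq' : ∃ᶠ w' in 𝓝 w, w' ∈ S := mem_closure_iff_frequently.1 hwS
    have hmem : w ∈ f '' {z | z ∈ D ∧ ‖f z‖ ≤ s} := by
      rw [← (hcs s hs2).closure_eq, mem_closure_iff_frequently]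
      refine (hfreq'.and_eventually ((isOpen_lt continuous_norm continuous_const).mem_nhds hs1)).mono ?_
      rintro w' ⟨⟨-, z, hz, hzw, -⟩, hlt⟩
      refine ⟨z, ⟨hz, ?_⟩, hzw⟩
      rw [hzw]
      exact le_of_lt hlt
    obtain ⟨z, ⟨hz, -⟩, rfl⟩ := hmem
    by_cases hd : deriv f z = 0
    · obtain ⟨w', ⟨-, y, -, -, -, hy⟩, z₁, h1, z₂, h2, hne, e1, e2⟩ := (hfreq.and_eventually
        (eventually_two_preimages (h.analyticAt hz) hd (h.not_eventually_const hz)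
          (h.isOpen.mem_nhds hz))).exists
      exact hne ((hy z₁ h1 e1).trans (hy z₂ h2 e2).symm)
    · refine hcon ⟨hw, z, hz, rfl, hd, fun z' hz' he => ?_⟩
      by_contra hne
      obtain ⟨V, V', hVo, hVo', hzV, hzV', hdisj⟩ := t2_separation hne
      have n1 := h.image_mem_nhds hz' (inter_mem (hVo.mem_nhds hzV) (h.isOpen.mem_nhds hz'))
      have n2 := h.image_mem_nhds hz (inter_mem (hVo'.mem_nhds hzV') (h.isOpen.mem_nhds hz))
      rw [he] at n1
      obtain ⟨w', ⟨-, y, -, -, -, hy⟩, ⟨z₁, h1, e1⟩, z₂, h2, e2⟩ := (hfreq'.and_eventually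
        (inter_mem n1 n2)).exists
      have : z₁ = z₂ := (hy z₁ h1.2 e1).trans (hy z₂ h2.2 e2).symm
      exact Set.disjoint_left.1 hdisj h1.1 (this ▸ h2.1)

lemma injOn (h : IsDiscMap f D) : InjOn f D := by
  intro x hx y hy hxy
  obtain ⟨z, hz, -, -, hu⟩ := h.ball_subset_simple (mem_ball_zero_iff.2 (h.norm_lt_one hx))
  exact (hu x hx rfl).trans (hu y hy hxy.symm).symm

lemma deriv_ne_zero (h : IsDiscMap f D) {z : ℂ} (hz : z ∈ D) : deriv f z ≠ 0 := by
  obtain ⟨y, hy, he, hd, hu⟩ := h.ball_subset_simple (mem_ball_zero_iff.2 (h.norm_lt_one hz))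
  rw [hu z hz rfl]
  exact hd

lemma surjOn (h : IsDiscMap f D) : SurjOn f D (Metric.ball 0 1) := fun w hw => by
  obtain ⟨z, hz, hzw, -⟩ := h.ball_subset_simple hw
  exact ⟨z, hz, hzw⟩

/-- The inverse of a conformal map onto the disc. -/
lemma exists_inverse (h : IsDiscMap f D) : ∃ ψ : ℂ → ℂ,
    (∀ w ∈ Metric.ball (0 : ℂ) 1, ψ w ∈ D ∧ f (ψ w) = w) ∧ (∀ z ∈ D, ψ (f z) = z) ∧
    (∀ w ∈ Metric.ball (0 : ℂ) 1, HasDerivAt ψ (deriv f (ψ w))⁻¹ w) := by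
  set ψ := Function.invFunOn f D
  have h1 : ∀ w ∈ Metric.ball (0 : ℂ) 1, ψ w ∈ D ∧ f (ψ w) = w := fun w hw =>
    ⟨Function.invFunOn_mem (h.surjOn hw), Function.invFunOn_eq (h.surjOn hw)⟩
  have h2 : ∀ z ∈ D, ψ (f z) = z := fun z hz => by
    have := h1 (f z) (mem_ball_zero_iff.2 (h.norm_lt_one hz))
    exact h.injOn this.1 hz this.2
  refine ⟨ψ, h1, h2, fun w hw => ?_⟩
  have hd := ((h.analyticAt (h1 w hw).1).differentiableAt).hasDerivAt
  refine HasDerivAt.of_local_left_inverse ?_ hd (h.deriv_ne_zero (h1 w hw).1)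
    (eventually_of_mem (Metric.isOpen_ball.mem_nhds hw) fun y hy => (h1 y hy).2)
  rw [ContinuousAt, tendsto_def]
  intro V hV
  have := h.image_mem_nhds (h1 w hw).1 (inter_mem hV (h.isOpen.mem_nhds (h1 w hw).1))
  rw [(h1 w hw).2] at this
  refine mem_of_superset this ?_
  rintro _ ⟨y, ⟨hyV, hyD⟩, rfl⟩
  rw [mem_preimage, h2 y hyD]
  exact hyV

end IsDiscMap

/-! ### Smoothness of the conformal map and its inverse up to the boundary. -/

/-- The extension by limits coincides with any local continuous extension, so a single global
extension inherits the smoothness of all the local ones. -/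
lemma extendFrom_eventuallyEq {Y : Type*} [TopologicalSpace Y] [T2Space Y] {U : Set ℂ}
    {g ge : ℂ → Y} {p : ℂ} (hc : ∀ᶠ z in 𝓝 p, ContinuousAt ge z)
    (he : ∀ᶠ z in 𝓝[U] p, ge z = g z) :
    ∀ᶠ z in 𝓝[closure U] p, extendFrom U g z = ge z := by
  have h2 : ∀ᶠ z in 𝓝 p, z ∈ U → ge z = g z := eventually_nhdsWithin_iff.1 he
  rw [eventually_nhdsWithin_iff]
  filter_upwards [hc, h2.eventually_nhds] with z h3 h4 hz
  refine extendFrom_eq hz ?_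
  refine (h3.tendsto.mono_left nhdsWithin_le_nhds).congr' ?_
  rw [EventuallyEq, eventually_nhdsWithin_iff]
  exact h4

lemma eventually_continuousAt_of_contDiffAt {ge : ℂ → ℂ} {p : ℂ} {n : ℕ}
    (h : ContDiffAt ℝ n ge p) : ∀ᶠ z in 𝓝 p, ContinuousAt ge z :=
  (h.eventually (by simp)).mono fun _ hz => hz.continuousAt

/-- The real derivative of a function agreeing with a holomorphic one on a set accumulating at `p`
is complex linear at `p`. -/
lemma exists_hasFDerivAt_smul {D : Set ℂ} {f fe : ℂ → ℂ} {p : ℂ} {n : ℕ} (hD : IsOpen D)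
    (hp : p ∈ closure D) (hf : DifferentiableOn ℂ f D) (hfe : ContDiffAt ℝ (n + 1) fe p)
    (he : ∀ᶠ z in 𝓝[D] p, fe z = f z) :
    ∃ b : ℂ, HasFDerivAt fe (b • (1 : ℂ →L[ℝ] ℂ)) p := by
  refine ⟨fderiv ℝ fe p 1, (hfe.differentiableAt (by simp)).hasFDerivAt.congr_fderiv ?_⟩
  have : (𝓝[D] p).NeBot := mem_closure_iff_nhdsWithin_neBot.1 hp
  have hc : ContinuousAt (fderiv ℝ fe) p :=
    (hfe.fderiv_right (m := n) le_rfl).continuousAt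
  have h2 : ∀ᶠ z in 𝓝 p, z ∈ D → fe z = f z := eventually_nhdsWithin_iff.1 he
  have hev : ∀ᶠ z in 𝓝[D] p, ∀ v, fderiv ℝ fe z v = fderiv ℝ fe z 1 * v := by
    rw [eventually_nhdsWithin_iff]
    filter_upwards [h2.eventually_nhds] with z hz hzD v
    have h3 : fe =ᶠ[𝓝 z] f := by
      filter_upwards [hz, hD.mem_nhds hzD] with y hy hyD using hy hyD
    have h4 := ((hf.differentiableAt (hD.mem_nhds hzD)).hasDerivAt).complexToReal_fderiv
    rw [h3.fderiv_eq, h4.fderiv]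
    simp
  ext v
  have hl : Tendsto (fun z => fderiv ℝ fe z v) (𝓝[D] p) (𝓝 (fderiv ℝ fe p v)) :=
    (hc.clm_apply continuousAt_const).tendsto.mono_left nhdsWithin_le_nhds
  have hr : Tendsto (fun z => fderiv ℝ fe z 1 * v) (𝓝[D] p) (𝓝 (fderiv ℝ fe p 1 * v)) :=
    ((hc.clm_apply continuousAt_const).mul continuousAt_const).tendsto.mono_left nhdsWithin_le_nhds
  have := tendsto_nhds_unique (hl.congr' (hev.mono fun z hz => hz v)) hr
  simpa using this

section DiscBoundary

variable {D : Set ℂ} {f P ψ : ℂ → ℂ} {c : ℝ → ℂ}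

/-- A conformal map onto the disc and its inverse are smooth up to the boundary. -/
theorem IsDiscMap.exists_boundary_extension (h : IsDiscMap f D) (hc : IsLeftParam c D)
    (hP : DifferentiableOn ℂ P D) (hf : ∀ z, f z = z * exp (P z))
    (hψ : ∀ z ∈ D, ψ (f z) = z) {p : ℂ} (hp : p ∈ frontier D) (n : ℕ) :
    ∃ fe ψe : ℂ → ℂ, ContDiffAt ℝ (n + 1) fe p ∧ (∀ᶠ z in 𝓝[D] p, fe z = f z) ∧
      fe p = extendFrom D f p ∧ ‖fe p‖ = 1 ∧ ContDiffAt ℝ (n + 1) ψe (fe p) ∧ ψe (fe p) = p ∧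
      (∀ᶠ w in 𝓝[Metric.ball 0 1] (fe p), ψe w = ψ w) ∧
      ∃ b : ℂ, b ≠ 0 ∧ HasFDerivAt ψe (b • (1 : ℂ →L[ℝ] ℂ)) (fe p) := by
  obtain ⟨t, rfl⟩ : ∃ t, c t = p := by
    rw [← hc.range_eq] at hp; exact hp
  set p := c t
  have hpD : p ∉ D := by
    rw [h.isOpen.frontier_eq] at hp; exact hp.2
  have hp0 : p ≠ 0 := fun h0 => hpD (h0 ▸ h.zero_mem)
  have hpn : 0 < ‖p‖ := norm_pos_iff.2 hp0
  have hpc : p ∈ closure D := frontier_subset_closure hp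
  have : (𝓝[D] p).NeBot := mem_closure_iff_nhdsWithin_neBot.1 hpc
  have hslit : ∀ z ∈ Metric.ball p ‖p‖, z / p ∈ slitPlane := by
    intro z hz
    have h1 : z / p ∈ Metric.ball (1 : ℂ) 1 := by
      rw [mem_ball_iff_norm, div_sub_one hp0, norm_div, div_lt_one hpn]
      exact mem_ball_iff_norm.1 hz
    exact ball_one_subset_slitPlane h1
  -- A branch of `log f` near `p`. Its real part `log ‖f‖` tends to zero at the boundary, as
  -- boundary regularity requires.
  set F : ℂ → ℂ := fun z => log (z / p) + log p + P z
  have hFe : ∀ z ∈ D ∩ Metric.ball p ‖p‖, exp (F z) = f z := by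
    intro z hz
    have := slitPlane_ne_zero (hslit z hz.2)
    rw [hf, exp_add, exp_add, exp_log this, exp_log hp0, div_mul_cancel₀ _ hp0]
  have hFd : DifferentiableOn ℂ F (D ∩ Metric.ball p ‖p‖) := by
    have h1 : DifferentiableOn ℂ (fun z => log (z / p)) (D ∩ Metric.ball p ‖p‖) :=
      (differentiableOn_id.div_const p).clog fun z hz => hslit z hz.2
    exact (h1.add_const _).add (hP.mono inter_subset_left)
  have hFre : ∀ z ∈ D ∩ Metric.ball p ‖p‖, (F z).re = Real.log ‖f z‖ := by
    intro z hz
    rw [← hFe z hz, norm_exp, Real.log_exp]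
  obtain ⟨Fe, hFes, hFeq⟩ := hc.exists_contDiffAt_extension t hpn hFd (fun q hq => by
    have h1 : Tendsto (fun z => Real.log ‖f z‖) (𝓝[D] q) (𝓝 (Real.log 1)) :=
      (h.tendsto q hq.1).log one_ne_zero
    rw [Real.log_one] at h1
    refine h1.congr' ?_
    filter_upwards [self_mem_nhdsWithin,
      mem_nhdsWithin_of_mem_nhds (Metric.isOpen_ball.mem_nhds hq.2)] with z h2 h3
    exact (hFre z ⟨h2, h3⟩).symm) (n + 1)
  set fe : ℂ → ℂ := fun z => exp (Fe z)
  have hfes : ContDiffAt ℝ (n + 1) fe p := by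
    have : ContDiffAt ℝ ((n + 1 : ℕ) : WithTop ℕ∞) fe p :=
      ((contDiff_exp (𝕜 := ℂ)).restrict_scalars ℝ).contDiffAt.comp p hFes
    exact_mod_cast this
  have hfeq : ∀ᶠ z in 𝓝[D] p, fe z = f z := by
    filter_upwards [hFeq, self_mem_nhdsWithin,
      mem_nhdsWithin_of_mem_nhds (Metric.ball_mem_nhds p hpn)] with z h1 h2 h3
    simp only [fe]
    rw [h1, hFe z ⟨h2, h3⟩]
  have hfec : ∀ᶠ z in 𝓝 p, ContinuousAt fe z :=
    eventually_continuousAt_of_contDiffAt (n := n + 1) (by exact_mod_cast hfes)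
  have hlim : Tendsto f (𝓝[D] p) (𝓝 (fe p)) :=
    (hfes.continuousAt.tendsto.mono_left nhdsWithin_le_nhds).congr' hfeq
  have hext : fe p = extendFrom D f p := (extendFrom_eq hpc hlim).symm
  have hfr : ∀ᶠ z in 𝓝 p, z ∈ frontier D → ‖fe z‖ = 1 := by
    filter_upwards [hfec, (eventually_nhdsWithin_iff.1 hfeq).eventually_nhds] with z h1 h2 hz
    have : (𝓝[D] z).NeBot := mem_closure_iff_nhdsWithin_neBot.1 (frontier_subset_closure hz)
    refine tendsto_nhds_unique ?_ (h.tendsto z hz)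
    refine (h1.norm.tendsto.mono_left nhdsWithin_le_nhds).congr' ?_
    filter_upwards [eventually_nhdsWithin_iff.2 h2] with y hy
    rw [hy]
  have hnorm : ‖fe p‖ = 1 := hfr.self_of_nhds hp
  obtain ⟨b, hb⟩ := exists_hasFDerivAt_smul h.isOpen hpc h.diff hfes hfeq
  have hb0 : b ≠ 0 := by
    rintro rfl
    obtain ⟨q, ρ, hρ, hpq, hball⟩ := hc.exists_interior_ball t
    refine fderiv_ne_zero_of_interior_ball hρ hpq hball h.diff (fun z hz => h.norm_lt_one hz) hb
      hfeq hnorm ?_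
    ext v
    simp
  set L : ℂ ≃L[ℝ] ℂ := (ContinuousLinearEquiv.unitsEquivAut ℂ (Units.mk0 _ hb0)).restrictScalars ℝ
  have hL : (L : ℂ →L[ℝ] ℂ) = b • (1 : ℂ →L[ℝ] ℂ) := by
    ext v
    simp [L, mul_comm]
  have hfd : HasFDerivAt fe (L : ℂ →L[ℝ] ℂ) p := by rw [hL]; exact hb
  set e := hfes.toOpenPartialHomeomorph _ hfd (by simp)
  have he : (e : ℂ → ℂ) = fe := hfes.toOpenPartialHomeomorph_coe hfd (by simp)
  have hps : p ∈ e.source := hfes.mem_toOpenPartialHomeomorph_source hfd (by simp)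
  have hwt : fe p ∈ e.target := by rw [← he]; exact e.map_source hps
  have hs0 : e.symm (fe p) = p := by rw [← he]; exact e.left_inv hps
  have hsc : ContDiffAt ℝ (n + 1) e.symm (fe p) :=
    e.contDiffAt_symm hwt (f₀' := L) (by rw [hs0, he]; exact hfd) (by rw [hs0, he]; exact hfes)
  have hsd : HasFDerivAt e.symm (b⁻¹ • (1 : ℂ →L[ℝ] ℂ)) (fe p) := by
    have h1 : HasFDerivAt e.symm (L.symm : ℂ →L[ℝ] ℂ) (fe p) :=
      e.hasFDerivAt_symm hwt (by rw [hs0, he]; exact hfd)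
    refine h1.congr_fderiv ?_
    ext v
    simp only [ContinuousLinearEquiv.coe_coe, smul_apply, one_apply_eq_self, smul_eq_mul]
    rw [ContinuousLinearEquiv.symm_apply_eq]
    have : L (b⁻¹ * v) = (L : ℂ →L[ℝ] ℂ) (b⁻¹ * v) := rfl
    rw [this, hL]
    simp only [smul_apply, one_apply_eq_self, smul_eq_mul]
    rw [mul_inv_cancel_left₀ hb0]
  refine ⟨fe, e.symm, hfes, hfeq, hext, hnorm, hsc, hs0, ?_, b⁻¹, inv_ne_zero hb0, hsd⟩
  have hN : ∀ᶠ w in 𝓝 (fe p), w ∈ e.target ∧ (e.symm w ∈ frontier D → ‖fe (e.symm w)‖ = 1) ∧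
      (e.symm w ∈ D → fe (e.symm w) = f (e.symm w)) := by
    have ht : Tendsto e.symm (𝓝 (fe p)) (𝓝 p) := by
      have := hsc.continuousAt.tendsto
      rwa [hs0] at this
    filter_upwards [e.open_target.mem_nhds hwt, ht.eventually hfr,
      ht.eventually (eventually_nhdsWithin_iff.1 hfeq)] with w h1 h2 h3 using ⟨h1, h2, h3⟩
  obtain ⟨δ, hδ, hδb⟩ := Metric.eventually_nhds_iff_ball.1 hN
  set W := Metric.ball (0 : ℂ) 1 ∩ Metric.ball (fe p) δ
  have hWpre : IsPreconnected (e.symm '' W) :=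
    ((convex_ball _ _).inter (convex_ball _ _)).isPreconnected.image _
      (e.symm.continuousOn.mono fun w hw => (hδb w hw.2).1)
  have hright : ∀ w ∈ W, fe (e.symm w) = w := fun w hw => by
    rw [← he]; exact e.right_inv (hδb w hw.2).1
  -- On the boundary `‖fe‖ = 1`, so the local inverse maps the disc side into `D` or away from it.
  -- The values `f z` with `z ∈ D` near `p` exclude the second case.
  have hdich := subset_or_disjoint_of_isPreconnected (D := D) hWpre (by
    rintro _ ⟨w, hw, rfl⟩ hmem
    have h1 := (hδb w hw.2).2.1 hmem
    rw [hright w hw] at h1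
    have := mem_ball_zero_iff.1 hw.1
    linarith)
  have hsub : e.symm '' W ⊆ D := by
    refine hdich.resolve_right fun hcon => ?_
    obtain ⟨z, h1, h2, h3, h4⟩ := (hfeq.and ((eventually_mem_nhdsWithin (s := D)).and
      ((hlim.eventually (Metric.ball_mem_nhds _ hδ)).and
        (mem_nhdsWithin_of_mem_nhds (e.open_source.mem_nhds hps))))).exists
    refine hcon (e.symm (f z)) ⟨f z, ⟨mem_ball_zero_iff.2 (h.norm_lt_one h2), h3⟩, rfl⟩ ?_
    rw [← h1, ← he, e.left_inv h4]
    exact h2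
  filter_upwards [self_mem_nhdsWithin, mem_nhdsWithin_of_mem_nhds (Metric.ball_mem_nhds _ hδ)]
    with w h1 h2
  have hw : w ∈ W := ⟨h1, h2⟩
  have hD' := hsub ⟨w, hw, rfl⟩
  have h3 := (hδb w h2).2.2 hD'
  rw [hright w hw] at h3
  rw [h3, hψ _ hD', ← h3]

end DiscBoundary

/-- The closed unit disc. -/
abbrev closedDisc : Set ℂ := Metric.closedBall 0 1

lemma uniqueDiffOn_real_closedDisc : UniqueDiffOn ℝ closedDisc :=
  uniqueDiffOn_convex (convex_closedBall _ _) (by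
    rw [interior_closedBall _ one_ne_zero]; exact ⟨0, Metric.mem_ball_self one_pos⟩)

lemma uniqueDiffOn_closedDisc : UniqueDiffOn ℂ closedDisc := fun w hw =>
  (uniqueDiffOn_real_closedDisc w hw).mono_field

lemma closedDisc_subset_closure : closedDisc ⊆ closure (Metric.ball (0 : ℂ) 1) := by
  rw [closure_ball _ one_ne_zero]

lemma hasDerivWithinAt_of_real_smul {h : ℂ → ℂ} {b w : ℂ} {s : Set ℂ}
    (hh : HasFDerivWithinAt h (b • (1 : ℂ →L[ℝ] ℂ)) s w) : HasDerivWithinAt h b s w := by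
  rw [hasDerivWithinAt_iff_hasFDerivWithinAt]
  refine HasFDerivWithinAt.of_restrictScalars ℝ hh ?_
  ext v
  simp [mul_comm]

/-- The real derivative is complex linear in the open disc, hence by continuity in the closed one.
Its value at `1` is again holomorphic inside, and the induction continues. -/
lemma contDiffOn_complex_of_real (n : ℕ) : ∀ {h : ℂ → ℂ}, ContDiffOn ℝ n h closedDisc →
    DifferentiableOn ℂ h (Metric.ball 0 1) → ContDiffOn ℂ n h closedDisc := by
  induction n with
  | zero =>
    intro h hr _
    simp only [Nat.cast_zero] at hr ⊢
    exact contDiffOn_zero.2 hr.continuousOn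
  | succ n ih =>
    intro h hr hd
    have hu := uniqueDiffOn_real_closedDisc
    have hr' : ContDiffOn ℝ (n + 1) h closedDisc := by exact_mod_cast hr
    set L := fderivWithin ℝ h closedDisc
    have hL : ContDiffOn ℝ n L closedDisc := hr'.fderivWithin hu le_rfl
    have hLv : ∀ v, ContDiffOn ℝ n (fun w => L w v) closedDisc := fun v =>
      hL.clm_apply contDiffOn_const
    have hball : ∀ w ∈ Metric.ball (0 : ℂ) 1, ∀ v, L w v = deriv h w * v := by
      intro w hw v
      have h1 := ((hd.differentiableAt (Metric.isOpen_ball.mem_nhds hw)).hasDerivAt).complexToReal_fderiv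
      have hin : closedDisc ∈ 𝓝 w :=
        mem_of_superset (Metric.isOpen_ball.mem_nhds hw) Metric.ball_subset_closedBall
      simp only [L]
      rw [fderivWithin_of_mem_nhds hin, h1.fderiv]
      simp
    have hlin : ∀ w ∈ closedDisc, L w = (L w 1) • (1 : ℂ →L[ℝ] ℂ) := by
      intro w hw
      ext v
      have : EqOn (fun w => L w v) (fun w => L w 1 * v) closedDisc :=
        EqOn.of_subset_closure (s := Metric.ball 0 1)
          (fun w hw => by simp only [hball w hw, mul_one])
          (hLv v).continuousOn ((hLv 1).continuousOn.mul continuousOn_const)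
          Metric.ball_subset_closedBall closedDisc_subset_closure
      simpa using this hw
    have hder : ∀ w ∈ closedDisc, HasDerivWithinAt h (L w 1) closedDisc w := by
      intro w hw
      refine hasDerivWithinAt_of_real_smul ?_
      rw [← hlin w hw]
      exact ((hr'.differentiableOn (by simp)) w hw).hasFDerivWithinAt
    have hdw : EqOn (derivWithin h closedDisc) (fun w => L w 1) closedDisc := fun w hw =>
      (hder w hw).derivWithin (uniqueDiffOn_closedDisc w hw)
    have h2 : ContDiffOn ℂ n (fun w => L w 1) closedDisc := by
      refine ih (hLv 1) ?_
      refine DifferentiableOn.congr (hd.deriv Metric.isOpen_ball) fun w hw => ?_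
      simp only [hball w hw, mul_one]
    have : ContDiffOn ℂ (n + 1) h closedDisc := by
      rw [contDiffOn_succ_iff_derivWithin uniqueDiffOn_closedDisc]
      exact ⟨fun w hw => (hder w hw).differentiableWithinAt, fun hn => by simp at hn, h2.congr hdw⟩
    exact_mod_cast this

/-- A conformal parametrization of a domain by the disc, smooth up to the boundary. -/
structure IsConformalParam (ψ : ℂ → ℂ) (D : Set ℂ) : Prop where
  smooth : ContDiffOn ℂ ∞ ψ closedDisc
  deriv_ne : ∀ w ∈ closedDisc, derivWithin ψ closedDisc w ≠ 0
  injOn : InjOn ψ closedDisc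
  map_zero : ψ 0 = 0
  image_ball : ψ '' Metric.ball 0 1 = D
  image_sphere : ψ '' Metric.sphere 0 1 = frontier D

/-- The inverse map is extended to the closed disc by limits, where it agrees near each circle point
with a local smooth inverse. The local extensions `fe` are retained because the one-sided gradient
of `G` on the boundary is computed from them. -/
theorem IsDiscMap.exists_conformalParam {D : Set ℂ} {f P : ℂ → ℂ} {c : ℝ → ℂ} (h : IsDiscMap f D)
    (hc : IsLeftParam c D) (hP : DifferentiableOn ℂ P D) (hf : ∀ z, f z = z * exp (P z)) :
    ∃ ψ : ℂ → ℂ, IsConformalParam ψ D ∧ (∀ w ∈ Metric.ball (0 : ℂ) 1, f (ψ w) = w) ∧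
      ∀ w ∈ Metric.sphere (0 : ℂ) 1, ∃ fe : ℂ → ℂ, ContDiffAt ℝ 1 fe (ψ w) ∧ fe (ψ w) = w ∧
        ∀ᶠ z in 𝓝[D] (ψ w), fe z = f z := by
  obtain ⟨ψ, h1, h2, h3⟩ := h.exists_inverse
  have hext := fun p (hp : p ∈ frontier D) n => h.exists_boundary_extension hc hP hf h2 hp n
  set fx := extendFrom D f
  set ψx := extendFrom (Metric.ball (0 : ℂ) 1) ψ
  have hcl : closure (Metric.ball (0 : ℂ) 1) = closedDisc := closure_ball _ one_ne_zero
  have hψd : DifferentiableOn ℂ ψ (Metric.ball 0 1) := fun w hw =>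
    (h3 w hw).differentiableAt.differentiableWithinAt
  have hψxb : ∀ w ∈ Metric.ball (0 : ℂ) 1, ψx w = ψ w := fun w hw =>
    extendFrom_extends hψd.continuousOn w hw
  have hfxD : ∀ z ∈ D, fx z = f z := fun z hz => extendFrom_extends h.diff.continuousOn z hz
  have hfxc : ContinuousOn fx (closure D) := by
    refine continuousOn_extendFrom le_rfl fun z hz => ?_
    rw [closure_eq_self_union_frontier] at hz
    rcases hz with hz | hz
    · exact ⟨f z, (h.analyticAt hz).continuousAt.tendsto.mono_left nhdsWithin_le_nhds⟩
    · obtain ⟨fe, -, e1, e2, -⟩ := hext z hz 0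
      exact ⟨fe z, (e1.continuousAt.tendsto.mono_left nhdsWithin_le_nhds).congr' e2⟩
  -- The extended map sends the compact closure of `D` onto a closed set containing the open disc.
  -- Circle points are not values on `D`, where `‖f‖ < 1`.
  have hsurj : ∀ w ∈ Metric.sphere (0 : ℂ) 1, ∃ p ∈ frontier D, fx p = w := by
    intro w hw
    have hcpt : IsClosed (fx '' closure D) :=
      (h.isCompact_closure.image_of_continuousOn hfxc).isClosed
    have hsub : Metric.ball (0 : ℂ) 1 ⊆ fx '' closure D := fun w' hw' =>
      ⟨ψ w', subset_closure (h1 w' hw').1, by rw [hfxD _ (h1 w' hw').1, (h1 w' hw').2]⟩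
    obtain ⟨p, hp, hpw⟩ := hcpt.closure_subset_iff.2 hsub (by
      rw [hcl]; exact Metric.sphere_subset_closedBall hw)
    rw [closure_eq_self_union_frontier] at hp
    rcases hp with hp | hp
    · have := h.norm_lt_one hp
      rw [← hfxD p hp, hpw, mem_sphere_zero_iff_norm.1 hw] at this
      exact absurd this (lt_irrefl _)
    · exact ⟨p, hp, hpw⟩
  have hloc : ∀ w ∈ Metric.sphere (0 : ℂ) 1, ∀ n : ℕ, ∃ ψe : ℂ → ℂ, ContDiffAt ℝ (n + 1) ψe w ∧
      (∀ᶠ y in 𝓝[closedDisc] w, ψx y = ψe y) ∧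
      ∃ b : ℂ, b ≠ 0 ∧ HasFDerivAt ψe (b • (1 : ℂ →L[ℝ] ℂ)) w := by
    intro w hw n
    obtain ⟨p, hp, rfl⟩ := hsurj w hw
    obtain ⟨fe, ψe, -, -, e3, -, e5, -, e7, e8⟩ := hext p hp n
    rw [e3] at e5 e7 e8
    refine ⟨ψe, e5, ?_, e8⟩
    rw [← hcl]
    exact extendFrom_eventuallyEq (eventually_continuousAt_of_contDiffAt (n := n + 1)
      (by exact_mod_cast e5)) e7
  have hψfx : ∀ p ∈ frontier D, ψx (fx p) = p ∧ ‖fx p‖ = 1 := by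
    intro p hp
    obtain ⟨fe, ψe, -, -, e3, e4, e5, e6, e7, -⟩ := hext p hp 0
    rw [e3] at e4 e5 e6 e7
    refine ⟨?_, e4⟩
    have := extendFrom_eventuallyEq (eventually_continuousAt_of_contDiffAt (n := 0 + 1)
      (by exact_mod_cast e5)) e7
    rw [hcl] at this
    exact (this.self_of_nhdsWithin (mem_closedBall_zero_iff.2 e4.le)).trans e6
  have hsplit : ∀ w ∈ closedDisc, w ∈ Metric.ball (0 : ℂ) 1 ∨ w ∈ Metric.sphere (0 : ℂ) 1 := by
    intro w hw
    rcases lt_or_eq_of_le (mem_closedBall_zero_iff.1 hw) with h | h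
    · exact Or.inl (mem_ball_zero_iff.2 h)
    · exact Or.inr (mem_sphere_zero_iff_norm.2 h)
  have hev : ∀ w ∈ Metric.ball (0 : ℂ) 1, ψx =ᶠ[𝓝 w] ψ := fun w hw =>
    eventually_of_mem (Metric.isOpen_ball.mem_nhds hw) hψxb
  have hψxd : DifferentiableOn ℂ ψx (Metric.ball 0 1) := hψd.congr hψxb
  have hreal : ∀ n : ℕ, ContDiffOn ℝ n ψx closedDisc := by
    intro n w hw
    rcases hsplit w hw with hw' | hw'
    · have han : AnalyticAt ℂ ψx w := hψxd.analyticAt (Metric.isOpen_ball.mem_nhds hw')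
      exact (han.contDiffAt.restrict_scalars ℝ).contDiffWithinAt
    · obtain ⟨ψe, e1, e2, -⟩ := hloc w hw' n
      exact ((e1.of_le (by norm_cast; omega)).contDiffWithinAt).congr_of_eventuallyEq e2
        (e2.self_of_nhdsWithin hw)
  have hleft : ∀ w ∈ closedDisc, fx (ψx w) = w := by
    intro w hw
    rcases hsplit w hw with hw' | hw'
    · rw [hψxb w hw', hfxD _ (h1 w hw').1, (h1 w hw').2]
    · obtain ⟨p, hp, rfl⟩ := hsurj w hw'
      rw [(hψfx p hp).1]
  refine ⟨ψx, ⟨?_, ?_, ?_, ?_, ?_, ?_⟩, ?_, ?_⟩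
  · exact contDiffOn_infty.2 fun n => contDiffOn_complex_of_real n (hreal n) hψxd
  · intro w hw
    rcases hsplit w hw with hw' | hw'
    · have hin : closedDisc ∈ 𝓝 w :=
        mem_of_superset (Metric.isOpen_ball.mem_nhds hw') Metric.ball_subset_closedBall
      rw [derivWithin_of_mem_nhds hin, (hev w hw').deriv_eq, (h3 w hw').deriv]
      exact inv_ne_zero (h.deriv_ne_zero (h1 w hw').1)
    · obtain ⟨ψe, e1, e2, b, hb, e3⟩ := hloc w hw' 0
      have : HasDerivWithinAt ψx b closedDisc w := hasDerivWithinAt_of_real_smul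
        (e3.hasFDerivWithinAt.congr_of_eventuallyEq e2 (e2.self_of_nhdsWithin hw))
      rw [this.derivWithin (uniqueDiffOn_closedDisc w hw)]
      exact hb
  · intro x hx y hy hxy
    rw [← hleft x hx, ← hleft y hy, hxy]
  · have := h2 0 h.zero_mem
    rw [h.map_zero] at this
    rw [hψxb 0 (Metric.mem_ball_self one_pos), this]
  · ext z
    constructor
    · rintro ⟨w, hw, rfl⟩
      rw [hψxb w hw]
      exact (h1 w hw).1
    · intro hz
      have := mem_ball_zero_iff.2 (h.norm_lt_one hz)
      exact ⟨f z, this, by rw [hψxb _ this, h2 z hz]⟩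
  · ext z
    constructor
    · rintro ⟨w, hw, rfl⟩
      obtain ⟨p, hp, rfl⟩ := hsurj w hw
      rw [(hψfx p hp).1]
      exact hp
    · intro hz
      exact ⟨fx z, mem_sphere_zero_iff_norm.2 (hψfx z hz).2, (hψfx z hz).1⟩
  · intro w hw
    rw [hψxb w hw, (h1 w hw).2]
  · intro w hw
    obtain ⟨p, hp, rfl⟩ := hsurj w hw
    obtain ⟨fe, -, e1, e2, e3, -⟩ := hext p hp 0
    rw [(hψfx p hp).1]
    exact ⟨fe, by simpa using e1, e3, e2⟩

/-! ### The Green function in conformal coordinates. -/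

variable {D : Set ℂ} {Φ : ℝ} {G : ℂ → ℝ} {ψ : ℂ → ℂ}

/-- Off the origin the modulus of the map is `exp (-(2π / Φ) (G - a))`, so constancy of `G` on the
boundary makes the map proper. -/
lemma IsGreen.isDiscMap (hD : IsSmoothJordanInterior D) (hΦ : Φ ≠ 0) (hG : IsGreen D Φ G)
    {a : ℝ} {P : ℂ → ℂ} (hP : DifferentiableOn ℂ P D) (ha : ∀ z ∈ frontier D, G z = a)
    (hGP : ∀ z ∈ D \ {0}, G z = a - Φ / (2 * Real.pi) * (Real.log ‖z‖ + (P z).re)) :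
    IsDiscMap (fun z => z * exp (P z)) D where
  isOpen := hD.isOpen
  isConnected := hD.isConnected
  isBounded := hD.isBounded
  zero_mem := hD.zero_mem
  diff := differentiableOn_id.mul hP.cexp
  map_zero := zero_mul _
  eq_zero := fun z _ h => (mul_eq_zero.1 h).resolve_right (exp_ne_zero _)
  deriv_zero := by
    have hd : DifferentiableAt ℂ (fun z => exp (P z)) 0 :=
      (hP.differentiableAt (hD.isOpen.mem_nhds hD.zero_mem)).cexp
    have : HasDerivAt (fun z => z * exp (P z)) (exp (P 0)) 0 :=
      ((hasDerivAt_id (0 : ℂ)).mul hd.hasDerivAt).congr_deriv (by simp)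
    rw [this.deriv]
    exact exp_ne_zero _
  tendsto := by
    intro p hp
    have hpD : p ∉ D := by
      rw [hD.isOpen.frontier_eq] at hp; exact hp.2
    have hp0 : p ≠ 0 := fun h0 => hpD (h0 ▸ hD.zero_mem)
    have hev : ∀ᶠ z in 𝓝[D] p, z ∈ D \ {0} := by
      filter_upwards [self_mem_nhdsWithin,
        mem_nhdsWithin_of_mem_nhds (isOpen_compl_singleton.mem_nhds hp0)] with z h1 h2
      exact ⟨h1, h2⟩
    have hGt : Tendsto G (𝓝[D] p) (𝓝 a) := by
      have h1 : Tendsto G (𝓝[closure D \ {0}] p) (𝓝 (G p)) :=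
        hG.continuousOn p ⟨frontier_subset_closure hp, hp0⟩
      rw [ha p hp] at h1
      refine h1.mono_left ?_
      rw [nhdsWithin_le_iff]
      filter_upwards [hev] with z hz
      exact ⟨subset_closure hz.1, hz.2⟩
    have h2 : Tendsto (fun z => Real.exp (-(2 * Real.pi / Φ) * (G z - a))) (𝓝[D] p)
        (𝓝 (Real.exp (-(2 * Real.pi / Φ) * (a - a)))) :=
      ((Real.continuous_exp.tendsto _).comp ((hGt.sub_const a).const_mul _))
    rw [sub_self, mul_zero, Real.exp_zero] at h2
    refine h2.congr' ?_
    filter_upwards [hev] with z hz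
    have hz0 : 0 < ‖z‖ := norm_pos_iff.2 hz.2
    rw [hGP z hz, norm_mul, norm_exp]
    have hpi := Real.pi_pos
    have : -(2 * Real.pi / Φ) * (a - Φ / (2 * Real.pi) * (Real.log ‖z‖ + (P z).re) - a) =
        Real.log ‖z‖ + (P z).re := by field_simp; ring
    rw [this, Real.exp_add, Real.exp_log hz0]

lemma IsConformalParam.hasDerivWithinAt (h : IsConformalParam ψ D) {w : ℂ} (hw : w ∈ closedDisc) :
    HasDerivWithinAt ψ (derivWithin ψ closedDisc w) closedDisc w :=
  ((h.smooth.differentiableOn (by simp)) w hw).hasDerivWithinAt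

lemma hasFDerivWithinAt_real {h : ℂ → ℂ} {b w : ℂ} {s : Set ℂ} (hh : HasDerivWithinAt h b s w) :
    HasFDerivWithinAt h (b • (1 : ℂ →L[ℝ] ℂ)) s w := by
  refine (hh.hasFDerivWithinAt.restrictScalars ℝ).congr_fderiv ?_
  ext v
  simp [mul_comm]

lemma IsConformalParam.ne_zero (h : IsConformalParam ψ D) {w : ℂ} (hw : w ∈ closedDisc)
    (h0 : w ≠ 0) : ψ w ≠ 0 := fun he =>
  h0 (h.injOn hw (Metric.mem_closedBall_self zero_le_one) (by rw [he, h.map_zero]))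

lemma closedDisc_eq_union : closedDisc = Metric.ball (0 : ℂ) 1 ∪ Metric.sphere 0 1 :=
  Metric.ball_union_sphere.symm

lemma IsConformalParam.image_closedDisc (h : IsConformalParam ψ D) : ψ '' closedDisc = closure D := by
  rw [closedDisc_eq_union, image_union, h.image_ball, h.image_sphere,
    closure_eq_self_union_frontier]

/-- The Green function in conformal coordinates, with its gradient. -/
theorem IsGreen.exists_conformalParam (hD : IsSmoothJordanInterior D) (hΦ : Φ ≠ 0)
    (hG : IsGreen D Φ G) : ∃ a : ℝ, ∃ ψ : ℂ → ℂ, IsConformalParam ψ D ∧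
      (∀ w ∈ closedDisc, w ≠ 0 → G (ψ w) = a - Φ / (2 * Real.pi) * Real.log ‖w‖) ∧
      ∀ w ∈ closedDisc, w ≠ 0 → gradientWithin G (closure D) (ψ w) =
        conj (-(Φ / (2 * Real.pi) : ℝ) / (w * derivWithin ψ closedDisc w)) := by
  obtain ⟨a, P, hP, ha, hGP⟩ := hG.exists_log_form hD hΦ
  obtain ⟨c, hc⟩ := exists_isLeftParam hD
  have hdm := hG.isDiscMap hD hΦ hP ha hGP
  set f : ℂ → ℂ := fun z => z * exp (P z)
  obtain ⟨ψ, hψ, hfψ, hfe⟩ := hdm.exists_conformalParam hc hP (fun _ => rfl)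
  have hGf : ∀ z ∈ D \ {0}, G z = a - Φ / (2 * Real.pi) * Real.log ‖f z‖ := by
    intro z hz
    have hz0 : ‖z‖ ≠ 0 := norm_ne_zero_iff.2 hz.2
    rw [hGP z hz, norm_mul, norm_exp, Real.log_mul hz0 (Real.exp_ne_zero _), Real.log_exp]
  have hGψ : ∀ w ∈ closedDisc, w ≠ 0 → G (ψ w) = a - Φ / (2 * Real.pi) * Real.log ‖w‖ := by
    intro w hw hw0
    have hw' := hw
    rw [closedDisc_eq_union] at hw'
    rcases hw' with hb | hs
    · rw [hGf _ ⟨hψ.image_ball ▸ mem_image_of_mem ψ hb, hψ.ne_zero hw hw0⟩, hfψ w hb]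
    · rw [ha _ (hψ.image_sphere ▸ mem_image_of_mem ψ hs), mem_sphere_zero_iff_norm.1 hs,
        Real.log_one, mul_zero, sub_zero]
  refine ⟨a, ψ, hψ, hGψ, fun w hw hw0 => ?_⟩
  have hp0 := hψ.ne_zero hw hw0
  have hpc : ψ w ∈ closure D := by
    rw [← hψ.image_closedDisc]; exact mem_image_of_mem ψ hw
  -- At boundary points `G` coincides on the closure of `D` with `a - Φ / (2π) log ‖fe‖`, which is
  -- differentiable in a full neighbourhood.
  have hdiff : DifferentiableWithinAt ℝ G (closure D) (ψ w) := by
    have hw' := hw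
    rw [closedDisc_eq_union] at hw'
    rcases hw' with hb | hs
    · exact (hG.differentiableAt ⟨hψ.image_ball ▸ mem_image_of_mem ψ hb, hp0⟩).differentiableWithinAt
    · obtain ⟨fe, h1, h2, h3⟩ := hfe w hs
      set ge : ℂ → ℝ := fun z => a - Φ / (2 * Real.pi) * Real.log ‖fe z‖
      have hfe0 : fe (ψ w) ≠ 0 := by rw [h2]; exact hw0
      have hdw : DifferentiableAt ℝ ge (ψ w) :=
        (((hasFDerivAt_log_norm hfe0).differentiableAt.comp (ψ w)
          (h1.differentiableAt one_ne_zero)).const_mul _).const_sub _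
      have hcont : ∀ᶠ z in 𝓝 (ψ w), ContinuousAt ge z := by
        filter_upwards [eventually_continuousAt_of_contDiffAt (n := 1) (by exact_mod_cast h1),
          h1.continuousAt.eventually_ne hfe0] with z e1 e2
        exact ((e1.norm.log (norm_ne_zero_iff.2 e2)).const_mul _).const_sub _
      have hne : ∀ᶠ z in 𝓝 (ψ w), z ≠ 0 := isOpen_compl_singleton.mem_nhds hp0
      have heq : ∀ᶠ z in 𝓝[D] (ψ w), ge z = G z := by
        filter_upwards [h3, self_mem_nhdsWithin, hne.filter_mono nhdsWithin_le_nhds] with z e1 e2 e3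
        rw [hGf z ⟨e2, e3⟩, ← e1]
      have hGe : ∀ z ∈ closure D, z ≠ 0 → extendFrom D G z = G z := by
        intro z hz hz0
        refine extendFrom_eq hz ?_
        refine (hG.continuousOn z ⟨hz, hz0⟩).mono_left ?_
        rw [nhdsWithin_le_iff]
        filter_upwards [self_mem_nhdsWithin,
          mem_nhdsWithin_of_mem_nhds (isOpen_compl_singleton.mem_nhds hz0)] with y e1 e2
        exact ⟨subset_closure e1, e2⟩
      have hfin : ∀ᶠ z in 𝓝[closure D] (ψ w), G z = ge z := by
        filter_upwards [extendFrom_eventuallyEq hcont heq, self_mem_nhdsWithin,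
          hne.filter_mono nhdsWithin_le_nhds] with z e1 e2 e3
        rw [← e1, hGe z e2 e3]
      exact hdw.differentiableWithinAt.congr_of_eventuallyEq hfin (hfin.self_of_nhdsWithin hpc)
  set b := derivWithin ψ closedDisc w
  have hb0 : b ≠ 0 := hψ.deriv_ne w hw
  have hcomp := HasFDerivWithinAt.comp w hdiff.hasFDerivWithinAt
    (hasFDerivWithinAt_real (hψ.hasDerivWithinAt hw))
    (fun x hx => by rw [← hψ.image_closedDisc]; exact mem_image_of_mem ψ hx)
  -- The derivative of `G ∘ ψ` is found a second time from its explicit logarithmic form. Uniqueness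
  -- of derivatives within the closed disc then determines the gradient of `G`.
  have hlog : HasFDerivWithinAt (G ∘ ψ)
      (-((Φ / (2 * Real.pi)) • (reCLM ∘L (w⁻¹ • (1 : ℂ →L[ℝ] ℂ))))) closedDisc w := by
    have h1 := (((hasFDerivAt_log_norm hw0).const_mul (Φ / (2 * Real.pi))).const_sub a)
    refine (h1.hasFDerivWithinAt (s := closedDisc)).congr_of_eventuallyEq ?_ (hGψ w hw hw0)
    filter_upwards [self_mem_nhdsWithin,
      mem_nhdsWithin_of_mem_nhds (isOpen_compl_singleton.mem_nhds hw0)] with y e1 e2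
    exact hGψ y e1 e2
  have heq := (uniqueDiffOn_real_closedDisc w hw).eq hcomp hlog
  rw [gradientWithin, LinearIsometryEquiv.symm_apply_eq]
  ext v
  have hv := DFunLike.congr_fun heq (b⁻¹ * v)
  simp only [ContinuousLinearMap.comp_apply, smul_apply, one_apply_eq_self, smul_eq_mul,
    neg_apply, reCLM_apply] at hv
  rw [mul_inv_cancel_left₀ hb0] at hv
  rw [hv, InnerProductSpace.toDual_apply_apply, Complex.inner, conj_conj, ← re_ofReal_mul, ← neg_re]
  congr 1
  push_cast
  field_simp

/-! ### Parseval's identity and the Dirichlet energy. -/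

lemma hasSum_circle_integral {F : ℕ → ℝ → ℂ} {f : ℝ → ℂ} {M : ℕ → ℝ} (hF : ∀ n, Continuous (F n))
    (hM : Summable M) (hb : ∀ n θ, ‖F n θ‖ ≤ M n) (hs : ∀ θ, HasSum (fun n => F n θ) (f θ)) :
    HasSum (fun n => ∫ θ in (0 : ℝ)..(2 * Real.pi), F n θ)
      (∫ θ in (0 : ℝ)..(2 * Real.pi), f θ) :=
  intervalIntegral.hasSum_integral_of_dominated_convergence (fun n _ => M n)
    (fun n => (hF n).aestronglyMeasurable) (fun n => Eventually.of_forall fun θ _ => hb n θ)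
    (Eventually.of_forall fun _ _ => hM) intervalIntegrable_const
    (Eventually.of_forall fun θ _ => hs θ)

lemma integral_conj_pow_mul_pow (r : ℝ) (n m : ℕ) :
    ∫ θ in (0 : ℝ)..(2 * Real.pi), conj (circleMap 0 r θ ^ n) * circleMap 0 r θ ^ m =
      if m = n then ((2 * Real.pi * r ^ (2 * n) : ℝ) : ℂ) else 0 := by
  have h1 : ∀ θ : ℝ, conj (circleMap 0 r θ ^ n) * circleMap 0 r θ ^ m =
      (r : ℂ) ^ (n + m) * exp ((((m : ℤ) - n : ℤ) : ℂ) * I * θ) := by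
    intro θ
    simp only [circleMap, zero_add, mul_pow, map_mul, map_pow, conj_ofReal, ← exp_conj, conj_I,
      ← exp_nat_mul, map_natCast]
    have : exp ((((m : ℤ) - n : ℤ) : ℂ) * I * θ) =
        exp (n * (θ * -I)) * exp (m * (θ * I)) := by
      rw [← exp_add]
      congr 1
      push_cast
      ring
    rw [this, pow_add]
    ring
  simp_rw [h1]
  rw [intervalIntegral.integral_const_mul]
  split_ifs with hmn
  · subst hmn
    simp only [sub_self, Int.cast_zero, zero_mul, exp_zero, intervalIntegral.integral_const]
    rw [two_mul m, sub_zero, real_smul]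
    push_cast
    ring
  · have hne : (((m : ℤ) - n : ℤ) : ℂ) * I ≠ 0 := by
      refine mul_ne_zero ?_ I_ne_zero
      rw [Int.cast_ne_zero]
      omega
    rw [integral_exp_mul_complex hne]
    have : exp ((((m : ℤ) - n : ℤ) : ℂ) * I * ((2 * Real.pi : ℝ) : ℂ)) = 1 := by
      rw [← exp_int_mul_two_pi_mul_I ((m : ℤ) - n)]
      congr 1
      push_cast
      ring
    rw [this]
    simp

/-- The Parseval identity for two power series on a circle. -/
lemma hasSum_parseval {a b : ℕ → ℂ} {f g : ℂ → ℂ} {r : ℝ}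
    (hf : ∀ θ, HasSum (fun n => a n * circleMap 0 r θ ^ n) (f (circleMap 0 r θ)))
    (hg : ∀ θ, HasSum (fun n => b n * circleMap 0 r θ ^ n) (g (circleMap 0 r θ)))
    (hgc : Continuous fun θ => g (circleMap 0 r θ)) :
    HasSum (fun n => conj (a n) * b n * ((2 * Real.pi * r ^ (2 * n) : ℝ) : ℂ))
      (∫ θ in (0 : ℝ)..(2 * Real.pi), conj (f (circleMap 0 r θ)) * g (circleMap 0 r θ)) := by
  have hcp : ∀ n : ℕ, Continuous fun θ => circleMap 0 r θ ^ n := fun n =>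
    (continuous_circleMap 0 r).pow n
  have hnorm : ∀ θ n, ‖circleMap 0 r θ ^ n‖ = |r| ^ n := fun θ n => by
    rw [norm_pow, norm_circleMap_zero]
  have hsum : ∀ {a : ℕ → ℂ} {f : ℂ → ℂ}, (∀ θ, HasSum (fun n => a n * circleMap 0 r θ ^ n)
      (f (circleMap 0 r θ))) → Summable fun n => ‖a n‖ * |r| ^ n := by
    intro a f hf
    refine (hf 0).summable.norm.congr fun n => ?_
    rw [norm_mul, hnorm]
  have hinner : ∀ n : ℕ, ∫ θ in (0 : ℝ)..(2 * Real.pi),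
      conj (circleMap 0 r θ ^ n) * g (circleMap 0 r θ) =
      b n * ((2 * Real.pi * r ^ (2 * n) : ℝ) : ℂ) := by
    intro n
    have h1 := hasSum_circle_integral
      (F := fun m θ => conj (circleMap 0 r θ ^ n) * (b m * circleMap 0 r θ ^ m))
      (f := fun θ => conj (circleMap 0 r θ ^ n) * g (circleMap 0 r θ))
      (M := fun m => |r| ^ n * (‖b m‖ * |r| ^ m))
      (fun m => (continuous_conj.comp (hcp n)).mul (continuous_const.mul (hcp m)))
      ((hsum hg).mul_left _) (fun m θ => by
        rw [norm_mul, norm_conj, norm_mul, hnorm, hnorm]) (fun θ => (hg θ).mul_left _)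
    have h2 : ∀ m : ℕ, ∫ θ in (0 : ℝ)..(2 * Real.pi),
        conj (circleMap 0 r θ ^ n) * (b m * circleMap 0 r θ ^ m) =
        if m = n then b n * ((2 * Real.pi * r ^ (2 * n) : ℝ) : ℂ) else 0 := by
      intro m
      simp_rw [mul_left_comm]
      rw [intervalIntegral.integral_const_mul, integral_conj_pow_mul_pow]
      split_ifs with h
      · rw [h]
      · rw [mul_zero]
    simp_rw [h2] at h1
    exact h1.unique (hasSum_ite_eq n _)
  obtain ⟨C, hC⟩ : ∃ C, ∀ θ, ‖g (circleMap 0 r θ)‖ ≤ C := by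
    have hper : Function.Periodic (fun θ => g (circleMap 0 r θ)) (2 * Real.pi) :=
      fun θ => by simp only [periodic_circleMap 0 r θ]
    obtain ⟨C, hC⟩ := hper.isBounded_of_continuous Real.two_pi_pos.ne' hgc |>.exists_norm_le
    exact ⟨C, fun θ => hC _ (mem_range_self θ)⟩
  have h1 := hasSum_circle_integral
    (F := fun n θ => conj (a n * circleMap 0 r θ ^ n) * g (circleMap 0 r θ))
    (f := fun θ => conj (f (circleMap 0 r θ)) * g (circleMap 0 r θ))
    (M := fun n => ‖a n‖ * |r| ^ n * C)
    (fun n => (continuous_conj.comp (continuous_const.mul (hcp n))).mul hgc)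
    ((hsum hf).mul_right _) (fun n θ => by
      rw [norm_mul, norm_conj, norm_mul, hnorm]
      gcongr
      exact hC θ) (fun θ => (hasSum_conj'.2 (hf θ)).mul_right _)
  refine h1.congr_fun ?_
  intro n
  have h2 : ∀ θ, conj (a n * circleMap 0 r θ ^ n) * g (circleMap 0 r θ) =
      conj (a n) * (conj (circleMap 0 r θ ^ n) * g (circleMap 0 r θ)) := fun θ => by
    rw [map_mul, mul_assoc]
  simp_rw [h2]
  rw [intervalIntegral.integral_const_mul, hinner, mul_assoc]

/-- The Taylor coefficients of `f` at the origin. -/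
def taylorCoeff (f : ℂ → ℂ) (n : ℕ) : ℂ := (n.factorial : ℂ)⁻¹ * iteratedDeriv n f 0

section Dirichlet

variable {h : ℂ → ℂ}

lemma hasSum_taylorCoeff (hd : DifferentiableOn ℂ h (Metric.ball 0 1)) {z : ℂ}
    (hz : z ∈ Metric.ball (0 : ℂ) 1) : HasSum (fun n => taylorCoeff h n * z ^ n) (h z) := by
  have := hasSum_taylorSeries_on_ball hd hz
  refine this.congr_fun fun n => ?_
  simp only [taylorCoeff, smul_eq_mul, sub_zero]
  ring

lemma hasSum_mul_deriv (hd : DifferentiableOn ℂ h (Metric.ball 0 1)) {z : ℂ}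
    (hz : z ∈ Metric.ball (0 : ℂ) 1) :
    HasSum (fun n => n * taylorCoeff h n * z ^ n) (z * deriv h z) := by
  have h1 := (hasSum_taylorCoeff (hd.deriv Metric.isOpen_ball) hz).mul_left z
  rw [← add_zero (z * deriv h z)]
  have h2 := (hasSum_nat_add_iff (f := fun n : ℕ => n * taylorCoeff h n * z ^ n) (g := z * deriv h z)
    1).1 (h1.congr_fun fun n => by
      simp only [taylorCoeff, iteratedDeriv_succ']
      rw [Nat.factorial_succ]
      push_cast
      have : (n : ℂ) + 1 ≠ 0 := by exact_mod_cast Nat.succ_ne_zero n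
      field_simp
      ring)
  simpa using h2

lemma hasSum_dirichlet (hd : DifferentiableOn ℂ h (Metric.ball 0 1)) {r : ℝ} (hr : r ∈ Ico 0 1) :
    HasSum (fun n : ℕ => n * ‖taylorCoeff h n‖ ^ 2 * (2 * Real.pi * r ^ (2 * n)))
      (∫ θ in (0 : ℝ)..(2 * Real.pi), (conj (h (circleMap 0 r θ)) *
        (circleMap 0 r θ * deriv h (circleMap 0 r θ))).re) := by
  have hmem : ∀ θ, circleMap 0 r θ ∈ Metric.ball (0 : ℂ) 1 := fun θ => by
    rw [mem_ball_zero_iff, norm_circleMap_zero, abs_of_nonneg hr.1]; exact hr.2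
  have hc := continuous_circleMap 0 r
  have hc1 : Continuous fun θ => h (circleMap 0 r θ) := hd.continuousOn.comp_continuous hc hmem
  have hc2 : Continuous fun θ => deriv h (circleMap 0 r θ) :=
    (hd.deriv Metric.isOpen_ball).continuousOn.comp_continuous hc hmem
  have h1 := hasSum_parseval (f := h) (g := fun z => z * deriv h z) (r := r)
    (fun θ => hasSum_taylorCoeff hd (hmem θ)) (fun θ => hasSum_mul_deriv hd (hmem θ)) (hc.mul hc2)
  have h2 := reCLM.hasSum h1
  have h3 : ∫ θ in (0 : ℝ)..(2 * Real.pi), (conj (h (circleMap 0 r θ)) *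
        (circleMap 0 r θ * deriv h (circleMap 0 r θ))).re = (∫ θ in (0 : ℝ)..(2 * Real.pi),
        conj (h (circleMap 0 r θ)) * (circleMap 0 r θ * deriv h (circleMap 0 r θ))).re :=
    ContinuousLinearMap.intervalIntegral_comp_comm reCLM
      (((continuous_conj.comp hc1).mul (hc.mul hc2)).intervalIntegrable 0 (2 * Real.pi))
  simp only [reCLM_apply] at h2
  rw [← h3] at h2
  refine h2.congr_fun fun n => ?_
  have : conj (taylorCoeff h n) * (n * taylorCoeff h n) * ((2 * Real.pi * r ^ (2 * n) : ℝ) : ℂ) =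
      ((n * ‖taylorCoeff h n‖ ^ 2 * (2 * Real.pi * r ^ (2 * n)) : ℝ) : ℂ) := by
    push_cast
    rw [← conj_mul']
    ring
  rw [this, ofReal_re]

/-- The Dirichlet energy of `h`, as an integral over the unit circle. -/
def energy (h : ℂ → ℂ) : ℝ := ∫ θ in (0 : ℝ)..(2 * Real.pi),
  (conj (h (circleMap 0 1 θ)) * (circleMap 0 1 θ * derivWithin h closedDisc (circleMap 0 1 θ))).re

lemma circleMap_mem_closedDisc {r : ℝ} (hr : r ∈ Icc 0 1) (θ : ℝ) : circleMap 0 r θ ∈ closedDisc := by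
  rw [mem_closedBall_zero_iff, norm_circleMap_zero, abs_of_nonneg hr.1]; exact hr.2

lemma circleMap_one_mem (θ : ℝ) : circleMap 0 1 θ ∈ closedDisc :=
  circleMap_mem_closedDisc ⟨zero_le_one, le_rfl⟩ θ

lemma tendsto_circle_integral {F : ℂ → ℝ} (hF : ContinuousOn F closedDisc) :
    Tendsto (fun r => ∫ θ in (0 : ℝ)..(2 * Real.pi), F (circleMap 0 r θ)) (𝓝[<] 1)
      (𝓝 (∫ θ in (0 : ℝ)..(2 * Real.pi), F (circleMap 0 1 θ))) := by
  -- Clamping the radius to `[0, 1]` makes the integrand jointly continuous for all radii, as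
  -- continuity of parametric integrals requires.
  set p : ℝ → ℝ := fun r => (projIcc (0 : ℝ) 1 zero_le_one r : ℝ)
  have hp : Continuous p := continuous_subtype_val.comp continuous_projIcc
  have hc : Continuous (Function.uncurry fun r θ => F (circleMap 0 (p r) θ)) := by
    refine hF.comp_continuous ?_ fun x => circleMap_mem_closedDisc (projIcc 0 1 _ x.1).2 x.2
    simp only [circleMap]
    have : Continuous fun x : ℝ × ℝ => (p x.1 : ℂ) :=
      continuous_ofReal.comp (hp.comp continuous_fst)
    fun_prop
  have h1 := (intervalIntegral.continuous_parametric_intervalIntegral_of_continuous' (μ := volume)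
    hc 0 (2 * Real.pi)).tendsto 1
  have hp1 : p 1 = 1 := by simp [p]
  rw [hp1] at h1
  refine (h1.mono_left nhdsWithin_le_nhds).congr' ?_
  filter_upwards [Ioo_mem_nhdsLT (zero_lt_one (α := ℝ))] with r hr
  have : p r = r := by simp [p, projIcc_of_mem zero_le_one ⟨hr.1.le, hr.2.le⟩]
  rw [this]

lemma derivWithin_eq_deriv {w : ℂ} (hw : w ∈ Metric.ball (0 : ℂ) 1) :
    derivWithin h closedDisc w = deriv h w :=
  derivWithin_of_mem_nhds
    (mem_of_superset (Metric.isOpen_ball.mem_nhds hw) Metric.ball_subset_closedBall)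

/-- On a circle of radius `r < 1` the energy is a series of nonnegative terms, so it dominates each
of them; then `r → 1`. One coefficient at a time suffices, so no convergence on the unit circle
itself is needed. -/
lemma energy_ge (hh : ContDiffOn ℂ ∞ h closedDisc) (n : ℕ) :
    n * ‖taylorCoeff h n‖ ^ 2 * (2 * Real.pi) ≤ energy h := by
  have hd : DifferentiableOn ℂ h (Metric.ball 0 1) :=
    (hh.differentiableOn (by simp)).mono Metric.ball_subset_closedBall
  have hc : ContinuousOn (derivWithin h closedDisc) closedDisc :=
    (hh.derivWithin uniqueDiffOn_closedDisc (m := ∞) (by simp)).continuousOn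
  have hlim := tendsto_circle_integral
    (F := fun w => (conj (h w) * (w * derivWithin h closedDisc w)).re)
    (continuous_re.comp_continuousOn ((continuous_conj.comp_continuousOn hh.continuousOn).mul
      (continuousOn_id.mul hc)))
  have hlim2 : Tendsto (fun r : ℝ => n * ‖taylorCoeff h n‖ ^ 2 * (2 * Real.pi * r ^ (2 * n))) (𝓝[<] 1)
      (𝓝 (n * ‖taylorCoeff h n‖ ^ 2 * (2 * Real.pi * 1 ^ (2 * n)))) := by
    have : Continuous fun r : ℝ => n * ‖taylorCoeff h n‖ ^ 2 * (2 * Real.pi * r ^ (2 * n)) := by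
      fun_prop
    exact (this.tendsto 1).mono_left nhdsWithin_le_nhds
  rw [one_pow, mul_one] at hlim2
  refine le_of_tendsto_of_tendsto hlim2 hlim ?_
  filter_upwards [Ioo_mem_nhdsLT (zero_lt_one (α := ℝ))] with r hr
  have hs := hasSum_dirichlet hd ⟨hr.1.le, hr.2⟩
  have hr0 := hr.1.le
  have hle := le_hasSum hs n (fun j _ => by positivity)
  refine hle.trans (le_of_eq ?_)
  congr 1
  ext θ
  rw [derivWithin_eq_deriv]
  rw [mem_ball_zero_iff, norm_circleMap_zero, abs_of_pos hr.1]
  exact hr.2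

lemma energy_nonneg (hh : ContDiffOn ℂ ∞ h closedDisc) : 0 ≤ energy h := by
  have := energy_ge hh 0
  simpa using this

lemma eq_const_of_energy_eq_zero (hh : ContDiffOn ℂ ∞ h closedDisc) (h0 : energy h = 0) :
    ∀ w ∈ closedDisc, h w = h 0 := by
  have hd : DifferentiableOn ℂ h (Metric.ball 0 1) :=
    (hh.differentiableOn (by simp)).mono Metric.ball_subset_closedBall
  have hco : ∀ n : ℕ, n ≠ 0 → taylorCoeff h n = 0 := by
    intro n hn
    have h1 := energy_ge hh n
    rw [h0] at h1
    have hn' : (0 : ℝ) < n := by exact_mod_cast Nat.pos_of_ne_zero hn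
    by_contra hne
    have : 0 < ‖taylorCoeff h n‖ := norm_pos_iff.2 hne
    have : 0 < n * ‖taylorCoeff h n‖ ^ 2 * (2 * Real.pi) := by positivity
    linarith
  have hball : EqOn h (fun _ => h 0) (Metric.ball 0 1) := by
    intro w hw
    have h1 := hasSum_taylorCoeff hd hw
    have h2 : HasSum (fun n => taylorCoeff h n * w ^ n) (taylorCoeff h 0 * w ^ 0) :=
      hasSum_single 0 fun n hn => by rw [hco n hn, zero_mul]
    rw [h1.unique h2]
    simp [taylorCoeff]
  exact hball.of_subset_closure hh.continuousOn continuousOn_const Metric.ball_subset_closedBall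
    closedDisc_subset_closure

/-- The mean value property on the closed disc. -/
lemma integral_circle_eq (hh : ContDiffOn ℂ ∞ h closedDisc) :
    ∫ θ in (0 : ℝ)..(2 * Real.pi), h (circleMap 0 1 θ) = (2 * Real.pi : ℝ) * h 0 := by
  have hcl : DiffContOnCl ℂ h (Metric.ball 0 |1|) := by
    rw [abs_one]
    refine ⟨(hh.differentiableOn (by simp)).mono Metric.ball_subset_closedBall, ?_⟩
    rw [closure_ball _ one_ne_zero]
    exact hh.continuousOn
  have := hcl.circleAverage
  rw [Real.circleAverage_def] at this
  rw [← this, real_smul, ← mul_assoc, ← ofReal_mul, mul_inv_cancel₀ (by positivity)]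
  simp

end Dirichlet

/-! ### Calculus on the closed disc and the nonnegative boundary integrals. -/

/-- The derivative on the closed unit disc. -/
abbrev discDeriv (h : ℂ → ℂ) : ℂ → ℂ := derivWithin h closedDisc

/-- The angular derivative `w dh/dw`. -/
def angDeriv (h : ℂ → ℂ) (w : ℂ) : ℂ := w * discDeriv h w

section DiscCalculus

variable {h : ℂ → ℂ}

lemma contDiffOn_discDeriv (hh : ContDiffOn ℂ ∞ h closedDisc) :
    ContDiffOn ℂ ∞ (discDeriv h) closedDisc :=
  hh.derivWithin uniqueDiffOn_closedDisc (by simp)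

lemma contDiffOn_angDeriv (hh : ContDiffOn ℂ ∞ h closedDisc) :
    ContDiffOn ℂ ∞ (angDeriv h) closedDisc := contDiffOn_id.mul (contDiffOn_discDeriv hh)

lemma hasDerivWithinAt_discDeriv (hh : ContDiffOn ℂ ∞ h closedDisc) {w : ℂ} (hw : w ∈ closedDisc) :
    HasDerivWithinAt h (discDeriv h w) closedDisc w :=
  ((hh.differentiableOn (by simp)) w hw).hasDerivWithinAt

lemma discDeriv_eq {b w : ℂ} (hw : w ∈ closedDisc) (hd : HasDerivWithinAt h b closedDisc w) :
    discDeriv h w = b := hd.derivWithin (uniqueDiffOn_closedDisc w hw)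

lemma discDeriv_eq_zero_of_const {a : ℂ} (hc : ∀ w ∈ closedDisc, h w = a) {w : ℂ}
    (hw : w ∈ closedDisc) : discDeriv h w = 0 :=
  discDeriv_eq hw ((hasDerivWithinAt_const w closedDisc a).congr hc (hc w hw))

lemma continuous_comp_circleMap {Y : Type*} [TopologicalSpace Y] {F : ℂ → Y}
    (hF : ContinuousOn F closedDisc) : Continuous fun θ => F (circleMap 0 1 θ) :=
  hF.comp_continuous (continuous_circleMap 0 1) circleMap_one_mem

lemma eq_of_discDeriv_eq_zero (hd : ∀ w ∈ closedDisc, HasDerivWithinAt h 0 closedDisc w) :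
    ∀ w ∈ closedDisc, h w = h 0 := by
  intro w hw
  have := (convex_closedBall (0 : ℂ) 1).norm_image_sub_le_of_norm_hasDerivWithin_le (C := 0) hd
    (fun x _ => by simp) (Metric.mem_closedBall_self zero_le_one) hw
  rw [zero_mul, norm_le_zero_iff, sub_eq_zero] at this
  exact this

/-- A nonvanishing smooth holomorphic function on the closed disc has a logarithm. -/
lemma exists_log (hh : ContDiffOn ℂ ∞ h closedDisc) (h0 : ∀ w ∈ closedDisc, h w ≠ 0) :
    ∃ l : ℂ → ℂ, ContDiffOn ℂ ∞ l closedDisc ∧ ∀ w ∈ closedDisc, exp (l w) = h w := by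
  set j : ℂ → ℂ := fun w => discDeriv h w / h w
  have hj : ContDiffOn ℂ ∞ j closedDisc := (contDiffOn_discDeriv hh).div hh h0
  obtain ⟨g, hg⟩ := (convex_closedBall (0 : ℂ) 1).exists_forall_hasDerivWithinAt
    (hj.differentiableOn (by simp))
  have hgs : ContDiffOn ℂ ∞ g closedDisc := by
    rw [contDiffOn_infty_iff_derivWithin uniqueDiffOn_closedDisc]
    exact ⟨fun w hw => (hg w hw).differentiableWithinAt, hj.congr fun w hw =>
      discDeriv_eq hw (hg w hw)⟩
  have hmem : (0 : ℂ) ∈ closedDisc := Metric.mem_closedBall_self zero_le_one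
  have hconst := eq_of_discDeriv_eq_zero (h := fun w => exp (g w) / h w) (fun w hw => by
    have := (hg w hw).cexp.div (hasDerivWithinAt_discDeriv hh hw) (h0 w hw)
    refine this.congr_deriv ?_
    have := h0 w hw
    simp only [j]
    field_simp
    ring)
  refine ⟨fun w => g w - g 0 + log (h 0), (hgs.sub contDiffOn_const).add contDiffOn_const,
    fun w hw => ?_⟩
  have h1 := hconst w hw
  rw [exp_add, exp_sub, exp_log (h0 0 hmem)]
  have h2 := h0 0 hmem
  have h3 := h0 w hw
  have h4 := exp_ne_zero (g 0)
  field_simp at h1 ⊢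
  exact h1

lemma integral_mul_angDeriv (hh : ContDiffOn ℂ ∞ h closedDisc) :
    ∫ θ in (0 : ℝ)..(2 * Real.pi), h (circleMap 0 1 θ) * angDeriv h (circleMap 0 1 θ) = 0 := by
  rw [integral_circle_eq (h := fun w => h w * angDeriv h w) (hh.mul (contDiffOn_angDeriv hh))]
  simp [angDeriv]

lemma integral_re_angDeriv (hh : ContDiffOn ℂ ∞ h closedDisc) :
    ∫ θ in (0 : ℝ)..(2 * Real.pi), (angDeriv h (circleMap 0 1 θ)).re = 0 := by
  have h1 := integral_circle_eq (contDiffOn_angDeriv hh)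
  have h2 := ContinuousLinearMap.intervalIntegral_comp_comm (a := 0) (b := 2 * Real.pi)
    (μ := volume) reCLM
    ((continuous_comp_circleMap (contDiffOn_angDeriv hh).continuousOn).intervalIntegrable _ _)
  rw [h1] at h2
  simpa [angDeriv] using h2

/-- By the mean value property `∫ h * angDeriv h = 0`, whose real part says that the two integrals
are equal. Their sum is the energy. -/
lemma integral_re_mul_re (hh : ContDiffOn ℂ ∞ h closedDisc) :
    ∫ θ in (0 : ℝ)..(2 * Real.pi), (angDeriv h (circleMap 0 1 θ)).re * (h (circleMap 0 1 θ)).re =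
      energy h / 2 ∧
    ∫ θ in (0 : ℝ)..(2 * Real.pi), (angDeriv h (circleMap 0 1 θ)).im * (h (circleMap 0 1 θ)).im =
      energy h / 2 := by
  have hc1 := continuous_comp_circleMap hh.continuousOn
  have hc2 := continuous_comp_circleMap (contDiffOn_angDeriv hh).continuousOn
  have h2 := ContinuousLinearMap.intervalIntegral_comp_comm (a := 0) (b := 2 * Real.pi)
    (μ := volume) reCLM ((hc1.mul hc2).intervalIntegrable 0 (2 * Real.pi))
  simp only [Pi.mul_apply] at h2
  rw [integral_mul_angDeriv hh] at h2
  simp only [reCLM_apply, mul_re, zero_re] at h2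
  have i1 : IntervalIntegrable (fun θ : ℝ => (angDeriv h (circleMap 0 1 θ)).re *
      (h (circleMap 0 1 θ)).re) volume 0 (2 * Real.pi) :=
    ((continuous_re.comp hc2).mul (continuous_re.comp hc1)).intervalIntegrable _ _
  have i2 : IntervalIntegrable (fun θ : ℝ => (angDeriv h (circleMap 0 1 θ)).im *
      (h (circleMap 0 1 θ)).im) volume 0 (2 * Real.pi) :=
    ((continuous_im.comp hc2).mul (continuous_im.comp hc1)).intervalIntegrable _ _
  have e1 : energy h = (∫ θ in (0 : ℝ)..(2 * Real.pi),
      (angDeriv h (circleMap 0 1 θ)).re * (h (circleMap 0 1 θ)).re) +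
      ∫ θ in (0 : ℝ)..(2 * Real.pi),
      (angDeriv h (circleMap 0 1 θ)).im * (h (circleMap 0 1 θ)).im := by
    rw [← intervalIntegral.integral_add i1 i2, energy]
    congr 1
    ext θ
    have : ∀ a b : ℂ, (conj a * b).re = b.re * a.re + b.im * a.im := fun a b => by
      simp only [mul_re, conj_re, conj_im]; ring
    exact this _ _
  have e2 : (∫ θ in (0 : ℝ)..(2 * Real.pi),
      (angDeriv h (circleMap 0 1 θ)).re * (h (circleMap 0 1 θ)).re) -
      ∫ θ in (0 : ℝ)..(2 * Real.pi),
      (angDeriv h (circleMap 0 1 θ)).im * (h (circleMap 0 1 θ)).im = 0 := by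
    rw [← intervalIntegral.integral_sub i1 i2, ← h2]
    congr 1
    ext θ
    ring
  constructor <;> linarith

end DiscCalculus

section Inequalities

variable {l : ℂ → ℂ}

lemma discDeriv_exp_smul (hl : ContDiffOn ℂ ∞ l closedDisc) (s : ℝ) {w : ℂ} (hw : w ∈ closedDisc) :
    discDeriv (fun w => exp (s * l w)) w = exp (s * l w) * (s * discDeriv l w) :=
  discDeriv_eq hw ((hasDerivWithinAt_discDeriv hl hw).const_mul (s : ℂ)).cexp

lemma contDiffOn_exp_smul (hl : ContDiffOn ℂ ∞ l closedDisc) (s : ℝ) :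
    ContDiffOn ℂ ∞ (fun w => exp (s * l w)) closedDisc := (contDiffOn_const.mul hl).cexp

/-- The derivative of `exp (s l)` reproduces the exponential, and `conj (exp (s l)) * exp (s l)` is
the real weight `exp (2 s Re l)`. -/
lemma energy_exp_smul (hl : ContDiffOn ℂ ∞ l closedDisc) (s : ℝ) :
    energy (fun w => exp (s * l w)) = s * ∫ θ in (0 : ℝ)..(2 * Real.pi),
      (angDeriv l (circleMap 0 1 θ)).re * Real.exp (2 * s * (l (circleMap 0 1 θ)).re) := by
  rw [energy, ← intervalIntegral.integral_const_mul]
  congr 1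
  ext θ
  have hw := circleMap_one_mem θ
  set w := circleMap 0 1 θ
  have h1 : derivWithin (fun w => exp (s * l w)) closedDisc w = _ := discDeriv_exp_smul hl s hw
  rw [h1]
  have h2 : conj (exp (s * l w)) * (w * (exp (s * l w) * (s * discDeriv l w))) =
      ((‖exp (s * l w)‖ ^ 2 * s : ℝ) : ℂ) * angDeriv l w := by
    rw [angDeriv]
    push_cast
    rw [← conj_mul']
    ring
  rw [h2, re_ofReal_mul, norm_exp, re_ofReal_mul, ← Real.exp_nat_mul]
  push_cast
  rw [show (2 : ℝ) * (s * (l w).re) = 2 * s * (l w).re by ring]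
  ring

lemma integral_angDeriv_mul_exp (hl : ContDiffOn ℂ ∞ l closedDisc) {s : ℝ} (hs : 0 < s) :
    0 ≤ ∫ θ in (0 : ℝ)..(2 * Real.pi),
      (angDeriv l (circleMap 0 1 θ)).re * Real.exp (2 * s * (l (circleMap 0 1 θ)).re) ∧
    (∫ θ in (0 : ℝ)..(2 * Real.pi),
      (angDeriv l (circleMap 0 1 θ)).re * Real.exp (2 * s * (l (circleMap 0 1 θ)).re) = 0 ↔
      ∀ w ∈ closedDisc, discDeriv l w = 0) := by
  have h1 := energy_exp_smul hl s
  have h2 := energy_nonneg (contDiffOn_exp_smul hl s)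
  rw [h1] at h2
  refine ⟨nonneg_of_mul_nonneg_right h2 hs, fun h0 w hw => ?_, fun h0 => ?_⟩
  · rw [h0, mul_zero] at h1
    have h3 := discDeriv_eq_zero_of_const (eq_const_of_energy_eq_zero (contDiffOn_exp_smul hl s) h1)
      hw
    rw [discDeriv_exp_smul hl s hw] at h3
    have hs' : (s : ℂ) ≠ 0 := by exact_mod_cast hs.ne'
    exact ((mul_eq_zero.1 ((mul_eq_zero.1 h3).resolve_left (exp_ne_zero _))).resolve_left hs')
  · simp only [angDeriv, h0 _ (circleMap_one_mem _), mul_zero, zero_re, zero_mul,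
      intervalIntegral.integral_zero]

lemma integral_angDeriv_mul_log (hl : ContDiffOn ℂ ∞ l closedDisc) :
    0 ≤ ∫ θ in (0 : ℝ)..(2 * Real.pi),
      (angDeriv l (circleMap 0 1 θ)).re * (l (circleMap 0 1 θ)).re ∧
    (∫ θ in (0 : ℝ)..(2 * Real.pi),
      (angDeriv l (circleMap 0 1 θ)).re * (l (circleMap 0 1 θ)).re = 0 ↔
      ∀ w ∈ closedDisc, discDeriv l w = 0) := by
  have h1 := energy_nonneg hl
  rw [(integral_re_mul_re hl).1]
  refine ⟨by positivity, fun h0 w hw => ?_, fun h0 => ?_⟩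
  · exact discDeriv_eq_zero_of_const (eq_const_of_energy_eq_zero hl (by linarith)) hw
  · rw [← (integral_re_mul_re hl).1]
    simp only [angDeriv, h0 _ (circleMap_one_mem _), mul_zero, zero_re, zero_mul,
      intervalIntegral.integral_zero]

/-- Half the energy of `angDeriv l`. If it vanishes, `w l'` is constant and equal to its value `0`
at the origin, so `l' = 0` off the origin and then everywhere by continuity. -/
lemma integral_im_angDeriv_mul (hl : ContDiffOn ℂ ∞ l closedDisc) :
    0 ≤ ∫ θ in (0 : ℝ)..(2 * Real.pi),
      (angDeriv (angDeriv l) (circleMap 0 1 θ)).im * (angDeriv l (circleMap 0 1 θ)).im ∧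
    (∫ θ in (0 : ℝ)..(2 * Real.pi),
      (angDeriv (angDeriv l) (circleMap 0 1 θ)).im * (angDeriv l (circleMap 0 1 θ)).im = 0 ↔
      ∀ w ∈ closedDisc, discDeriv l w = 0) := by
  have hk := contDiffOn_angDeriv hl
  have h1 := energy_nonneg hk
  rw [(integral_re_mul_re hk).2]
  refine ⟨by positivity, fun h0 => ?_, fun h0 => ?_⟩
  · have h2 := eq_const_of_energy_eq_zero hk (by linarith)
    have h3 : EqOn (discDeriv l) (fun _ => 0) (closedDisc \ {0}) := by
      intro w hw
      have h4 := h2 w hw.1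
      simp only [angDeriv, zero_mul] at h4
      exact (mul_eq_zero.1 h4).resolve_left hw.2
    have h5 : EqOn (discDeriv l) (fun _ => 0) closedDisc := by
      refine h3.of_subset_closure (contDiffOn_discDeriv hl).continuousOn continuousOn_const
        sdiff_subset fun w hw => ?_
      by_cases hw0 : w = 0
      · subst hw0
        have h6 : (0 : ℂ) ∈ closure ({0}ᶜ : Set ℂ) := by
          rw [closure_compl_singleton]; exact mem_univ _
        rw [mem_closure_iff_frequently]
        refine Frequently.mono ?_ fun z (hz : z ∈ ({0}ᶜ : Set ℂ) ∩ closedDisc) => ⟨hz.2, hz.1⟩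
        refine ((mem_closure_iff_frequently.1 h6).and_eventually
          (Metric.closedBall_mem_nhds (0 : ℂ) one_pos))
      · exact subset_closure ⟨hw, hw0⟩
    exact h5
  · rw [← (integral_re_mul_re hk).2]
    simp only [angDeriv, h0 _ (circleMap_one_mem _), mul_zero, zero_im,
      intervalIntegral.integral_zero]

end Inequalities

/-! ### Angle functions and parametrizations of level curves. -/

section Curves

variable {h : ℂ → ℂ} {γ : ℝ → ℂ}

lemma hasDerivAt_comp_curve (hh : ContDiffOn ℂ ∞ h closedDisc) (hγ : ∀ t, γ t ∈ closedDisc) {t : ℝ}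
    {γ' : ℂ} (hd : HasDerivAt γ γ' t) :
    HasDerivAt (fun t => h (γ t)) (discDeriv h (γ t) * γ') t := by
  have h1 := hasFDerivWithinAt_real (hasDerivWithinAt_discDeriv hh (hγ t))
  have h2 := h1.comp_hasDerivAt t hd (Eventually.of_forall hγ)
  refine h2.congr_deriv ?_
  simp

lemma contDiff_comp_curve {n : WithTop ℕ∞} (hn : n ≤ ∞) (hh : ContDiffOn ℂ ∞ h closedDisc)
    (hγ : ∀ t, γ t ∈ closedDisc) (hd : ContDiff ℝ n γ) : ContDiff ℝ n fun t => h (γ t) :=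
  ((hh.restrict_scalars ℝ).of_le hn).comp_contDiff hd hγ

lemma hasDerivAt_circleMap_comp {θ : ℝ → ℝ} {θ' t : ℝ} (hθ : HasDerivAt θ θ' t) :
    HasDerivAt (fun t => circleMap 0 1 (θ t)) (circleMap 0 1 (θ t) * (I * θ')) t := by
  have := (hasDerivAt_circleMap 0 1 (θ t)).scomp t hθ
  refine this.congr_deriv ?_
  rw [real_smul]
  ring

lemma hasDerivAt_comp_angle (hh : ContDiffOn ℂ ∞ h closedDisc) {θ : ℝ → ℝ} {θ' t : ℝ}
    (hθ : HasDerivAt θ θ' t) :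
    HasDerivAt (fun t => h (circleMap 0 1 (θ t))) (angDeriv h (circleMap 0 1 (θ t)) * (I * θ')) t := by
  refine (hasDerivAt_comp_curve hh (fun t => circleMap_one_mem (θ t))
    (hasDerivAt_circleMap_comp hθ)).congr_deriv ?_
  rw [angDeriv]
  ring

lemma contDiff_circleMap_comp {θ : ℝ → ℝ} (hθ : ContDiff ℝ ∞ θ) :
    ContDiff ℝ ∞ fun t => circleMap 0 1 (θ t) := (contDiff_circleMap 0 1).comp hθ

lemma periodic_comp_circleMap {Y : Type*} (F : ℂ → Y) :
    Function.Periodic (fun θ => F (circleMap 0 1 θ)) (2 * Real.pi) :=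
  fun θ => by simp only [periodic_circleMap 0 1 θ]

/-- Lift of a smooth curve in the unit circle. -/
lemma exists_angle {w : ℝ → ℂ} (hw : ContDiff ℝ ∞ w) (h1 : ∀ t, ‖w t‖ = 1) :
    ∃ θ : ℝ → ℝ, ContDiff ℝ ∞ θ ∧ ∀ t, w t = circleMap 0 1 (θ t) := by
  have hwd : ∀ t, HasDerivAt w (deriv w t) t := fun t =>
    ((hw.differentiable (by simp)) t).hasDerivAt
  have hdw : ContDiff ℝ ∞ (deriv w) := (contDiff_infty_iff_deriv.1 hw).2
  have hcw : ContDiff ℝ ∞ fun t => conj (w t) := conjCLE.contDiff.comp hw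
  set φ : ℝ → ℝ := fun t => (deriv w t * conj (w t)).im
  -- `φ` is the angular velocity: on the unit circle `w' = I φ w`, so integrating `φ` gives the
  -- angle.
  have hφ : ContDiff ℝ ∞ φ := imCLM.contDiff.comp (hdw.mul hcw)
  have hre : ∀ t, (deriv w t * conj (w t)).re = 0 := by
    intro t
    have e1 : HasDerivAt (fun t => normSq (w t)) (2 * (deriv w t * conj (w t)).re) t := by
      have a1 : HasDerivAt (fun t => (w t).re) (deriv w t).re t :=
        reCLM.hasFDerivAt.comp_hasDerivAt t (hwd t)
      have a2 : HasDerivAt (fun t => (w t).im) (deriv w t).im t :=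
        imCLM.hasFDerivAt.comp_hasDerivAt t (hwd t)
      have := (a1.mul a1).add (a2.mul a2)
      refine HasDerivAt.congr_deriv (this.congr_of_eventuallyEq
        (Eventually.of_forall fun t => normSq_apply (w t))) ?_
      simp only [mul_re, conj_re, conj_im]
      ring
    have e2 : (fun t => normSq (w t)) = fun _ => (1 : ℝ) := by
      ext t
      rw [normSq_eq_norm_sq, h1, one_pow]
    rw [e2] at e1
    have := e1.unique (hasDerivAt_const t (1 : ℝ))
    linarith
  have hwφ : ∀ t, deriv w t = I * φ t * w t := by
    intro t
    have e1 : deriv w t * conj (w t) = I * φ t := by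
      apply Complex.ext
      · rw [hre]; simp
      · simp [φ]
    have e2 : conj (w t) * w t = 1 := by rw [conj_mul', h1]; simp
    rw [← e1, mul_assoc, e2, mul_one]
  set θ : ℝ → ℝ := fun t => (w 0).arg + ∫ s in (0 : ℝ)..t, φ s
  have hθd : ∀ t, HasDerivAt θ (φ t) t := fun t =>
    (hφ.continuous.integral_hasStrictDerivAt 0 t).hasDerivAt.const_add _
  have hθs : ContDiff ℝ ∞ θ := by
    rw [contDiff_infty_iff_deriv]
    refine ⟨fun t => (hθd t).differentiableAt, ?_⟩
    rw [show deriv θ = φ from funext fun t => (hθd t).deriv]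
    exact hφ
  refine ⟨θ, hθs, ?_⟩
  have hconst : ∀ t, HasDerivAt (fun t => w t * circleMap 0 1 (-θ t)) 0 t := by
    intro t
    have := (hwd t).mul (hasDerivAt_circleMap_comp (hθd t).neg)
    refine this.congr_deriv ?_
    rw [hwφ t]
    push_cast
    ring
  have hcm : ∀ x : ℝ, circleMap 0 1 (-x) * circleMap 0 1 x = 1 := fun x => by
    simp only [circleMap, zero_add, ofReal_one, one_mul, ← exp_add]
    push_cast
    rw [← add_mul, neg_add_cancel, zero_mul, exp_zero]
  intro t
  have e1 := is_const_of_deriv_eq_zero (fun t => (hconst t).differentiableAt)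
    (fun t => (hconst t).deriv) t 0
  have hθ0 : θ 0 = (w 0).arg := by simp [θ]
  have hw0 : w 0 = circleMap 0 1 (θ 0) := by
    rw [hθ0]
    have := norm_mul_exp_arg_mul_I (w 0)
    rw [h1, ofReal_one, one_mul] at this
    rw [circleMap, zero_add, ofReal_one, one_mul, this]
  rw [hw0, mul_comm (circleMap 0 1 (θ 0)), hcm] at e1
  calc w t = w t * (circleMap 0 1 (-θ t) * circleMap 0 1 (θ t)) := by rw [hcm, mul_one]
    _ = circleMap 0 1 (θ t) := by rw [← mul_assoc, e1, one_mul]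

/-- The increment of a monotone angle over a closed curve is a positive number of turns. More than
one turn would pass through the starting point at an intermediate time, against injectivity. -/
lemma angle_total {θ : ℝ → ℝ} {σ : ℝ} (hσ : σ = 1 ∨ σ = -1) (hθ : Continuous θ)
    (hm : StrictMono fun t => σ * θ t)
    (hinj : ∀ t ∈ Ioo (0 : ℝ) 1, circleMap 0 1 (θ t) ≠ circleMap 0 1 (θ 0))
    (hper : circleMap 0 1 (θ 1) = circleMap 0 1 (θ 0)) : θ 1 = θ 0 + σ * (2 * Real.pi) := by
  have hσ2 : σ * σ = 1 := by rcases hσ with rfl | rfl <;> norm_num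
  obtain ⟨k, hk⟩ : ∃ k : ℤ, θ 1 = θ 0 + k * (2 * Real.pi) := by
    simp only [circleMap, zero_add, ofReal_one, one_mul] at hper
    obtain ⟨k, hk⟩ := exp_eq_exp_iff_exists_int.1 hper
    refine ⟨k, ?_⟩
    have : ((θ 1 : ℝ) : ℂ) * I = ((θ 0 + k * (2 * Real.pi) : ℝ) : ℂ) * I := by
      rw [hk]; push_cast; ring
    exact_mod_cast mul_right_cancel₀ I_ne_zero this
  have hpi := Real.two_pi_pos
  have hpos : 0 < σ * k := by
    have := hm (zero_lt_one (α := ℝ))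
    simp only [hk] at this
    by_contra hcon
    nlinarith [not_lt.1 hcon]
  obtain ⟨j, hj⟩ : ∃ j : ℤ, (j : ℝ) = σ * k := by
    rcases hσ with rfl | rfl
    · exact ⟨k, by simp⟩
    · exact ⟨-k, by simp⟩
  have hj1 : j = 1 := by
    by_contra hne
    have hj0 : 0 < j := by exact_mod_cast (hj ▸ hpos : (0 : ℝ) < j)
    have hj2 : (2 : ℝ) ≤ j := by exact_mod_cast (by omega : (2 : ℤ) ≤ j)
    have hmem : σ * θ 0 + 2 * Real.pi ∈ Ioo (σ * θ 0) (σ * θ 1) := by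
      refine ⟨by linarith, ?_⟩
      rw [hk, mul_add, ← mul_assoc, ← hj]
      nlinarith
    obtain ⟨t, ht, hte⟩ := intermediate_value_Ioo zero_le_one
      ((continuous_const.mul hθ).continuousOn (s := Icc (0 : ℝ) 1)) hmem
    have hte : σ * θ t = σ * θ 0 + 2 * Real.pi := hte
    refine hinj t ht ?_
    have h1 : θ t = θ 0 + σ * (2 * Real.pi) := by
      have : σ * (σ * θ t) = σ * (σ * θ 0 + 2 * Real.pi) := by rw [hte]
      rw [mul_add, ← mul_assoc, ← mul_assoc, hσ2, one_mul, one_mul] at this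
      exact this
    rw [h1]
    rcases hσ with rfl | rfl
    · rw [one_mul]; exact periodic_circleMap 0 1 (θ 0)
    · have := periodic_circleMap 0 1 (θ 0 + -1 * (2 * Real.pi))
      rw [← this]
      congr 1
      ring
  rw [hj1, Int.cast_one] at hj
  have : (k : ℝ) = σ := by
    have : σ * (σ * k) = σ * 1 := by rw [← hj]
    rwa [← mul_assoc, hσ2, one_mul, mul_one] at this
  rw [hk, this]

end Curves

/-- A smooth increasing angle function making one turn on the unit interval. -/
structure IsAngle (θ : ℝ → ℝ) : Prop where
  smooth : ContDiff ℝ ∞ θ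
  pos : ∀ t, 0 < deriv θ t
  turn : θ 1 = θ 0 + 2 * Real.pi

lemma hasDerivAt_of_contDiff {θ : ℝ → ℝ} (h : ContDiff ℝ ∞ θ) (t : ℝ) : HasDerivAt θ (deriv θ t) t :=
  ((h.differentiable (by simp)) t).hasDerivAt

lemma integral_comp_angle {θ g : ℝ → ℝ} (hθ : ContDiff ℝ ∞ θ) (hg : Continuous g) :
    ∫ t in (0 : ℝ)..1, g (θ t) * deriv θ t = ∫ x in θ 0..θ 1, g x :=
  intervalIntegral.integral_comp_mul_deriv (fun t _ => hasDerivAt_of_contDiff hθ t)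
    (contDiff_infty_iff_deriv.1 hθ).2.continuous.continuousOn hg

lemma IsAngle.integral_comp {θ g : ℝ → ℝ} (h : IsAngle θ) (hg : Continuous g)
    (hp : Function.Periodic g (2 * Real.pi)) :
    ∫ t in (0 : ℝ)..1, g (θ t) * deriv θ t = ∫ x in (0 : ℝ)..(2 * Real.pi), g x := by
  rw [integral_comp_angle h.smooth hg, h.turn, hp.intervalIntegral_add_eq (θ 0) 0, zero_add]

section Param

variable {χ : ℂ → ℂ} {S : Set ℂ} {c : ℝ → ℂ}

/-- A smooth conformal embedding of the closed disc. -/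
structure IsDiscEmbedding (χ : ℂ → ℂ) : Prop where
  smooth : ContDiffOn ℂ ∞ χ closedDisc
  deriv_ne : ∀ w ∈ closedDisc, discDeriv χ w ≠ 0
  injOn : InjOn χ closedDisc

lemma IsDiscEmbedding.energy_pos (h : IsDiscEmbedding χ) : 0 < energy χ := by
  refine lt_of_le_of_ne (energy_nonneg h.smooth) fun h0 => ?_
  have hm := Metric.mem_closedBall_self (x := (0 : ℂ)) (zero_le_one (α := ℝ))
  exact h.deriv_ne 0 hm (discDeriv_eq_zero_of_const (eq_const_of_energy_eq_zero h.smooth h0.symm) hm)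

lemma area_integrand (hχ : ContDiffOn ℂ ∞ χ closedDisc) {θ : ℝ → ℝ} (hθ : ContDiff ℝ ∞ θ)
    (hc : ∀ t, c t = χ (circleMap 0 1 (θ t))) (t : ℝ) :
    (c t).re * (deriv c t).im - (c t).im * (deriv c t).re =
      (conj (χ (circleMap 0 1 (θ t))) * angDeriv χ (circleMap 0 1 (θ t))).re * deriv θ t := by
  have h1 : HasDerivAt c (angDeriv χ (circleMap 0 1 (θ t)) * (I * deriv θ t)) t := by
    rw [funext hc]
    exact hasDerivAt_comp_angle hχ (hasDerivAt_of_contDiff hθ t)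
  rw [h1.deriv, hc t]
  simp only [mul_re, mul_im, conj_re, conj_im, I_re, I_im, ofReal_re, ofReal_im]
  ring

lemma area_eq (hχ : ContDiffOn ℂ ∞ χ closedDisc) {θ : ℝ → ℝ} (hθ : ContDiff ℝ ∞ θ)
    (hc : ∀ t, c t = χ (circleMap 0 1 (θ t))) :
    ∫ t in (0 : ℝ)..1, ((c t).re * (deriv c t).im - (c t).im * (deriv c t).re) =
      ∫ x in θ 0..θ 1, (conj (χ (circleMap 0 1 x)) * angDeriv χ (circleMap 0 1 x)).re := by
  simp_rw [area_integrand hχ hθ hc]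
  exact integral_comp_angle hθ (g := fun x =>
    (conj (χ (circleMap 0 1 x)) * angDeriv χ (circleMap 0 1 x)).re)
    (continuous_re.comp ((continuous_conj.comp (continuous_comp_circleMap hχ.continuousOn)).mul
      (continuous_comp_circleMap (contDiffOn_angDeriv hχ).continuousOn)))

/-- The signed area along one counterclockwise turn is therefore half the energy, positive for an
embedding; this decides the orientation. -/
lemma integral_turn_eq_energy (χ : ℂ → ℂ) (a : ℝ) :
    ∫ x in a..a + 2 * Real.pi, (conj (χ (circleMap 0 1 x)) * angDeriv χ (circleMap 0 1 x)).re =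
      energy χ := by
  have hp := periodic_comp_circleMap (fun w => (conj (χ w) * angDeriv χ w).re)
  rw [hp.intervalIntegral_add_eq a 0, zero_add]
  rfl

/-- The image of the unit circle under a conformal embedding of the disc is a smooth Jordan curve. -/
lemma IsDiscEmbedding.isSmoothJordanCurve (h : IsDiscEmbedding χ) :
    IsSmoothJordanCurve (χ '' Metric.sphere 0 1) := by
  set θ : ℝ → ℝ := fun t => 2 * Real.pi * t
  have hθs : ContDiff ℝ ∞ θ := contDiff_const.mul contDiff_id
  have hpi := Real.two_pi_pos
  refine ⟨fun t => χ (circleMap 0 1 (θ t)), ?_, ?_, ?_, ?_, ?_, ?_⟩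
  · exact contDiff_comp_curve le_rfl h.smooth (fun t => circleMap_one_mem _)
      (contDiff_circleMap_comp hθs)
  · intro t
    simp only [θ, mul_add, mul_one, periodic_circleMap 0 1 (2 * Real.pi * t)]
  · intro t
    have hd : HasDerivAt θ (2 * Real.pi) t := by
      simpa using (hasDerivAt_id t).const_mul (2 * Real.pi)
    rw [(hasDerivAt_comp_angle h.smooth hd).deriv, angDeriv]
    exact mul_ne_zero (mul_ne_zero (circleMap_ne_center one_ne_zero) (h.deriv_ne _ (circleMap_one_mem _)))
      (mul_ne_zero I_ne_zero (by exact_mod_cast hpi.ne'))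
  · intro s hs t ht hst
    have h1 := h.injOn (circleMap_one_mem _) (circleMap_one_mem _) hst
    have h2 := injOn_circleMap_of_abs_sub_le' (c := 0) (R := 1) one_ne_zero
      (a := 0) (b := 2 * Real.pi) (by linarith)
    have hmem : ∀ u ∈ Ico (0 : ℝ) 1, θ u ∈ Ico 0 (2 * Real.pi) := fun u hu =>
      ⟨by simp only [θ]; have := hu.1; positivity, by simp only [θ]; nlinarith [hu.2]⟩
    have h3 := h2 (hmem s hs) (hmem t ht) h1
    exact mul_left_cancel₀ hpi.ne' h3
  · ext z
    constructor
    · rintro ⟨t, rfl⟩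
      exact mem_image_of_mem χ (by rw [mem_sphere_zero_iff_norm, norm_circleMap_zero, abs_one])
    · rintro ⟨w, hw, rfl⟩
      refine ⟨w.arg / (2 * Real.pi), ?_⟩
      have h1 : θ (w.arg / (2 * Real.pi)) = w.arg := mul_div_cancel₀ _ hpi.ne'
      have h2 := norm_mul_exp_arg_mul_I w
      rw [mem_sphere_zero_iff_norm.1 hw] at h2
      simp only [h1, circleMap, zero_add]
      rw [h2]
  · rw [area_eq h.smooth hθs (fun _ => rfl)]
    have e0 : θ 0 = 0 := mul_zero _
    have e1 : θ 1 = 0 + 2 * Real.pi := by simp [θ]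
    rw [e0, e1, integral_turn_eq_energy]
    have := h.energy_pos
    positivity

/-- Every counterclockwise parametrization comes from an increasing angle function. -/
lemma IsDiscEmbedding.exists_isAngle (h : IsDiscEmbedding χ)
    (hc : IsPosParam c (χ '' Metric.sphere 0 1)) :
    ∃ θ, IsAngle θ ∧ ∀ t, c t = χ (circleMap 0 1 (θ t)) := by
  have hmem : ∀ t, ∃ w ∈ Metric.sphere (0 : ℂ) 1, χ w = c t := fun t => by
    have := mem_range_self (f := c) t
    rw [hc.range_eq] at this
    exact this
  choose w hws hwc using hmem
  have hwd : ∀ t, w t ∈ closedDisc := fun t => Metric.sphere_subset_closedBall (hws t)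
  -- A continuous injection of a compact set is closed, so its inverse is continuous.
  have hcw : Continuous w := by
    rw [continuous_iff_isClosed]
    intro K hK
    have : w ⁻¹' K = c ⁻¹' (χ '' (Metric.sphere 0 1 ∩ K)) := by
      ext t
      constructor
      · intro ht
        exact ⟨w t, ⟨hws t, ht⟩, hwc t⟩
      · rintro ⟨y, ⟨hy1, hy2⟩, hyc⟩
        rw [← hwc t] at hyc
        have := h.injOn (Metric.sphere_subset_closedBall hy1) (hwd t) hyc
        rw [mem_preimage, ← this]
        exact hy2
    rw [this]
    refine IsClosed.preimage hc.smooth.continuous (IsCompact.isClosed ?_)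
    exact ((isCompact_sphere 0 1).inter_right hK).image_of_continuousOn
      (h.smooth.continuousOn.mono fun y hy => Metric.sphere_subset_closedBall hy.1)
  have hder : ∀ t, HasDerivAt w ((discDeriv χ (w t))⁻¹ * deriv c t) t := by
    intro t
    have hb := h.deriv_ne (w t) (hwd t)
    set b := discDeriv χ (w t)
    -- At circle points `χ` is differentiable only within the closed disc, so the derivative of `w`
    -- is extracted from `χ ∘ w = c` and the invertibility of `χ'`.
    have h1 := HasFDerivWithinAt.of_comp_of_leftInverse (g := w) (f := χ) (h := c) (s := univ)
      (t := closedDisc) (a := t) (f' := b • (1 : ℂ →L[ℝ] ℂ)) (f'symm := b⁻¹ • (1 : ℂ →L[ℝ] ℂ))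
      (tendsto_nhdsWithin_iff.2 ⟨hcw.continuousAt.tendsto.mono_left nhdsWithin_le_nhds,
        Eventually.of_forall hwd⟩)
      (hasFDerivWithinAt_real (hasDerivWithinAt_discDeriv h.smooth (hwd t)))
      (hc.isParam.hasDerivAt t).hasFDerivAt.hasFDerivWithinAt
      (Eventually.of_forall hwc) (fun v => by simp [inv_mul_cancel_left₀ hb]) (mem_univ t)
    rw [hasFDerivWithinAt_univ] at h1
    refine h1.hasDerivAt.congr_deriv ?_
    simp
  have hws' : ContDiff ℝ ∞ w := by
    rw [contDiff_infty]
    intro n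
    induction n with
    | zero => exact_mod_cast contDiff_zero.2 hcw
    | succ n ih =>
      -- Bootstrapping: `w' = c' / χ'(w)` is as smooth as `w`, which is therefore smoother by one
      -- order.
      have : ContDiff ℝ (n + 1) w := by
        rw [contDiff_succ_iff_deriv]
        refine ⟨fun t => (hder t).differentiableAt, fun hn => by simp at hn, ?_⟩
        rw [show deriv w = fun t => (discDeriv χ (w t))⁻¹ * deriv c t from
          funext fun t => (hder t).deriv]
        have hn : ((n : ℕ) : WithTop ℕ∞) ≤ ∞ := by exact_mod_cast le_top
        refine ContDiff.mul (ContDiff.inv (contDiff_comp_curve hn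
          (contDiffOn_discDeriv h.smooth) hwd ih) fun t => h.deriv_ne _ (hwd t)) ?_
        exact (contDiff_infty_iff_deriv.1 hc.smooth).2.of_le hn
      exact_mod_cast this
  obtain ⟨θ, hθs, hθ⟩ := exists_angle hws' (fun t => mem_sphere_zero_iff_norm.1 (hws t))
  have hcθ : ∀ t, c t = χ (circleMap 0 1 (θ t)) := fun t => by rw [← hθ, hwc]
  have hne : ∀ t, deriv θ t ≠ 0 := by
    intro t h0
    have h1 := hasDerivAt_comp_angle h.smooth (hasDerivAt_of_contDiff hθs t)
    rw [← funext hcθ, h0] at h1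
    refine hc.regular t ?_
    rw [h1.deriv]
    simp
  have hdc : Continuous (deriv θ) := (contDiff_infty_iff_deriv.1 hθs).2.continuous
  have hsign : (∀ t, 0 < deriv θ t) ∨ ∀ t, deriv θ t < 0 := by
    by_contra hcon
    rw [not_or] at hcon
    push Not at hcon
    obtain ⟨⟨a, ha⟩, b, hb⟩ := hcon
    obtain ⟨t, ht⟩ := mem_range_of_exists_le_of_exists_ge hdc ⟨a, ha⟩ ⟨b, hb⟩
    exact hne t ht
  have hinj : ∀ t ∈ Ioo (0 : ℝ) 1, circleMap 0 1 (θ t) ≠ circleMap 0 1 (θ 0) := by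
    intro t ht he
    have h1 : c t = c 0 := by rw [hcθ, hcθ, he]
    exact ht.1.ne' (hc.injOn ⟨ht.1.le, ht.2⟩ ⟨le_rfl, one_pos⟩ h1)
  have hper : circleMap 0 1 (θ 1) = circleMap 0 1 (θ 0) := by
    refine h.injOn (circleMap_one_mem _) (circleMap_one_mem _) ?_
    rw [← hcθ, ← hcθ]
    have := hc.periodic 0
    rwa [zero_add] at this
  rcases hsign with hpos | hneg
  · refine ⟨θ, ⟨hθs, hpos, ?_⟩, hcθ⟩
    have := angle_total (σ := 1) (Or.inl rfl) hθs.continuous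
      (by simpa using strictMono_of_deriv_pos hpos) hinj hper
    rwa [one_mul] at this
  -- A decreasing angle makes one clockwise turn and encloses the negative of a positive area.
  · exfalso
    have h1 := angle_total (σ := -1) (Or.inr rfl) hθs.continuous (by
      have := strictAnti_of_deriv_neg hneg
      intro a b hab
      have := this hab
      simp only
      linarith) hinj hper
    have h2 := hc.pos
    rw [area_eq h.smooth hθs hcθ, intervalIntegral.integral_symm,
      show θ 0 = θ 1 + 2 * Real.pi by rw [h1]; ring, integral_turn_eq_energy] at h2
    have := h.energy_pos
    linarith

end Param

/-! ### Averages, curvature and the four inequalities on a level curve. -/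

section Averages

variable {c : ℝ → ℂ} {θ M F K : ℝ → ℝ}

/-- The curve `c` has arc length element `M dθ` in terms of the angle function `θ`. -/
structure HasSpeed (c : ℝ → ℂ) (θ M : ℝ → ℝ) : Prop where
  angle : IsAngle θ
  continuous : Continuous M
  periodic : Function.Periodic M (2 * Real.pi)
  pos : ∀ x, 0 < M x
  norm_deriv : ∀ t, ‖deriv c t‖ = M (θ t) * deriv θ t

lemma HasSpeed.arcLength_eq (h : HasSpeed c θ M) :
    arcLength c = ∫ x in (0 : ℝ)..(2 * Real.pi), M x := by
  rw [arcLength, ← h.angle.integral_comp h.continuous h.periodic]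
  simp only [h.norm_deriv]

lemma HasSpeed.arcLength_pos (h : HasSpeed c θ M) : 0 < arcLength c := by
  rw [h.arcLength_eq]
  exact intervalIntegral.intervalIntegral_pos_of_pos (h.continuous.intervalIntegrable _ _) h.pos
    Real.two_pi_pos

lemma HasSpeed.avg_eq (h : HasSpeed c θ M) (hF : Continuous F)
    (hp : Function.Periodic F (2 * Real.pi)) :
    avg c (fun t => F (θ t)) = (∫ x in (0 : ℝ)..(2 * Real.pi), F x * M x) / arcLength c := by
  rw [avg, ← h.angle.integral_comp (g := fun x => F x * M x) (hF.mul h.continuous)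
    fun x => by simp only [hp x, h.periodic x]]
  simp only [h.norm_deriv, mul_assoc]

lemma HasSpeed.cov_eq (h : HasSpeed c θ M) (hF : Continuous F)
    (hp : Function.Periodic F (2 * Real.pi)) (hK : Continuous K)
    (hq : Function.Periodic K (2 * Real.pi)) :
    cov c (fun t => F (θ t)) (fun t => K (θ t)) =
      (∫ x in (0 : ℝ)..(2 * Real.pi), F x * K x * M x) / arcLength c -
      (∫ x in (0 : ℝ)..(2 * Real.pi), F x * M x) / arcLength c *
        ((∫ x in (0 : ℝ)..(2 * Real.pi), K x * M x) / arcLength c) := by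
  have hL := h.arcLength_pos.ne'
  have hM := h.continuous
  rw [cov, h.avg_eq hF hp, h.avg_eq hK hq]
  set a := (∫ x in (0 : ℝ)..(2 * Real.pi), F x * M x) / arcLength c with ha
  set b := (∫ x in (0 : ℝ)..(2 * Real.pi), K x * M x) / arcLength c with hb
  rw [h.avg_eq (F := fun x => (F x - a) * (K x - b))
    ((hF.sub continuous_const).mul (hK.sub continuous_const))
    fun x => by simp only [hp x, hq x]]
  have e : ∫ x in (0 : ℝ)..(2 * Real.pi), (F x - a) * (K x - b) * M x =
      (∫ x in (0 : ℝ)..(2 * Real.pi), F x * K x * M x) -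
        a * (∫ x in (0 : ℝ)..(2 * Real.pi), K x * M x) -
        b * (∫ x in (0 : ℝ)..(2 * Real.pi), F x * M x) +
        a * b * ∫ x in (0 : ℝ)..(2 * Real.pi), M x := by
    have i1 : IntervalIntegrable (fun x => F x * K x * M x) volume 0 (2 * Real.pi) :=
      ((hF.mul hK).mul hM).intervalIntegrable _ _
    have i2 : IntervalIntegrable (fun x => a * (K x * M x)) volume 0 (2 * Real.pi) :=
      (continuous_const.mul (hK.mul hM)).intervalIntegrable _ _
    have i3 : IntervalIntegrable (fun x => b * (F x * M x)) volume 0 (2 * Real.pi) :=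
      (continuous_const.mul (hF.mul hM)).intervalIntegrable _ _
    have i4 : IntervalIntegrable (fun x => a * b * M x) volume 0 (2 * Real.pi) :=
      (continuous_const.mul hM).intervalIntegrable _ _
    simp only [← intervalIntegral.integral_const_mul]
    rw [← intervalIntegral.integral_sub i1 i2, ← intervalIntegral.integral_sub (i1.sub i2) i3,
      ← intervalIntegral.integral_add ((i1.sub i2).sub i3) i4]
    congr 1
    ext x
    ring
  have e1 : (∫ x in (0 : ℝ)..(2 * Real.pi), F x * M x) = a * arcLength c := by
    rw [ha, div_mul_cancel₀ _ hL]
  have e2 : (∫ x in (0 : ℝ)..(2 * Real.pi), K x * M x) = b * arcLength c := by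
    rw [hb, div_mul_cancel₀ _ hL]
  rw [e, e1, e2, ← h.arcLength_eq]
  field_simp
  ring

end Averages

section Curvature

variable {χ l : ℂ → ℂ} {c : ℝ → ℂ} {θ : ℝ → ℝ}

/-- The modulus of `exp l` on the unit circle. -/
def speed (l : ℂ → ℂ) (x : ℝ) : ℝ := Real.exp (l (circleMap 0 1 x)).re

/-- The real part of `w dl/dw` on the unit circle. -/
def excess (l : ℂ → ℂ) (x : ℝ) : ℝ := (angDeriv l (circleMap 0 1 x)).re

lemma speed_pos (l : ℂ → ℂ) (x : ℝ) : 0 < speed l x := Real.exp_pos _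

lemma continuous_speed (hl : ContDiffOn ℂ ∞ l closedDisc) : Continuous (speed l) :=
  Real.continuous_exp.comp (continuous_re.comp (continuous_comp_circleMap hl.continuousOn))

lemma continuous_excess (hl : ContDiffOn ℂ ∞ l closedDisc) : Continuous (excess l) :=
  continuous_re.comp (continuous_comp_circleMap (contDiffOn_angDeriv hl).continuousOn)

lemma periodic_speed (l : ℂ → ℂ) : Function.Periodic (speed l) (2 * Real.pi) :=
  periodic_comp_circleMap fun w => Real.exp (l w).re

lemma periodic_excess (l : ℂ → ℂ) : Function.Periodic (excess l) (2 * Real.pi) :=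
  periodic_comp_circleMap fun w => (angDeriv l w).re

lemma hasDerivAt_speed (hl : ContDiffOn ℂ ∞ l closedDisc) {θ' t : ℝ} (hθ : HasDerivAt θ θ' t) :
    HasDerivAt (fun t => speed l (θ t))
      (-(speed l (θ t) * (angDeriv l (circleMap 0 1 (θ t))).im * θ')) t := by
  have h1 := reCLM.hasFDerivAt.comp_hasDerivAt t (hasDerivAt_comp_angle hl hθ)
  refine h1.exp.congr_deriv ?_
  simp [speed]
  ring

lemma hasDerivAt_excess (hl : ContDiffOn ℂ ∞ l closedDisc) {θ' t : ℝ} (hθ : HasDerivAt θ θ' t) :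
    HasDerivAt (fun t => excess l (θ t))
      (-((angDeriv (angDeriv l) (circleMap 0 1 (θ t))).im * θ')) t := by
  have h1 := reCLM.hasFDerivAt.comp_hasDerivAt t
    (hasDerivAt_comp_angle (contDiffOn_angDeriv hl) hθ)
  refine h1.congr_deriv ?_
  simp

lemma contDiff_speed (hl : ContDiffOn ℂ ∞ l closedDisc) (hθ : ContDiff ℝ ∞ θ) :
    ContDiff ℝ ∞ fun t => speed l (θ t) :=
  (reCLM.contDiff.comp (contDiff_comp_curve le_rfl hl (fun t => circleMap_one_mem (θ t))
    (contDiff_circleMap_comp hθ))).exp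

lemma deriv_curve (hχ : ContDiffOn ℂ ∞ χ closedDisc)
    (he : ∀ w ∈ closedDisc, exp (l w) = discDeriv χ w) (hθ : ContDiff ℝ ∞ θ)
    (hc : ∀ t, c t = χ (circleMap 0 1 (θ t))) (t : ℝ) :
    deriv c t = circleMap 0 1 (θ t) * exp (l (circleMap 0 1 (θ t))) * (I * deriv θ t) := by
  have h1 : HasDerivAt c (angDeriv χ (circleMap 0 1 (θ t)) * (I * deriv θ t)) t := by
    rw [funext hc]
    exact hasDerivAt_comp_angle hχ (hasDerivAt_of_contDiff hθ t)
  rw [h1.deriv, angDeriv, he _ (circleMap_one_mem _)]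

lemma hasSpeed_curve (hχ : ContDiffOn ℂ ∞ χ closedDisc) (hl : ContDiffOn ℂ ∞ l closedDisc)
    (he : ∀ w ∈ closedDisc, exp (l w) = discDeriv χ w) (hθ : IsAngle θ)
    (hc : ∀ t, c t = χ (circleMap 0 1 (θ t))) : HasSpeed c θ (speed l) where
  angle := hθ
  continuous := continuous_speed hl
  periodic := periodic_speed l
  pos := speed_pos l
  norm_deriv t := by
    rw [deriv_curve hχ he hθ.smooth hc, norm_mul, norm_mul, norm_mul, norm_circleMap_zero, abs_one,
      one_mul, norm_I, one_mul, norm_real, Real.norm_of_nonneg (hθ.pos t).le, norm_exp, speed]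

/-- The tangent `I w exp (l w)` has argument `θ + Im l + π / 2`, which turns at rate `1 + Re (w l')`
per unit angle, while arc length grows at rate `speed l`. -/
lemma curvature_eq (hχ : ContDiffOn ℂ ∞ χ closedDisc) (hl : ContDiffOn ℂ ∞ l closedDisc)
    (he : ∀ w ∈ closedDisc, exp (l w) = discDeriv χ w) (hθ : IsAngle θ)
    (hc : ∀ t, c t = χ (circleMap 0 1 (θ t))) (t : ℝ) :
    curvature c t = (1 + excess l (θ t)) / speed l (θ t) := by
  have hdc := deriv_curve hχ he hθ.smooth hc
  have hθd := hasDerivAt_of_contDiff hθ.smooth t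
  have hθ2 := hasDerivAt_of_contDiff (contDiff_infty_iff_deriv.1 hθ.smooth).2 t
  have h2 := ((hasDerivAt_circleMap_comp hθd).mul (hasDerivAt_comp_angle hl hθd).cexp).mul
    (hθ2.ofReal_comp.const_mul I)
  have h3 : deriv (deriv c) t = circleMap 0 1 (θ t) * exp (l (circleMap 0 1 (θ t))) *
      ((1 + angDeriv l (circleMap 0 1 (θ t))) * (I * deriv θ t) * (I * deriv θ t) +
        I * deriv (deriv θ) t) := by
    rw [funext hdc]
    refine (h2.congr_deriv ?_).deriv
    simp only [Pi.mul_apply]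
    ring
  have hn := (hasSpeed_curve hχ hl he hθ hc).norm_deriv t
  have hp := hθ.pos t
  have hM := speed_pos l (θ t)
  have hu : ‖circleMap 0 1 (θ t) * exp (l (circleMap 0 1 (θ t)))‖ = speed l (θ t) := by
    rw [norm_mul, norm_circleMap_zero, abs_one, one_mul, norm_exp, speed]
  rw [curvature, hn, h3, hdc t, excess]
  set u := circleMap 0 1 (θ t) * exp (l (circleMap 0 1 (θ t)))
  set A := angDeriv l (circleMap 0 1 (θ t))
  set p := deriv θ t
  set p' := deriv (deriv θ) t
  have key : (u * (I * p)).re * (u * ((1 + A) * (I * p) * (I * p) + I * p')).im -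
      (u * (I * p)).im * (u * ((1 + A) * (I * p) * (I * p) + I * p')).re =
      ‖u‖ ^ 2 * p ^ 3 * (1 + A.re) := by
    rw [← normSq_eq_norm_sq, normSq_apply]
    simp only [mul_re, mul_im, I_re, I_im, ofReal_re, ofReal_im, add_re, add_im, one_re, one_im]
    ring
  rw [key, hu]
  field_simp

end Curvature

section CurveInequalities

variable {χ l : ℂ → ℂ} {c : ℝ → ℂ} {θ κ E : ℝ → ℝ} {q L Φ : ℝ}

lemma integral_excess (hl : ContDiffOn ℂ ∞ l closedDisc) :
    ∫ x in (0 : ℝ)..(2 * Real.pi), excess l x = 0 := integral_re_angDeriv hl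

lemma integral_excess_mul_speed (hl : ContDiffOn ℂ ∞ l closedDisc) :
    0 ≤ ∫ x in (0 : ℝ)..(2 * Real.pi), excess l x * speed l x ∧
    (∫ x in (0 : ℝ)..(2 * Real.pi), excess l x * speed l x = 0 ↔
      ∀ w ∈ closedDisc, discDeriv l w = 0) := by
  have := integral_angDeriv_mul_exp hl (s := 1 / 2) (by norm_num)
  simpa [excess, speed] using this

lemma integral_excess_mul_speed_sq (hl : ContDiffOn ℂ ∞ l closedDisc) :
    0 ≤ ∫ x in (0 : ℝ)..(2 * Real.pi), excess l x * speed l x ^ 2 ∧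
    (∫ x in (0 : ℝ)..(2 * Real.pi), excess l x * speed l x ^ 2 = 0 ↔
      ∀ w ∈ closedDisc, discDeriv l w = 0) := by
  have := integral_angDeriv_mul_exp hl (s := 1) one_pos
  simpa only [excess, speed, ← Real.exp_nat_mul, Nat.cast_ofNat, mul_one] using this

/-- Here `κ / E = (1 + excess) / q` and `∫ excess = 0`. The covariance reduces to `-(2π / L²) ∫
excess * speed`, an integral equal to twice the energy of `exp (l / 2)`. -/
lemma cov_gradNorm_le (hs : HasSpeed c θ (speed l)) (hl : ContDiffOn ℂ ∞ l closedDisc)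
    (hq : 0 < q) (hκ : ∀ t, κ t = (1 + excess l (θ t)) / speed l (θ t))
    (hE : ∀ t, E t = q / speed l (θ t)) :
    cov c (fun t => κ t / E t) E ≤ 0 ∧
      (cov c (fun t => κ t / E t) E = 0 ↔ ∀ w ∈ closedDisc, discDeriv l w = 0) := by
  have hM := continuous_speed hl
  have hH := continuous_excess hl
  have hM0 : ∀ x, speed l x ≠ 0 := fun x => (speed_pos l x).ne'
  have hL := hs.arcLength_pos
  have e1 : (fun t => κ t / E t) = fun t => (fun x => (1 + excess l x) / q) (θ t) := by
    ext t
    rw [hκ, hE]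
    have := hM0 (θ t)
    field_simp
  have e2 : E = fun t => (fun x => q / speed l x) (θ t) := funext hE
  have hcov := hs.cov_eq (F := fun x => (1 + excess l x) / q) (K := fun x => q / speed l x)
    ((continuous_const.add hH).div_const q) (fun x => by simp only [periodic_excess l x])
    (continuous_const.div hM hM0) (fun x => by simp only [periodic_speed l x])
  have i1 : ∫ x in (0 : ℝ)..(2 * Real.pi), (1 + excess l x) / q * (q / speed l x) * speed l x =
      2 * Real.pi := by
    have : ∀ x, (1 + excess l x) / q * (q / speed l x) * speed l x = 1 + excess l x := fun x => by
      have := hM0 x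
      field_simp
    simp only [this]
    rw [intervalIntegral.integral_add (continuous_const.intervalIntegrable _ _)
      (hH.intervalIntegrable _ _), integral_excess hl]
    simp
  have i2 : ∫ x in (0 : ℝ)..(2 * Real.pi), (1 + excess l x) / q * speed l x =
      (arcLength c + ∫ x in (0 : ℝ)..(2 * Real.pi), excess l x * speed l x) / q := by
    have k : IntervalIntegrable (fun x => excess l x * speed l x) volume 0 (2 * Real.pi) :=
      (hH.mul hM).intervalIntegrable _ _
    rw [hs.arcLength_eq, ← intervalIntegral.integral_add (hM.intervalIntegrable _ _) k,
      ← intervalIntegral.integral_div]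
    congr 1
    ext x
    ring
  have i3 : ∫ x in (0 : ℝ)..(2 * Real.pi), q / speed l x * speed l x = 2 * Real.pi * q := by
    simp [div_mul_cancel₀ _ (hM0 _)]
  obtain ⟨hA, hA0⟩ := integral_excess_mul_speed hl
  set A := ∫ x in (0 : ℝ)..(2 * Real.pi), excess l x * speed l x
  have h : cov c (fun t => κ t / E t) E = -(2 * Real.pi / arcLength c ^ 2 * A) := by
    rw [e1, e2, hcov, i1, i2, i3]
    field_simp
    ring
  have hpos : 0 < 2 * Real.pi / arcLength c ^ 2 := by positivity
  rw [h, neg_nonpos, neg_eq_zero, mul_eq_zero, or_iff_right hpos.ne', hA0]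
  exact ⟨mul_nonneg hpos.le hA, Iff.rfl⟩

/-- The logarithm is a constant minus `Re l`, and `E / |Φ|` is `κ / (2π)` without the excess. The
two sides differ by `∫ excess * Re l / (2π L)`, and that integral is half the energy of `l`. -/
lemma cov_log_le (hs : HasSpeed c θ (speed l)) (hl : ContDiffOn ℂ ∞ l closedDisc)
    (hΦ : Φ ≠ 0) (hκ : ∀ t, κ t = (1 + excess l (θ t)) / speed l (θ t))
    (hE : ∀ t, E t = |Φ| / (2 * Real.pi) / speed l (θ t)) (hL : L = arcLength c) :
    cov c (fun t => κ t / (2 * Real.pi)) (fun t => Real.log (E t * L / |Φ|)) ≤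
        cov c (fun t => E t / |Φ|) (fun t => Real.log (E t * L / |Φ|)) ∧
      (cov c (fun t => κ t / (2 * Real.pi)) (fun t => Real.log (E t * L / |Φ|)) =
        cov c (fun t => E t / |Φ|) (fun t => Real.log (E t * L / |Φ|)) ↔
        ∀ w ∈ closedDisc, discDeriv l w = 0) := by
  have hM := continuous_speed hl
  have hH := continuous_excess hl
  have hM0 : ∀ x, speed l x ≠ 0 := fun x => (speed_pos l x).ne'
  have hLp := hs.arcLength_pos
  have hΦ' : |Φ| ≠ 0 := abs_ne_zero.2 hΦ
  have hpi := Real.pi_pos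
  set b := Real.log (arcLength c / (2 * Real.pi))
  set R : ℝ → ℝ := fun x => (l (circleMap 0 1 x)).re
  have hR : Continuous R := continuous_re.comp (continuous_comp_circleMap hl.continuousOn)
  have hRp : Function.Periodic R (2 * Real.pi) := periodic_comp_circleMap fun w => (l w).re
  have e1 : (fun t => κ t / (2 * Real.pi)) =
      fun t => (fun x => (1 + excess l x) / speed l x / (2 * Real.pi)) (θ t) :=
    funext fun t => by rw [hκ]
  have e2 : (fun t => E t / |Φ|) = fun t => (fun x => 1 / speed l x / (2 * Real.pi)) (θ t) := by
    ext t
    rw [hE]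
    have := hM0 (θ t)
    field_simp
  have e3 : (fun t => Real.log (E t * L / |Φ|)) = fun t => (fun x => b - R x) (θ t) := by
    ext t
    have h1 : E t * L / |Φ| = arcLength c / (2 * Real.pi) / speed l (θ t) := by
      rw [hE, hL]
      have := hM0 (θ t)
      field_simp
    rw [h1, Real.log_div (by positivity) (hM0 _), speed, Real.log_exp]
  have hc1 := hs.cov_eq (F := fun x => (1 + excess l x) / speed l x / (2 * Real.pi))
    (K := fun x => b - R x)
    (((continuous_const.add hH).div hM hM0).div_const _)
    (fun x => by simp only [periodic_excess l x, periodic_speed l x])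
    (continuous_const.sub hR) (fun x => by simp only [hRp x])
  have hc2 := hs.cov_eq (F := fun x => 1 / speed l x / (2 * Real.pi))
    (K := fun x => b - R x)
    ((continuous_const.div hM hM0).div_const _) (fun x => by simp only [periodic_speed l x])
    (continuous_const.sub hR) (fun x => by simp only [hRp x])
  obtain ⟨hA, hA0⟩ : 0 ≤ ∫ x in (0 : ℝ)..(2 * Real.pi), excess l x * R x ∧
    (∫ x in (0 : ℝ)..(2 * Real.pi), excess l x * R x = 0 ↔
      ∀ w ∈ closedDisc, discDeriv l w = 0) := integral_angDeriv_mul_log hl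
  have j1 : ∀ x, (1 + excess l x) / speed l x / (2 * Real.pi) * (b - R x) * speed l x =
      (1 + excess l x) * (b - R x) / (2 * Real.pi) := fun x => by
    have := hM0 x
    field_simp
  have j2 : ∀ x, 1 / speed l x / (2 * Real.pi) * (b - R x) * speed l x =
      (b - R x) / (2 * Real.pi) := fun x => by
    have := hM0 x
    field_simp
  have j3 : ∀ x, (1 + excess l x) / speed l x / (2 * Real.pi) * speed l x =
      (1 + excess l x) / (2 * Real.pi) := fun x => by
    have := hM0 x
    field_simp
  have j4 : ∀ x, 1 / speed l x / (2 * Real.pi) * speed l x = 1 / (2 * Real.pi) := fun x => by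
    have := hM0 x
    field_simp
  have i1 : ∫ x in (0 : ℝ)..(2 * Real.pi), (1 + excess l x) / (2 * Real.pi) =
      ∫ x in (0 : ℝ)..(2 * Real.pi), (1 : ℝ) / (2 * Real.pi) := by
    rw [intervalIntegral.integral_div, intervalIntegral.integral_div,
      intervalIntegral.integral_add (continuous_const.intervalIntegrable _ _)
      (hH.intervalIntegrable _ _), integral_excess hl, add_zero]
  have hbR : Continuous fun x => b - R x := continuous_const.sub hR
  have i2 : ∫ x in (0 : ℝ)..(2 * Real.pi), (1 + excess l x) * (b - R x) / (2 * Real.pi) =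
      (∫ x in (0 : ℝ)..(2 * Real.pi), (b - R x) / (2 * Real.pi)) -
        (∫ x in (0 : ℝ)..(2 * Real.pi), excess l x * R x) / (2 * Real.pi) := by
    have k1 : IntervalIntegrable (fun x => b - R x) volume 0 (2 * Real.pi) :=
      hbR.intervalIntegrable _ _
    have k2 : IntervalIntegrable (fun x => b * excess l x) volume 0 (2 * Real.pi) :=
      (continuous_const.mul hH).intervalIntegrable _ _
    have k3 : IntervalIntegrable (fun x => excess l x * R x) volume 0 (2 * Real.pi) :=
      (hH.mul hR).intervalIntegrable _ _
    rw [intervalIntegral.integral_div, intervalIntegral.integral_div, ← sub_div]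
    congr 1
    calc ∫ x in (0 : ℝ)..(2 * Real.pi), (1 + excess l x) * (b - R x)
        = ∫ x in (0 : ℝ)..(2 * Real.pi), (b - R x + b * excess l x - excess l x * R x) := by
          congr 1
          ext x
          ring
      _ = _ := by
          rw [intervalIntegral.integral_sub (k1.add k2) k3, intervalIntegral.integral_add k1 k2,
            intervalIntegral.integral_const_mul, integral_excess hl, mul_zero, add_zero]
  set A := ∫ x in (0 : ℝ)..(2 * Real.pi), excess l x * R x
  have h : cov c (fun t => κ t / (2 * Real.pi)) (fun t => Real.log (E t * L / |Φ|)) =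
      cov c (fun t => E t / |Φ|) (fun t => Real.log (E t * L / |Φ|)) -
        1 / (2 * Real.pi * arcLength c) * A := by
    rw [e1, e2, e3, hc1, hc2]
    simp only [j1, j2, j3, j4]
    rw [i1, i2]
    field_simp
    ring
  have hpos : 0 < 1 / (2 * Real.pi * arcLength c) := by positivity
  rw [h, sub_le_self_iff, sub_eq_self, mul_eq_zero, or_iff_right hpos.ne', hA0]
  exact ⟨mul_nonneg hpos.le hA, Iff.rfl⟩

/-- Up to the factor `1 / q`, the two functions are `1 + excess` and `speed`. Their angular
derivatives are `-Im (w (w l')')` and `-speed * Im (w l')`, and all speeds cancel after integration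
against arc length. -/
lemma avg_tangentialDeriv_nonneg (hs : HasSpeed c θ (speed l)) (hl : ContDiffOn ℂ ∞ l closedDisc)
    (hq : 0 < q) (hκ : ∀ t, κ t = (1 + excess l (θ t)) / speed l (θ t))
    (hE : ∀ t, E t = q / speed l (θ t)) :
    0 ≤ avg c (fun t => tangentialDeriv c (fun u => κ u / E u) t *
        tangentialDeriv c (fun u => 1 / E u) t) ∧
      (avg c (fun t => tangentialDeriv c (fun u => κ u / E u) t *
        tangentialDeriv c (fun u => 1 / E u) t) = 0 ↔ ∀ w ∈ closedDisc, discDeriv l w = 0) := by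
  have hM0 : ∀ x, speed l x ≠ 0 := fun x => (speed_pos l x).ne'
  have hL := hs.arcLength_pos
  have e1 : (fun t => κ t / E t) = fun t => (1 + excess l (θ t)) / q := by
    ext t
    rw [hκ, hE]
    have := hM0 (θ t)
    field_simp
  have e2 : (fun t => 1 / E t) = fun t => speed l (θ t) / q := by
    ext t
    rw [hE]
    have := hM0 (θ t)
    field_simp
  set B : ℝ → ℝ := fun x => (angDeriv (angDeriv l) (circleMap 0 1 x)).im *
    (angDeriv l (circleMap 0 1 x)).im
  have hl2 := contDiffOn_angDeriv hl
  have hB : Continuous B := (continuous_im.comp (continuous_comp_circleMap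
    (contDiffOn_angDeriv hl2).continuousOn)).mul
    (continuous_im.comp (continuous_comp_circleMap hl2.continuousOn))
  have hBp : Function.Periodic B (2 * Real.pi) :=
    periodic_comp_circleMap fun w => (angDeriv (angDeriv l) w).im * (angDeriv l w).im
  have e3 : (fun t => tangentialDeriv c (fun u => κ u / E u) t *
      tangentialDeriv c (fun u => 1 / E u) t) =
      fun t => (fun x => B x / (q ^ 2 * speed l x)) (θ t) := by
    ext t
    have hd := hasDerivAt_of_contDiff hs.angle.smooth t
    have d1 := (((hasDerivAt_excess hl hd).const_add 1).div_const q).deriv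
    have d2 := ((hasDerivAt_speed hl hd).div_const q).deriv
    rw [tangentialDeriv, tangentialDeriv, e1, e2, d1, d2, hs.norm_deriv]
    have h1 := hM0 (θ t)
    have h2 := (hs.angle.pos t).ne'
    simp only [B]
    field_simp
  obtain ⟨hA, hA0⟩ : 0 ≤ ∫ x in (0 : ℝ)..(2 * Real.pi), B x ∧
    (∫ x in (0 : ℝ)..(2 * Real.pi), B x = 0 ↔ ∀ w ∈ closedDisc, discDeriv l w = 0) :=
      integral_im_angDeriv_mul hl
  have h : avg c (fun t => tangentialDeriv c (fun u => κ u / E u) t *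
      tangentialDeriv c (fun u => 1 / E u) t) =
      1 / (q ^ 2 * arcLength c) * ∫ x in (0 : ℝ)..(2 * Real.pi), B x := by
    rw [e3, hs.avg_eq (F := fun x => B x / (q ^ 2 * speed l x))
      (hB.div (continuous_const.mul (continuous_speed hl))
        fun x => mul_ne_zero (by positivity) (hM0 x))
      fun x => by simp only [hBp x, periodic_speed l x]]
    have : ∀ x, B x / (q ^ 2 * speed l x) * speed l x = B x / q ^ 2 := fun x => by
      have := hM0 x
      field_simp
    simp only [this]
    rw [intervalIntegral.integral_div]
    field_simp
  have hpos : 0 < 1 / (q ^ 2 * arcLength c) := by positivity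
  rw [h, mul_eq_zero, or_iff_right hpos.ne', hA0]
  exact ⟨mul_nonneg hpos.le hA, Iff.rfl⟩

/-- With `p = 2π / |Φ|` one has `κ / E² = p² (1 + excess) speed` and `1 / E = p * speed`. What
remains is `(p² / L) ∫ excess * speed²`, and that integral is the energy of `exp l`. -/
lemma avg_inv_gradNorm_le (hs : HasSpeed c θ (speed l)) (hl : ContDiffOn ℂ ∞ l closedDisc)
    (hΦ : Φ ≠ 0) (hκ : ∀ t, κ t = (1 + excess l (θ t)) / speed l (θ t))
    (hE : ∀ t, E t = |Φ| / (2 * Real.pi) / speed l (θ t)) :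
    2 * Real.pi / |Φ| * avg c (fun t => 1 / E t) ≤ avg c (fun t => κ t / E t ^ 2) ∧
      (avg c (fun t => κ t / E t ^ 2) = 2 * Real.pi / |Φ| * avg c (fun t => 1 / E t) ↔
        ∀ w ∈ closedDisc, discDeriv l w = 0) := by
  have hM := continuous_speed hl
  have hH := continuous_excess hl
  have hM0 : ∀ x, speed l x ≠ 0 := fun x => (speed_pos l x).ne'
  have hL := hs.arcLength_pos
  have hΦ' : 0 < |Φ| := abs_pos.2 hΦ
  have hpi := Real.pi_pos
  set p := 2 * Real.pi / |Φ| with hp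
  have hpp : 0 < p := by positivity
  have hE' : ∀ t, E t = 1 / (p * speed l (θ t)) := fun t => by
    rw [hE, hp]
    have := hM0 (θ t)
    field_simp
  have e1 : (fun t => κ t / E t ^ 2) =
      fun t => (fun x => p ^ 2 * ((1 + excess l x) * speed l x)) (θ t) := by
    ext t
    rw [hκ, hE']
    have := hM0 (θ t)
    field_simp
  have e2 : (fun t => 1 / E t) = fun t => (fun x => p * speed l x) (θ t) := by
    ext t
    rw [hE']
    have := hM0 (θ t)
    field_simp
  obtain ⟨hA, hA0⟩ := integral_excess_mul_speed_sq hl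
  have i1 : ∫ x in (0 : ℝ)..(2 * Real.pi), p ^ 2 * ((1 + excess l x) * speed l x) * speed l x =
      p * (∫ x in (0 : ℝ)..(2 * Real.pi), p * speed l x * speed l x) +
        p ^ 2 * ∫ x in (0 : ℝ)..(2 * Real.pi), excess l x * speed l x ^ 2 := by
    have k1 : IntervalIntegrable (fun x => p * (p * speed l x * speed l x)) volume 0
        (2 * Real.pi) :=
      (continuous_const.mul ((continuous_const.mul hM).mul hM)).intervalIntegrable _ _
    have k2 : IntervalIntegrable (fun x => p ^ 2 * (excess l x * speed l x ^ 2)) volume 0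
        (2 * Real.pi) :=
      (continuous_const.mul (hH.mul (hM.pow 2))).intervalIntegrable _ _
    rw [← intervalIntegral.integral_const_mul, ← intervalIntegral.integral_const_mul,
      ← intervalIntegral.integral_add k1 k2]
    congr 1
    ext x
    ring
  set A := ∫ x in (0 : ℝ)..(2 * Real.pi), excess l x * speed l x ^ 2
  have h : avg c (fun t => κ t / E t ^ 2) =
      p * avg c (fun t => 1 / E t) + p ^ 2 / arcLength c * A := by
    rw [e1, e2, hs.avg_eq (F := fun x => p ^ 2 * ((1 + excess l x) * speed l x))
      (continuous_const.mul ((continuous_const.add hH).mul hM))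
      (fun x => by simp only [periodic_excess l x, periodic_speed l x]),
      hs.avg_eq (F := fun x => p * speed l x) (continuous_const.mul hM)
      (fun x => by simp only [periodic_speed l x]), i1]
    field_simp
  have hpos : 0 < p ^ 2 / arcLength c := by positivity
  rw [h, le_add_iff_nonneg_right, add_eq_left, mul_eq_zero, or_iff_right hpos.ne', hA0]
  exact ⟨mul_nonneg hpos.le hA, Iff.rfl⟩

end CurveInequalities

/-! ### Level curves in conformal coordinates and the case of equality. -/

section LevelCurves

variable {D : Set ℂ} {ψ l : ℂ → ℂ} {r : ℝ}

lemma smul_mem_closedDisc (hr : r ∈ Ioc 0 1) {w : ℂ} (hw : w ∈ closedDisc) :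
    (r : ℂ) * w ∈ closedDisc := by
  rw [mem_closedBall_zero_iff] at hw ⊢
  rw [norm_mul, norm_real, Real.norm_of_nonneg hr.1.le]
  exact mul_le_one₀ hr.2 (norm_nonneg w) hw

lemma discDeriv_scale (hψ : ContDiffOn ℂ ∞ ψ closedDisc) (hr : r ∈ Ioc 0 1) {w : ℂ}
    (hw : w ∈ closedDisc) :
    discDeriv (fun w => ψ (r * w)) w = discDeriv ψ (r * w) * r := by
  refine discDeriv_eq hw ?_
  have h1 := hasDerivWithinAt_discDeriv hψ (smul_mem_closedDisc hr hw)
  have h2 : HasDerivWithinAt (fun w : ℂ => (r : ℂ) * w) r closedDisc w := by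
    simpa using (hasDerivWithinAt_id w closedDisc).const_mul (r : ℂ)
  exact h1.comp w h2 fun v hv => smul_mem_closedDisc hr hv

lemma IsConformalParam.isDiscEmbedding_scale (h : IsConformalParam ψ D) (hr : r ∈ Ioc 0 1) :
    IsDiscEmbedding fun w => ψ (r * w) where
  smooth := h.smooth.comp (contDiffOn_const.mul contDiffOn_id) fun _ hw => smul_mem_closedDisc hr hw
  deriv_ne w hw := by
    rw [discDeriv_scale h.smooth hr hw]
    exact mul_ne_zero (h.deriv_ne _ (smul_mem_closedDisc hr hw)) (by exact_mod_cast hr.1.ne')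
  injOn v hv w hw hvw := mul_left_cancel₀ (by exact_mod_cast hr.1.ne' : (r : ℂ) ≠ 0)
    (h.injOn (smul_mem_closedDisc hr hv) (smul_mem_closedDisc hr hw) hvw)

lemma IsConformalParam.differentiableOn (h : IsConformalParam ψ D) :
    DifferentiableOn ℂ ψ (Metric.ball 0 1) :=
  (h.smooth.differentiableOn (by simp)).mono Metric.ball_subset_closedBall

lemma IsConformalParam.eqOn_closedDisc (h : IsConformalParam ψ D) {α : ℂ}
    (he : ∀ w ∈ Metric.ball (0 : ℂ) 1, ψ w = α * w) : ∀ w ∈ closedDisc, ψ w = α * w := by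
  have h1 : EqOn ψ (fun w => α * w) (Metric.ball 0 1) := he
  exact h1.of_subset_closure h.smooth.continuousOn (continuous_const.mul continuous_id).continuousOn
    Metric.ball_subset_closedBall closedDisc_subset_closure

lemma IsConformalParam.isCenteredCircle_of_linear (h : IsConformalParam ψ D) {α : ℂ} (hα : α ≠ 0)
    (he : ∀ w ∈ closedDisc, ψ w = α * w) : IsCenteredCircle (frontier D) := by
  refine ⟨‖α‖, norm_pos_iff.2 hα, ?_⟩
  rw [← h.image_sphere]
  ext z
  rw [mem_sphere_zero_iff_norm]
  constructor
  · rintro ⟨w, hw, rfl⟩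
    rw [he w (Metric.sphere_subset_closedBall hw), norm_mul, mem_sphere_zero_iff_norm.1 hw, mul_one]
  · intro hz
    have hs : z / α ∈ Metric.sphere (0 : ℂ) 1 := by
      rw [mem_sphere_zero_iff_norm, norm_div, hz, div_self (norm_ne_zero_iff.2 hα)]
    exact ⟨z / α, hs, by rw [he _ (Metric.sphere_subset_closedBall hs), mul_div_cancel₀ _ hα]⟩

/-- The quotient `ψ w / w` has no zeros and constant modulus on the unit circle. The maximum
principle for it and for its inverse makes its modulus maximal at the origin, so it is constant. -/
lemma IsConformalParam.linear_of_isCenteredCircle (h : IsConformalParam ψ D)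
    (hc : IsCenteredCircle (frontier D)) : ∃ α : ℂ, ∀ w ∈ closedDisc, ψ w = α * w := by
  obtain ⟨R, hR, hfr⟩ := hc
  have hcl : closure (Metric.ball (0 : ℂ) 1) = closedDisc := closure_ball 0 one_ne_zero
  have hnhds : Metric.ball (0 : ℂ) 1 ∈ 𝓝 0 := Metric.ball_mem_nhds 0 one_pos
  have hnhds' : closedDisc ∈ 𝓝 (0 : ℂ) := Metric.closedBall_mem_nhds 0 one_pos
  have hψw : ∀ w, ψ w = dslope ψ 0 w * w := fun w => by
    have := sub_smul_dslope ψ 0 w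
    rw [sub_zero, smul_eq_mul, h.map_zero, sub_zero] at this
    rw [← this, mul_comm]
  set k := dslope ψ 0 with hk
  have hkd : DiffContOnCl ℂ k (Metric.ball 0 1) := by
    refine ⟨(differentiableOn_dslope hnhds).2 h.differentiableOn, ?_⟩
    rw [hcl]
    exact (continuousOn_dslope hnhds').2 ⟨h.smooth.continuousOn,
      h.differentiableOn.differentiableAt hnhds⟩
  have hk0 : ∀ w ∈ closedDisc, k w ≠ 0 := by
    intro w hw
    rcases eq_or_ne w 0 with rfl | hne
    · rw [hk, dslope_same, ← derivWithin_eq_deriv (Metric.mem_ball_self one_pos)]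
      exact h.deriv_ne 0 hw
    · intro h0
      refine h.ne_zero hw hne ?_
      rw [hψw, h0, zero_mul]
  have hkR : ∀ w ∈ frontier (Metric.ball (0 : ℂ) 1), ‖k w‖ = R := by
    intro w hw
    rw [frontier_ball 0 one_ne_zero] at hw
    have h1 : ψ w ∈ frontier D := h.image_sphere ▸ mem_image_of_mem ψ hw
    rw [hfr, mem_sphere_zero_iff_norm, hψw, norm_mul, mem_sphere_zero_iff_norm.1 hw, mul_one] at h1
    exact h1
  have hle : ∀ w ∈ closedDisc, ‖k w‖ ≤ R := fun w hw =>
    norm_le_of_forall_mem_frontier_norm_le Metric.isBounded_ball hkd (fun z hz => (hkR z hz).le)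
      (hcl ▸ hw)
  have hge : R ≤ ‖k 0‖ := by
    have h0 : (0 : ℂ) ∈ closedDisc := Metric.mem_closedBall_self zero_le_one
    have := norm_le_of_forall_mem_frontier_norm_le Metric.isBounded_ball
      (hkd.inv fun w hw => hk0 w (hcl ▸ hw)) (C := R⁻¹)
      (fun z hz => by rw [Pi.inv_apply, norm_inv, hkR z hz]) (hcl ▸ h0)
    rw [Pi.inv_apply, norm_inv] at this
    exact (inv_le_inv₀ (norm_pos_iff.2 (hk0 0 h0)) hR).1 this
  have hconst := eqOn_of_isPreconnected_of_isMaxOn_norm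
    (convex_ball (0 : ℂ) 1).isPreconnected Metric.isOpen_ball hkd.differentiableOn
    (Metric.mem_ball_self one_pos)
    (fun w hw => (hle w (Metric.ball_subset_closedBall hw)).trans hge)
  refine ⟨k 0, h.eqOn_closedDisc fun w hw => ?_⟩
  rw [hψw, hconst hw]
  rfl

/-- A constant derivative makes `ψ` linear on the disc of radius `r` only; the identity theorem
carries this to the whole disc. Thus equality on one level curve determines `∂D`. -/
lemma IsConformalParam.linear_of_scale (h : IsConformalParam ψ D) (hr : r ∈ Ioc 0 1) {β : ℂ}
    (hd : ∀ w ∈ closedDisc, discDeriv (fun w => ψ (r * w)) w = β) :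
    ∀ w ∈ closedDisc, ψ w = β / r * w := by
  have hr0 : (r : ℂ) ≠ 0 := by exact_mod_cast hr.1.ne'
  have h1 : ∀ w ∈ closedDisc, ψ (r * w) - β * w = 0 := by
    intro w hw
    have := eq_of_discDeriv_eq_zero (h := fun w => ψ (r * w) - β * w) (fun v hv => by
      have h2 := hasDerivWithinAt_discDeriv (h.isDiscEmbedding_scale hr).smooth hv
      rw [hd v hv] at h2
      simpa using! h2.sub ((hasDerivWithinAt_id v closedDisc).const_mul β)) w hw
    simpa [h.map_zero] using this
  refine h.eqOn_closedDisc ?_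
  have ha : AnalyticOnNhd ℂ ψ (Metric.ball 0 1) := h.differentiableOn.analyticOnNhd Metric.isOpen_ball
  have hb : AnalyticOnNhd ℂ (fun w => β / r * w) (Metric.ball 0 1) :=
    (differentiable_id.const_mul _).differentiableOn.analyticOnNhd Metric.isOpen_ball
  refine ha.eqOn_of_preconnected_of_eventuallyEq hb (convex_ball (0 : ℂ) 1).isPreconnected
    (Metric.mem_ball_self one_pos) ?_
  filter_upwards [Metric.ball_mem_nhds (0 : ℂ) hr.1] with w hw
  have hm : w / r ∈ closedDisc := by
    rw [mem_closedBall_zero_iff, norm_div, norm_real, Real.norm_of_nonneg hr.1.le,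
      div_le_one hr.1]
    exact (mem_ball_zero_iff.1 hw).le
  have h2 := sub_eq_zero.1 (h1 _ hm)
  rw [mul_div_cancel₀ _ hr0] at h2
  rw [h2]
  ring

/-- The logarithm of the derivative of a level parametrization is constant exactly for centred circles. -/
lemma IsConformalParam.discDeriv_log_eq_zero_iff (h : IsConformalParam ψ D) (hr : r ∈ Ioc 0 1)
    (hl : ContDiffOn ℂ ∞ l closedDisc)
    (he : ∀ w ∈ closedDisc, exp (l w) = discDeriv (fun w => ψ (r * w)) w) :
    (∀ w ∈ closedDisc, discDeriv l w = 0) ↔ IsCenteredCircle (frontier D) := by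
  have hr0 : (r : ℂ) ≠ 0 := by exact_mod_cast hr.1.ne'
  constructor
  · intro h0
    have hconst := eq_of_discDeriv_eq_zero (h := l) fun w hw => by
      have := hasDerivWithinAt_discDeriv hl hw
      rwa [h0 w hw] at this
    have hlin := h.linear_of_scale hr (β := exp (l 0)) fun w hw => by rw [← he w hw, hconst w hw]
    exact h.isCenteredCircle_of_linear (div_ne_zero (exp_ne_zero _) hr0) hlin
  · intro hc w hw
    obtain ⟨α, hα⟩ := h.linear_of_isCenteredCircle hc
    have h1 : ∀ w ∈ closedDisc, exp (l w) = α * r := by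
      intro v hv
      rw [he v hv]
      refine discDeriv_eq hv ?_
      have h2 : HasDerivWithinAt (fun w : ℂ => α * r * w) (α * r) closedDisc v := by
        simpa using (hasDerivWithinAt_id v closedDisc).const_mul (α * r)
      refine h2.congr (fun u hu => ?_) ?_
      · rw [hα _ (smul_mem_closedDisc hr hu), mul_assoc]
      · rw [hα _ (smul_mem_closedDisc hr hv), mul_assoc]
    have h3 := discDeriv_eq_zero_of_const h1 hw
    have h4 : discDeriv (fun w => exp (l w)) w = exp (l w) * discDeriv l w :=
      discDeriv_eq hw (hasDerivWithinAt_discDeriv hl hw).cexp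
    rw [h4] at h3
    exact (mul_eq_zero.1 h3).resolve_left (exp_ne_zero _)

variable {G : ℂ → ℝ} {Φ φ a : ℝ}

/-- Nonempty level sets are the images of circles about the origin. -/
lemma IsConformalParam.exists_levelSet_eq (h : IsConformalParam ψ D) (hΦ : Φ ≠ 0)
    (hG : ∀ w ∈ closedDisc, w ≠ 0 → G (ψ w) = a - Φ / (2 * Real.pi) * Real.log ‖w‖)
    (hφ : (levelSet D G φ).Nonempty) :
    ∃ r ∈ Ioc (0 : ℝ) 1, levelSet D G φ = (fun w => ψ (r * w)) '' Metric.sphere 0 1 := by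
  have hq : Φ / (2 * Real.pi) ≠ 0 := div_ne_zero hΦ Real.two_pi_pos.ne'
  have hmem : ∀ z ∈ levelSet D G φ, ∃ w ∈ closedDisc, w ≠ 0 ∧ ψ w = z := by
    rintro z ⟨⟨hz, hz0⟩, -⟩
    rw [← h.image_closedDisc] at hz
    obtain ⟨w, hw, rfl⟩ := hz
    exact ⟨w, hw, fun h0 => hz0 (by rw [h0, h.map_zero]; rfl), rfl⟩
  obtain ⟨z₀, hz₀⟩ := hφ
  obtain ⟨w₀, hw₀, hne, rfl⟩ := hmem _ hz₀
  have hφ₀ : G (ψ w₀) = φ := hz₀.2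
  have hr : ‖w₀‖ ∈ Ioc (0 : ℝ) 1 := ⟨norm_pos_iff.2 hne, mem_closedBall_zero_iff.1 hw₀⟩
  have hr0 : (‖w₀‖ : ℂ) ≠ 0 := by exact_mod_cast hr.1.ne'
  refine ⟨‖w₀‖, hr, ?_⟩
  ext z
  constructor
  · intro hz
    obtain ⟨w, hw, hw0, rfl⟩ := hmem z hz
    have h1 : G (ψ w) = φ := hz.2
    rw [← hφ₀, hG w hw hw0, hG w₀ hw₀ hne, sub_right_inj, mul_right_inj' hq] at h1
    have h2 := Real.log_injOn_pos (norm_pos_iff.2 hw0) (norm_pos_iff.2 hne) h1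
    refine ⟨w / ‖w₀‖, ?_, ?_⟩
    · rw [mem_sphere_zero_iff_norm, norm_div, norm_real, norm_norm, h2, div_self hr.1.ne']
    · simp only [mul_div_cancel₀ _ hr0]
  · rintro ⟨w, hw, rfl⟩
    have hw1 := mem_sphere_zero_iff_norm.1 hw
    have hwm := smul_mem_closedDisc hr (Metric.sphere_subset_closedBall hw)
    have hwn : ‖(‖w₀‖ : ℂ) * w‖ = ‖w₀‖ := by rw [norm_mul, norm_real, norm_norm, hw1, mul_one]
    have hw0 : (‖w₀‖ : ℂ) * w ≠ 0 := by rw [← norm_pos_iff, hwn]; exact hr.1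
    refine ⟨⟨?_, h.ne_zero hwm hw0⟩, ?_⟩
    · rw [← h.image_closedDisc]
      exact mem_image_of_mem ψ hwm
    · rw [hG _ hwm hw0, hwn, ← hφ₀, hG w₀ hw₀ hne]

/-- The factor `|r w| = r` in the gradient is exactly the one produced by differentiating `ψ (r w)`.
-/
lemma IsConformalParam.norm_gradientWithin (h : IsConformalParam ψ D)
    (hg : ∀ w ∈ closedDisc, w ≠ 0 → gradientWithin G (closure D) (ψ w) =
      conj (-(Φ / (2 * Real.pi) : ℝ) / (w * derivWithin ψ closedDisc w)))
    (hr : r ∈ Ioc 0 1) {w : ℂ} (hw : w ∈ Metric.sphere (0 : ℂ) 1) :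
    ‖gradientWithin G (closure D) (ψ (r * w))‖ =
      |Φ| / (2 * Real.pi) / ‖discDeriv (fun w => ψ (r * w)) w‖ := by
  have hwd := Metric.sphere_subset_closedBall hw
  have hr0 : (r : ℂ) ≠ 0 := by exact_mod_cast hr.1.ne'
  have hw1 := mem_sphere_zero_iff_norm.1 hw
  have hw0 : w ≠ 0 := by rw [← norm_pos_iff, hw1]; exact one_pos
  rw [hg _ (smul_mem_closedDisc hr hwd) (mul_ne_zero hr0 hw0), discDeriv_scale h.smooth hr hwd,
    RCLike.norm_conj, norm_div, norm_neg, norm_real, norm_mul, norm_mul, norm_mul, hw1,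
    Real.norm_eq_abs, abs_div, abs_of_pos Real.two_pi_pos]
  congr 1
  ring

end LevelCurves

end GreenLevel

end

theorem theorem2 (D : Set ℂ) (hD : GreenLevel.IsSmoothJordanInterior D)
    (Φ : ℝ) (hΦ : Φ ≠ 0) (G : ℂ → ℝ) (hG : GreenLevel.IsGreen D Φ G)
    (φ : ℝ) (hφ : (GreenLevel.levelSet D G φ).Nonempty) :
    GreenLevel.IsSmoothJordanCurve (GreenLevel.levelSet D G φ) ∧
    (∀ z ∈ GreenLevel.levelSet D G φ, gradientWithin G (closure D) z ≠ 0) ∧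
    ∀ c : ℝ → ℂ, GreenLevel.IsPosParam c (GreenLevel.levelSet D G φ) →
    ∀ κ E : ℝ → ℝ, (κ = fun t => GreenLevel.curvature c t) →
      (E = fun t => GreenLevel.gradNorm D G (c t)) →
    ∀ L : ℝ, L = GreenLevel.arcLength c →
      ContDiff ℝ ∞ E ∧
      (GreenLevel.cov c (fun t => κ t / E t) E ≤ 0 ∧
        (GreenLevel.cov c (fun t => κ t / E t) E = 0 ↔
          GreenLevel.IsCenteredCircle (frontier D))) ∧
      (GreenLevel.cov c (fun t => κ t / (2 * Real.pi)) (fun t => Real.log (E t * L / |Φ|)) ≤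
          GreenLevel.cov c (fun t => E t / |Φ|) (fun t => Real.log (E t * L / |Φ|)) ∧
        (GreenLevel.cov c (fun t => κ t / (2 * Real.pi)) (fun t => Real.log (E t * L / |Φ|)) =
          GreenLevel.cov c (fun t => E t / |Φ|) (fun t => Real.log (E t * L / |Φ|)) ↔
          GreenLevel.IsCenteredCircle (frontier D))) ∧
      (0 ≤ GreenLevel.avg c (fun t =>
          GreenLevel.tangentialDeriv c (fun u => κ u / E u) t *
            GreenLevel.tangentialDeriv c (fun u => 1 / E u) t) ∧
        (GreenLevel.avg c (fun t =>
          GreenLevel.tangentialDeriv c (fun u => κ u / E u) t *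
            GreenLevel.tangentialDeriv c (fun u => 1 / E u) t) = 0 ↔
          GreenLevel.IsCenteredCircle (frontier D))) ∧
      (2 * Real.pi / |Φ| * GreenLevel.avg c (fun t => 1 / E t) ≤
          GreenLevel.avg c (fun t => κ t / E t ^ 2) ∧
        (GreenLevel.avg c (fun t => κ t / E t ^ 2) =
          2 * Real.pi / |Φ| * GreenLevel.avg c (fun t => 1 / E t) ↔
          GreenLevel.IsCenteredCircle (frontier D))) := by
  obtain ⟨a, ψ, hψ, hGψ, hgrad⟩ := hG.exists_conformalParam hD hΦ
  obtain ⟨r, hr, hlev⟩ := hψ.exists_levelSet_eq hΦ hGψ hφ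
  have hχ := hψ.isDiscEmbedding_scale hr
  have hnorm := fun w hw => hψ.norm_gradientWithin (w := w) hgrad hr hw
  rw [hlev]
  refine ⟨hχ.isSmoothJordanCurve, ?_, ?_⟩
  · rintro z ⟨w, hw, rfl⟩
    rw [← norm_ne_zero_iff, hnorm w hw]
    have h1 := abs_ne_zero.2 hΦ
    have h2 := norm_ne_zero_iff.2 (hχ.deriv_ne w (Metric.sphere_subset_closedBall hw))
    have h3 := Real.pi_ne_zero
    positivity
  intro c hc κ E hκ hE L hL
  obtain ⟨θ, hθ, hcθ⟩ := hχ.exists_isAngle hc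
  obtain ⟨l, hl, he⟩ := GreenLevel.exists_log (GreenLevel.contDiffOn_discDeriv hχ.smooth)
    hχ.deriv_ne
  have hs := GreenLevel.hasSpeed_curve hχ.smooth hl he hθ hcθ
  have hκ' : ∀ t, κ t = (1 + GreenLevel.excess l (θ t)) / GreenLevel.speed l (θ t) := fun t => by
    rw [hκ]
    exact GreenLevel.curvature_eq hχ.smooth hl he hθ hcθ t
  have hE' : ∀ t, E t = |Φ| / (2 * Real.pi) / GreenLevel.speed l (θ t) := fun t => by
    rw [hE, GreenLevel.speed, ← Complex.norm_exp, he _ (GreenLevel.circleMap_one_mem _),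
      ← hnorm (circleMap 0 1 (θ t)) (by simp), ← hcθ]
    rfl
  have hq : 0 < |Φ| / (2 * Real.pi) := div_pos (abs_pos.2 hΦ) Real.two_pi_pos
  -- The four equality conditions all become `l' = 0`, the form in which the energy arguments
  -- deliver them.
  rw [← hψ.discDeriv_log_eq_zero_iff hr hl he]
  refine ⟨?_, GreenLevel.cov_gradNorm_le hs hl hq hκ' hE', GreenLevel.cov_log_le hs hl hΦ hκ' hE' hL,
    GreenLevel.avg_tangentialDeriv_nonneg hs hl hq hκ' hE',
    GreenLevel.avg_inv_gradNorm_le hs hl hΦ hκ' hE'⟩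
  rw [funext hE']
  exact contDiff_const.div (GreenLevel.contDiff_speed hl hθ.smooth)
    fun t => (GreenLevel.speed_pos l _).ne'
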